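/- Let $M$ be a compact connected smooth Riemannian manifold of dimension $d\ge 1$, let $r\ge 1$ be an integer and let $\phi:M\to M$ be a $C^r$ map such that $D\phi(x):T_xM\to T_{\phi(x)}M$ is invertible for every $x\in M$. The set $\phi^{-1}(y)$ is finite and its cardinality, denoted $\deg(\phi)$, does not depend on $y\in M$. For $x \in M$ and $n\ge 1$ let $J(\phi^n,x)=|\det D\phi^n(x)|$, computed in orthonormal bases of the tangent spaces, and $E(\phi^n,x)=\inf\{\|D\phi^n(x)v\| : v\in T_xM,\ \|v\|=1\}$. Define the expansion rate and, for integers $k\ge 0$, the $k$-expansion volume rate of $\phi$ by $$\mathcal E(\phi)=\lim_{n\to\infty}\frac1n\log\Big(\min_{x\in M}E(\phi^n,x)\Big),\qquad \mathcal{EV}_k(\phi)=\lim_{n\to\infty}\frac1n\min_{x\in M}\Big[\log J(\phi^n,x)+k\log E(\phi^n,x)\Big];$$ these limits exist and are finite. Let $C^{r-1}(M)$ be the space of real $C^{r-1}$ functions on $M$, with any norm inducing its usual ($C^{r-1}$) Banach space topology. The transfer operator $$\mathcal L_\phi(\rho)(y)=\sum_{x\in\phi^{-1}(y)}\frac{\rho(x)}{J(\phi,x)}$$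 is a well-defined bounded linear operator on $C^{r-1}(M)$, and its spectral radius $\mathcal R(\mathcal L_\phi,C^{r-1}(M))=\lim_{n\to\infty}\|\mathcal L_\phi^n\|_{C^{r-1}(M)}^{1/n}$ exists. Moreover: (i) if $\mathcal E(\phi)>0$, then $\mathcal R(\mathcal L_\phi,C^{r-1}(M))=1$; (ii) if $\mathcal E(\phi)\le 0$, then $$1\le \mathcal R(\mathcal L_\phi,C^{r-1}(M))\le \deg(\phi)\,\max_{0\le k\le r-1}e^{-\mathcal{EV}_k(\phi)}.$$ -/

import Mathlib

open Bundle Filter Topology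
open scoped Manifold ContDiff

noncomputable section

namespace RuelleTransfer

section Geometry

/-! Differential quantities of a self-map of a `d`-dimensional Riemannian manifold `M`. The Riemannian
metric is the `RiemannianBundle` structure on the tangent bundle: it provides the inner product and
the norm on each tangent space `TangentSpace (𝓡 d) x`. -/

variable {d : ℕ} {M : Type*} [TopologicalSpace M] [ChartedSpace (EuclideanSpace ℝ (Fin d)) M]
  [RiemannianBundle (fun x : M ↦ TangentSpace (𝓡 d) x)]

instance finiteDimensional_tangentSpace (x : M) :
    FiniteDimensional ℝ (TangentSpace (𝓡 d) x) :=
  inferInstanceAs (FiniteDimensional ℝ (EuclideanSpace ℝ (Fin d)))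

/-- An orthonormal basis of the tangent space at `x`. -/
def tangentBasis (x : M) : OrthonormalBasis (Fin d) ℝ (TangentSpace (𝓡 d) x) :=
  (stdOrthonormalBasis ℝ (TangentSpace (𝓡 d) x)).reindex
    (finCongr (finrank_euclideanSpace_fin (𝕜 := ℝ) (n := d)))

/-- The Jacobian `J(φ, x) = |det Dφ(x)|`, the determinant being computed in orthonormal bases of the
tangent spaces at `x` and at `φ x`. -/
def jacobian (φ : M → M) (x : M) : ℝ :=
  |(LinearMap.toMatrix (tangentBasis x).toBasis (tangentBasis (φ x)).toBasis
      (mfderiv (𝓡 d) (𝓡 d) φ x).toLinearMap).det|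

/-- The expansion constant `E(φ, x) = inf {‖Dφ(x) v‖ : v ∈ T_x M, ‖v‖ = 1}`. -/
def expansionConst (φ : M → M) (x : M) : ℝ :=
  ⨅ v : {v : TangentSpace (𝓡 d) x // ‖v‖ = 1}, ‖mfderiv (𝓡 d) (𝓡 d) φ x v.1‖

/-- `n ↦ (1/n) log (min_x E(φ^n, x))`. -/
def expansionSeq (φ : M → M) (n : ℕ) : ℝ :=
  (1 / (n : ℝ)) * Real.log (⨅ x : M, expansionConst (d := d) φ^[n] x)

/-- The (logarithmic) expansion rate `ℰ(φ) = lim (1/n) log (min_x E(φ^n, x))`. -/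
def expansionRate (φ : M → M) : ℝ := limUnder atTop (expansionSeq (d := d) φ)

/-- `n ↦ (1/n) min_x [log J(φ^n, x) + k log E(φ^n, x)]`. -/
def expansionVolumeSeq (φ : M → M) (k n : ℕ) : ℝ :=
  (1 / (n : ℝ)) * ⨅ x : M, (Real.log (jacobian (d := d) φ^[n] x)
    + (k : ℝ) * Real.log (expansionConst (d := d) φ^[n] x))

/-- The `k`-expansion volume rate
`ℰ𝒱_k(φ) = lim (1/n) min_x [log J(φ^n, x) + k log E(φ^n, x)]`. -/
def expansionVolumeRate (φ : M → M) (k : ℕ) : ℝ :=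
  limUnder atTop (expansionVolumeSeq (d := d) φ k)

/-- `(ℒ_φ ρ)(y) = ∑_{x ∈ φ⁻¹(y)} ρ(x) / J(φ, x)`, as a function (the fibres of a local
diffeomorphism of a compact manifold are finite). -/
def transfer (φ : M → M) (ρ : M → ℝ) (y : M) : ℝ :=
  ∑ᶠ x ∈ φ ⁻¹' {y}, ρ x / jacobian (d := d) φ x

end Geometry

/-- The number of preimages of a point; it does not depend on the point for a local diffeomorphism
of a compact connected manifold. -/
def degree {M : Type*} [Nonempty M] (φ : M → M) : ℕ :=
  (φ ⁻¹' {Classical.arbitrary M}).ncard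

section CkNorm

variable {d : ℕ} {M : Type*} [TopologicalSpace M] [ChartedSpace (EuclideanSpace ℝ (Fin d)) M]

/-- The space `C^k(M)` of real `C^k` functions on `M`. -/
abbrev CkSpace (d : ℕ) (M : Type*) [TopologicalSpace M]
    [ChartedSpace (EuclideanSpace ℝ (Fin d)) M] (k : ℕ) : Type _ :=
  ContMDiffMap (𝓡 d) 𝓘(ℝ, ℝ) M ℝ (k : WithTop ℕ∞)

/-- A finite family of smooth charts whose images contain the closed ball of radius 2 and such that
the preimages of the open unit ball cover `M`. -/
structure IsNormAtlas {m : ℕ} (e : Fin m → OpenPartialHomeomorph M (EuclideanSpace ℝ (Fin d))) :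
    Prop where
  smooth : ∀ i, e i ∈ IsManifold.maximalAtlas (𝓡 d) ∞ M
  ball_subset : ∀ i, Metric.closedBall 0 2 ⊆ (e i).target
  cover : ∀ x : M, ∃ i, x ∈ (e i).source ∧ e i x ∈ Metric.ball 0 1

/-- The `C^k` norm induced by a finite atlas: the sup norm plus, for `1 ≤ j ≤ k`, the supremum over
the charts `α` and over the closed unit ball of `‖D^j(ρ ∘ α⁻¹)‖`. -/
def atlasNorm {m : ℕ} (e : Fin m → OpenPartialHomeomorph M (EuclideanSpace ℝ (Fin d))) (k : ℕ)
    (ρ : M → ℝ) : ℝ :=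
  (⨆ x : M, |ρ x|) + ∑ j ∈ Finset.Icc 1 k,
    ⨆ p : Fin m × Metric.closedBall (0 : EuclideanSpace ℝ (Fin d)) 1,
      ‖iteratedFDeriv ℝ j (ρ ∘ (e p.1).symm) p.2‖

/-- `N` is a norm on `C^k(M)` that induces the `C^k` topology, that is, which is equivalent to the
`C^k` norm induced by a finite atlas. (`N` is then positive definite and complete.) -/
def IsCkNorm (k : ℕ) (N : Seminorm ℝ (CkSpace d M k)) : Prop :=
  ∃ (m : ℕ) (e : Fin m → OpenPartialHomeomorph M (EuclideanSpace ℝ (Fin d))), IsNormAtlas e ∧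
    ∃ a b : ℝ, 0 < a ∧ 0 < b ∧
      ∀ ρ : CkSpace d M k, a * atlasNorm e k ρ ≤ N ρ ∧ N ρ ≤ b * atlasNorm e k ρ

end CkNorm

section Operator

variable {V : Type*} [AddCommGroup V] [Module ℝ V]

/-- The operator `A` is bounded for the norm `N`. -/
def IsBoundedOp (N : Seminorm ℝ V) (A : Module.End ℝ V) : Prop :=
  ∃ C : ℝ, ∀ v, N (A v) ≤ C * N v

/-- The operator norm `sup {N (A v) : N v ≤ 1}`. -/
def opNorm (N : Seminorm ℝ V) (A : Module.End ℝ V) : ℝ :=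
  ⨆ v : {v : V // N v ≤ 1}, N (A v.1)

/-- `n ↦ ‖A^n‖^{1/n}`. -/
def radiusSeq (N : Seminorm ℝ V) (A : Module.End ℝ V) (n : ℕ) : ℝ :=
  opNorm N (A ^ n) ^ (1 / (n : ℝ))

/-- The spectral radius `lim ‖A^n‖^{1/n}`. -/
def specRadius (N : Seminorm ℝ V) (A : Module.End ℝ V) : ℝ := limUnder atTop (radiusSeq N A)

end Operator

end RuelleTransfer

end

/-!
The spectral radius is computed from the powers `ℒ_φ^n`, which are the transfer operators of the
iterates `φ^n` (`IsRegularMap.transferOp_pow`). Three facts about transfer operators carry the proof.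

*Seminorm estimate.* Let `p_k` be the supremum, over the charts of a finite atlas, of the norms of
the derivatives of order `k`. Near a point `ℒ_φ ρ` is the sum of the functions `(ρ / J) ∘ b` over the
local inverse branches `b` of `φ`. By the formulas of Leibniz and Faà di Bruno, the only
derivative of order `k` of `ρ` in the `k`-th derivative of such a term is multiplied by
`J⁻¹ ‖Db‖ ^ k ≤ J⁻¹ E⁻ᵏ`, up to a constant. So
`p_k (ℒ_φ ρ) ≤ K S p_k ρ + D ∑_{j < k} p_j ρ`, where `S` bounds the sums of `J⁻¹ E⁻ᵏ` over the
fibres and `K` depends on the atlas only (`IsNormAtlas.exists_seminorm_estimate`). An operator that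
is triangular in this sense has its spectral radius bounded by the diagonal coefficient
`K S`, since the seminorms can be rescaled so as to make the other terms negligible
(`specRadius_pow_le_of_triangular`). Applied to `φ^n`, this gives `R ^ n ≤ K S_n`, with `K`
independent of `n`. A fibre of `φ^n` has `deg(φ) ^ n` points, and the definition of the rates bounds
`J(φ^n)⁻¹ E(φ^n)⁻ᵏ` by `exp (- n EV_k + o(n))`, so taking roots yields the upper bound in the general
case (`IsRegularMap.specRadius_le_degree_mul`).

*Invariance of the volume.* By the change of variables formula, `∫ ℒ_φ 1 = ∫ 1`
(`IsNormAtlas.volumeIntegral_wtransfer_one`). Hence `sup ℒ_φ^n 1 ≥ 1` for all `n`, and `R ≥ 1`. The same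
lower bound for the norms of the powers turns submultiplicativity into the existence of the
limit that defines `R`.

*Bounded distortion.* If the expansion rate is positive, some iterate `ψ` expands all tangent
vectors by a factor `λ > 1`. Then `E(ψ^n) ≥ 1`, so `S_n ≤ sup ℒ_ψ^n 1`, and it remains to see that
this supremum grows subexponentially. When `r = 1` the weight `1 / J` is merely continuous; it is
replaced by a `C^1` weight `w` with ratio at most `s` to `1 / J`, where `s > 1` is arbitrary. If
`‖D log w‖ ≤ G`, the transfer operator with weight `w` maps the cone `‖D log v‖ ≤ Q` to the cone
`‖D log v‖ ≤ (G + Q) / λ`, so it preserves the cone with `Q = G / (λ - 1)`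
(`IsNormAtlas.inLogLipschitzCone_wtransfer`). The iterates of `1` therefore vary by a bounded factor
on each chart ball, and the invariance of the volume prevents them from being large on a whole ball.
This gives `sup ℒ_ψ^n 1 ≤ C s ^ (2 n)` (`IsNormAtlas.exists_transfer_iterate_one_le`), hence `R ≤ 1`
(`IsRegularMap.specRadius_le_one`).

The volume appears only through the functional `volumeIntegral`, an integral over disjoint pieces
of the chart balls against the density of the metric. Smoothness of this density, and hence of the
Jacobian, follows from its expression by the Gram matrix of the coordinate vectors
(`contDiffOn_density`).
-/

noncomputable section

namespace RuelleTransfer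

/-! ### Leading terms of the derivatives of products and compositions -/

section Leading

variable {E F : Type*} [NormedAddCommGroup E] [NormedSpace ℝ E]
  [NormedAddCommGroup F] [NormedSpace ℝ F]

/-- The Leibniz bound at a point for functions that are only regular near this point. -/
lemma norm_iteratedFDeriv_mul_le_of_contDiffAt {k : ℕ} {f g : E → ℝ} {x : E}
    (hf : ContDiffAt ℝ k f x) (hg : ContDiffAt ℝ k g x) :
    ‖iteratedFDeriv ℝ k (fun y ↦ f y * g y) x‖ ≤ ∑ i ∈ Finset.range (k + 1),
      (k.choose i : ℝ) * ‖iteratedFDeriv ℝ i f x‖ * ‖iteratedFDeriv ℝ (k - i) g x‖ := by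
  have key := (hf.eventually (by simp)).and (hg.eventually (by simp))
  obtain ⟨s, hs, hso, hxs⟩ := eventually_nhds_iff.1 key
  have h := norm_iteratedFDerivWithin_mul_le (n := k) (N := k)
    (fun y hy ↦ (hs y hy).1.contDiffWithinAt)
    (fun y hy ↦ (hs y hy).2.contDiffWithinAt) hso.uniqueDiffOn hxs le_rfl
  simpa only [iteratedFDerivWithin_of_isOpen _ hso hxs] using h

/-- In a product `w * g`, the derivatives of top order of `g` come with the factor `w`. -/
lemma norm_iteratedFDeriv_mul_le_leading {k : ℕ} {w g : E → ℝ} {x : E} {B : ℝ}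
    (hw : ContDiffAt ℝ k w x) (hg : ContDiffAt ℝ k g x)
    (hB : ∀ j ≤ k, ‖iteratedFDeriv ℝ j w x‖ ≤ B) :
    ‖iteratedFDeriv ℝ k (fun y ↦ w y * g y) x‖ ≤ |w x| * ‖iteratedFDeriv ℝ k g x‖
      + 2 ^ k * B * ∑ j ∈ Finset.range k, ‖iteratedFDeriv ℝ j g x‖ := by
  have hB0 : 0 ≤ B := (norm_nonneg _).trans (hB 0 (Nat.zero_le _))
  refine (norm_iteratedFDeriv_mul_le_of_contDiffAt hw hg).trans ?_
  rw [Finset.sum_range_succ']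
  rw [add_comm]
  refine add_le_add (by simp) ?_
  rw [← Finset.sum_range_reflect (fun j ↦ ‖iteratedFDeriv ℝ j g x‖), Finset.mul_sum]
  refine Finset.sum_le_sum fun i hi ↦ ?_
  have hi' := Finset.mem_range.1 hi
  rw [show k - (i + 1) = k - 1 - i by omega]
  gcongr
  · exact_mod_cast Nat.choose_le_two_pow k (i + 1)
  · exact hB _ (by omega)

/-- In a composition `f ∘ H`, the derivatives of top order of `f` come with the first derivative
of `H` only. -/
lemma norm_iteratedFDeriv_comp_le_leading {k : ℕ} {f : F → ℝ} {H : E → F} {x : E} {B : ℝ}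
    (hf : ContDiffAt ℝ k f (H x)) (hH : ContDiffAt ℝ k H x) (hB1 : 1 ≤ B)
    (hB : ∀ j, 1 ≤ j → j ≤ k → ‖iteratedFDeriv ℝ j H x‖ ≤ B) :
    ‖iteratedFDeriv ℝ k (f ∘ H) x‖ ≤ Fintype.card (OrderedFinpartition k) *
      (‖iteratedFDeriv ℝ k f (H x)‖ * ‖fderiv ℝ H x‖ ^ k
        + B ^ k * ∑ j ∈ Finset.range k, ‖iteratedFDeriv ℝ j f (H x)‖) := by
  rw [iteratedFDeriv_comp hf hH le_rfl]
  refine (norm_sum_le _ _).trans ?_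
  rw [← nsmul_eq_mul, ← Finset.card_univ]
  refine Finset.sum_le_card_nsmul _ _ _ fun c _ ↦ ?_
  have h1 := c.norm_compAlongOrderedFinpartition_le (ftaylorSeries ℝ f (H x) c.length)
    (fun m ↦ ftaylorSeries ℝ H x (c.partSize m))
  refine h1.trans ?_
  simp only [ftaylorSeries]
  rcases c.length_le.eq_or_lt with hc | hc
  -- the only partition with `k` parts is the one into singletons
  · have h2 : ∀ m, c.partSize m = 1 := by
      intro m
      by_contra hm
      have hs := c.sum_sigma_eq_sum (fun _ ↦ (1 : ℕ))
      simp only [Finset.sum_const, Finset.card_univ, Fintype.card_fin, smul_eq_mul, mul_one] at hs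
      have : ∑ _m : Fin c.length, 1 < ∑ m, c.partSize m := by
        refine Finset.sum_lt_sum (fun i _ ↦ c.partSize_pos i) ⟨m, Finset.mem_univ _, ?_⟩
        have := c.partSize_pos m
        omega
      simp at this
      omega
    have h3 : ∏ i, ‖iteratedFDeriv ℝ (c.partSize i) H x‖ = ‖fderiv ℝ H x‖ ^ k := by
      have h4 : ∀ l, l = 1 → ‖iteratedFDeriv ℝ l H x‖ = ‖fderiv ℝ H x‖ := by
        rintro _ rfl
        exact norm_iteratedFDeriv_one _
      rw [Finset.prod_congr rfl fun i _ ↦ h4 _ (h2 i)]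
      simp [hc]
    rw [h3, hc]
    exact le_add_of_nonneg_right (by positivity)
  · refine le_trans ?_ (le_add_of_nonneg_left (by positivity))
    rw [mul_comm]
    refine mul_le_mul ?_ ?_ (norm_nonneg _) (by positivity)
    · calc ∏ i, ‖iteratedFDeriv ℝ (c.partSize i) H x‖ ≤ ∏ _i : Fin c.length, B :=
            Finset.prod_le_prod (fun _ _ ↦ norm_nonneg _)
              fun i _ ↦ hB _ (c.partSize_pos i) (c.partSize_le i)
        _ = B ^ c.length := by simp
        _ ≤ B ^ k := pow_le_pow_right₀ hB1 c.length_le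
    · exact Finset.single_le_sum (f := fun j ↦ ‖iteratedFDeriv ℝ j f (H x)‖)
        (fun _ _ ↦ norm_nonneg _) (Finset.mem_range.2 hc)

/-- The leading term of the derivative of order `k` of `(w * g) ∘ H`, with a bound of the remainder
in terms of the derivatives of `g` of order less than `k`. -/
lemma exists_norm_iteratedFDeriv_mul_comp_le (k : ℕ) (B : ℝ) : ∃ C : ℝ, 0 ≤ C ∧
    ∀ (w g : F → ℝ) (H : E → F) (x : E), ContDiffAt ℝ k w (H x) → ContDiffAt ℝ k g (H x) →
      ContDiffAt ℝ k H x → (∀ j ≤ k, ‖iteratedFDeriv ℝ j w (H x)‖ ≤ B) →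
      (∀ j, 1 ≤ j → j ≤ k → ‖iteratedFDeriv ℝ j H x‖ ≤ B) →
      ‖iteratedFDeriv ℝ k ((fun y ↦ w y * g y) ∘ H) x‖ ≤ Fintype.card (OrderedFinpartition k) *
        (|w (H x)| * ‖fderiv ℝ H x‖ ^ k) * ‖iteratedFDeriv ℝ k g (H x)‖
        + C * ∑ j ∈ Finset.range k, ‖iteratedFDeriv ℝ j g (H x)‖ := by
  set B' := max B 1
  have hB' : 1 ≤ B' := le_max_right _ _
  set N := (Fintype.card (OrderedFinpartition k) : ℝ)
  have hN : 0 ≤ N := Nat.cast_nonneg _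
  have hB0 : 0 ≤ B' := zero_le_one.trans hB'
  refine ⟨N * (2 ^ k * B' * B' ^ k + B' ^ k * (k * (B' + 2 ^ k * B'))), by positivity, ?_⟩
  intro w g H x hw hg hH hwB hHB
  have hwB' : ∀ j ≤ k, ‖iteratedFDeriv ℝ j w (H x)‖ ≤ B' :=
    fun j hj ↦ (hwB j hj).trans (le_max_left _ _)
  have hHB' : ∀ j, 1 ≤ j → j ≤ k → ‖iteratedFDeriv ℝ j H x‖ ≤ B' :=
    fun j h1 hj ↦ (hHB j h1 hj).trans (le_max_left _ _)
  refine (norm_iteratedFDeriv_comp_le_leading (hw.mul hg) hH hB' hHB').trans ?_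
  rw [mul_assoc N, mul_assoc N, ← mul_add]
  refine mul_le_mul_of_nonneg_left ?_ hN
  set S := ∑ j ∈ Finset.range k, ‖iteratedFDeriv ℝ j g (H x)‖
  have hS : 0 ≤ S := Finset.sum_nonneg fun _ _ ↦ norm_nonneg _
  have h1 := norm_iteratedFDeriv_mul_le_leading hw hg hwB'
  have hd : ‖fderiv ℝ H x‖ ^ k ≤ B' ^ k := by
    rcases Nat.eq_zero_or_pos k with h0 | h0
    · simp [h0]
    · refine pow_le_pow_left₀ (norm_nonneg _) ?_ k
      rw [← norm_iteratedFDeriv_one (𝕜 := ℝ)]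
      exact hHB' 1 le_rfl h0
  have hd0 : 0 ≤ ‖fderiv ℝ H x‖ ^ k := by positivity
  have h2 : ∑ j ∈ Finset.range k, ‖iteratedFDeriv ℝ j (fun y ↦ w y * g y) (H x)‖
      ≤ k * (B' + 2 ^ k * B') * S := by
    have : ∀ j ∈ Finset.range k, ‖iteratedFDeriv ℝ j (fun y ↦ w y * g y) (H x)‖
        ≤ (B' + 2 ^ k * B') * S := by
      intro j hj
      have hjk := Finset.mem_range.1 hj
      have hle : ((j : ℕ) : WithTop ℕ∞) ≤ k := by exact_mod_cast hjk.le
      refine (norm_iteratedFDeriv_mul_le_leading (hw.of_le hle) (hg.of_le hle)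
        fun i hi ↦ hwB' i (hi.trans hjk.le)).trans ?_
      rw [add_mul]
      have hw0 : |w (H x)| ≤ B' := by
        simpa [norm_iteratedFDeriv_zero] using hwB' 0 (Nat.zero_le _)
      refine add_le_add (mul_le_mul hw0 ?_ (norm_nonneg _) hB0) (mul_le_mul ?_ ?_ ?_ ?_)
      · exact Finset.single_le_sum (f := fun j ↦ ‖iteratedFDeriv ℝ j g (H x)‖)
          (fun _ _ ↦ norm_nonneg _) hj
      · gcongr
        norm_num
      · exact Finset.sum_le_sum_of_subset_of_nonneg
          (Finset.range_subset_range.2 hjk.le) fun _ _ _ ↦ norm_nonneg _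
      · exact Finset.sum_nonneg fun _ _ ↦ norm_nonneg _
      · positivity
    refine (Finset.sum_le_card_nsmul _ _ _ this).trans ?_
    simp [mul_assoc]
  calc ‖iteratedFDeriv ℝ k (fun y ↦ w y * g y) (H x)‖ * ‖fderiv ℝ H x‖ ^ k
        + B' ^ k * ∑ j ∈ Finset.range k, ‖iteratedFDeriv ℝ j (fun y ↦ w y * g y) (H x)‖
      ≤ (|w (H x)| * ‖iteratedFDeriv ℝ k g (H x)‖ + 2 ^ k * B' * S) * ‖fderiv ℝ H x‖ ^ k
        + B' ^ k * (k * (B' + 2 ^ k * B') * S) := by gcongr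
    _ = |w (H x)| * ‖fderiv ℝ H x‖ ^ k * ‖iteratedFDeriv ℝ k g (H x)‖
        + 2 ^ k * B' * S * ‖fderiv ℝ H x‖ ^ k + B' ^ k * (k * (B' + 2 ^ k * B') * S) := by ring
    _ ≤ |w (H x)| * ‖fderiv ℝ H x‖ ^ k * ‖iteratedFDeriv ℝ k g (H x)‖
        + 2 ^ k * B' * S * B' ^ k + B' ^ k * (k * (B' + 2 ^ k * B') * S) := by gcongr
    _ = _ := by ring

end Leading

lemma natCast_le_infty (n : ℕ) : (n : WithTop ℕ∞) ≤ ∞ := by exact_mod_cast le_top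

/-! ### The Riemannian metric in charts -/

section Metric

variable {d : ℕ} {M : Type*} [TopologicalSpace M] [ChartedSpace (EuclideanSpace ℝ (Fin d)) M]
  [IsManifold (𝓡 d) ∞ M] [RiemannianBundle (fun x : M ↦ TangentSpace (𝓡 d) x)]
  [IsContMDiffRiemannianBundle (𝓡 d) ∞ (EuclideanSpace ℝ (Fin d))
    (fun x : M ↦ TangentSpace (𝓡 d) x)]

/-- The pull-back of the metric by a map from the model space depends smoothly on the base point
and on the two vectors. -/
lemma contDiffOn_inner_mfderiv {f : EuclideanSpace ℝ (Fin d) → M}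
    {U : Set (EuclideanSpace ℝ (Fin d))} (hU : IsOpen U) {m n : ℕ}
    (hf : ContMDiffOn (𝓡 d) (𝓡 d) (n : WithTop ℕ∞) f U) (hmn : m + 1 ≤ n) :
    ContDiffOn ℝ m (fun q : EuclideanSpace ℝ (Fin d) × EuclideanSpace ℝ (Fin d) ×
      EuclideanSpace ℝ (Fin d) ↦
        inner ℝ (mfderiv (𝓡 d) (𝓡 d) f q.1 q.2.1) (mfderiv (𝓡 d) (𝓡 d) f q.1 q.2.2))
      (U ×ˢ Set.univ) := by
  have : IsContMDiffRiemannianBundle (𝓡 d) (m : WithTop ℕ∞) (EuclideanSpace ℝ (Fin d))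
    (fun x : M ↦ TangentSpace (𝓡 d) x) :=
    IsContMDiffRiemannianBundle.of_le (n := ∞) (by exact_mod_cast le_top)
  have : IsManifold (𝓡 d) 1 M := IsManifold.of_le (n := ∞) (by exact_mod_cast le_top)
  -- the metric is evaluated at two `C^m` maps into the tangent bundle, obtained from the tangent
  -- map of `f`
  have htan := hf.contMDiffOn_tangentMapWithin (m := (m : WithTop ℕ∞)) (by exact_mod_cast hmn)
    hU.uniqueMDiffOn
  have hmk : ContMDiff 𝓘(ℝ, EuclideanSpace ℝ (Fin d) × EuclideanSpace ℝ (Fin d)) (𝓡 d).tangent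
      (m : WithTop ℕ∞)
      (fun q : EuclideanSpace ℝ (Fin d) × EuclideanSpace ℝ (Fin d) ↦
        (⟨q.1, q.2⟩ : TangentBundle (𝓡 d) (EuclideanSpace ℝ (Fin d)))) := by
    have := (contMDiff_tangentBundleModelSpaceHomeomorph_symm (I := 𝓡 d)
      (n := (m : WithTop ℕ∞)))
    rw [modelWithCornersSelf_prod]
    exact this
  have hsec : ∀ p : EuclideanSpace ℝ (Fin d) × EuclideanSpace ℝ (Fin d) ×
      EuclideanSpace ℝ (Fin d) →L[ℝ] EuclideanSpace ℝ (Fin d) × EuclideanSpace ℝ (Fin d),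
      (∀ q, (p q).1 = q.1) →
      ContMDiffOn 𝓘(ℝ, EuclideanSpace ℝ (Fin d) × EuclideanSpace ℝ (Fin d) ×
        EuclideanSpace ℝ (Fin d)) (𝓡 d).tangent (m : WithTop ℕ∞)
        (fun q ↦ tangentMapWithin (𝓡 d) (𝓡 d) f U ⟨(p q).1, (p q).2⟩) (U ×ˢ Set.univ) := by
    intro p hp
    refine htan.comp (hmk.comp p.contDiff.contMDiff).contMDiffOn ?_
    intro q hq
    simpa [hp] using hq.1
  have h1 := hsec ((ContinuousLinearMap.fst _ _ _).prod
    ((ContinuousLinearMap.fst ℝ _ _).comp (ContinuousLinearMap.snd _ _ _))) (fun _ ↦ rfl)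
  have h2 := hsec ((ContinuousLinearMap.fst _ _ _).prod
    ((ContinuousLinearMap.snd ℝ _ _).comp (ContinuousLinearMap.snd _ _ _))) (fun _ ↦ rfl)
  rw [← contMDiffOn_iff_contDiffOn]
  refine (ContMDiffOn.inner_bundle (b := fun q : EuclideanSpace ℝ (Fin d) ×
    EuclideanSpace ℝ (Fin d) × EuclideanSpace ℝ (Fin d) ↦ f q.1) h1 h2).congr ?_
  rintro ⟨p, u, v⟩ hq
  have hp : p ∈ U := hq.1
  have : mfderivWithin (𝓡 d) (𝓡 d) f U p = mfderiv (𝓡 d) (𝓡 d) f p :=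
    mfderivWithin_of_mem_nhds (hU.mem_nhds hp)
  simp only [ContinuousLinearMap.prod_apply, ContinuousLinearMap.coe_fst', this,
    ContinuousLinearMap.coe_comp]
  rfl

/-- On a compact set, the differential of a `C^1` map with injective differentials compares the
Euclidean norm with the Riemannian norm. -/
lemma exists_norm_mfderiv_bounds {f : EuclideanSpace ℝ (Fin d) → M}
    {U K : Set (EuclideanSpace ℝ (Fin d))} (hU : IsOpen U)
    (hf : ContMDiffOn (𝓡 d) (𝓡 d) 1 f U) (hK : IsCompact K) (hKU : K ⊆ U)
    (hinj : ∀ p ∈ K, Function.Injective (mfderiv (𝓡 d) (𝓡 d) f p)) :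
    ∃ c C : ℝ, 0 < c ∧ 0 < C ∧ ∀ p ∈ K, ∀ u : EuclideanSpace ℝ (Fin d),
      c * ‖u‖ ≤ ‖mfderiv (𝓡 d) (𝓡 d) f p u‖ ∧ ‖mfderiv (𝓡 d) (𝓡 d) f p u‖ ≤ C * ‖u‖ := by
  set q : EuclideanSpace ℝ (Fin d) × EuclideanSpace ℝ (Fin d) → ℝ :=
    fun z ↦ ‖mfderiv (𝓡 d) (𝓡 d) f z.1 z.2‖
  have hq : ContinuousOn q (U ×ˢ Set.univ) := by
    have h1 := (contDiffOn_inner_mfderiv (m := 0) (n := 1) hU hf le_rfl).continuousOn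
    have h2 : ContinuousOn (fun z : EuclideanSpace ℝ (Fin d) × EuclideanSpace ℝ (Fin d) ↦
        Real.sqrt (inner ℝ (mfderiv (𝓡 d) (𝓡 d) f z.1 z.2) (mfderiv (𝓡 d) (𝓡 d) f z.1 z.2)))
        (U ×ˢ Set.univ) :=
      Real.continuous_sqrt.comp_continuousOn
        (h1.comp (f := fun z : EuclideanSpace ℝ (Fin d) × EuclideanSpace ℝ (Fin d) ↦
          (z.1, z.2, z.2)) (by fun_prop) fun z hz ↦ ⟨hz.1, Set.mem_univ _⟩)
    refine h2.congr fun z _ ↦ ?_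
    simp only [q]
    rw [real_inner_self_eq_norm_sq, Real.sqrt_sq (norm_nonneg _)]
  -- by homogeneity it suffices to bound the norm on the compact set of unit vectors over `K`
  have hc : IsCompact (K ×ˢ Metric.sphere (0 : EuclideanSpace ℝ (Fin d)) 1) :=
    hK.prod (isCompact_sphere _ _)
  have hq' : ContinuousOn q (K ×ˢ Metric.sphere (0 : EuclideanSpace ℝ (Fin d)) 1) :=
    hq.mono (Set.prod_mono hKU (Set.subset_univ _))
  have hpos : ∀ z ∈ K ×ˢ Metric.sphere (0 : EuclideanSpace ℝ (Fin d)) 1, 0 < q z := by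
    rintro ⟨p, u⟩ ⟨hp, hu⟩
    refine norm_pos_iff.2 fun h0 ↦ ?_
    have : u = 0 := hinj p hp (h0.trans (map_zero _).symm)
    simp [this] at hu
  obtain ⟨c, hc0, hcle⟩ : ∃ c : ℝ, 0 < c ∧
      ∀ z ∈ K ×ˢ Metric.sphere (0 : EuclideanSpace ℝ (Fin d)) 1, c ≤ q z := by
    rcases (K ×ˢ Metric.sphere (0 : EuclideanSpace ℝ (Fin d)) 1).eq_empty_or_nonempty with h | h
    · exact ⟨1, one_pos, by simp [h]⟩
    · obtain ⟨z, hz, hmin⟩ := hc.exists_isMinOn h hq'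
      exact ⟨q z, hpos z hz, fun y hy ↦ hmin hy⟩
  obtain ⟨C, hC⟩ := hc.exists_bound_of_continuousOn hq'
  refine ⟨c, max C 1, hc0, lt_max_of_lt_right one_pos, fun p hp u ↦ ?_⟩
  rcases eq_or_ne u 0 with rfl | hu
  · have : mfderiv (𝓡 d) (𝓡 d) f p (0 : EuclideanSpace ℝ (Fin d)) = 0 := map_zero _
    rw [this]
    simp
  · have hu0 : 0 < ‖u‖ := norm_pos_iff.2 hu
    have hmem : (p, ‖u‖⁻¹ • u) ∈ K ×ˢ Metric.sphere (0 : EuclideanSpace ℝ (Fin d)) 1 :=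
      ⟨hp, by simp [norm_smul, hu0.ne']⟩
    have hq1 : q (p, ‖u‖⁻¹ • u) = ‖u‖⁻¹ * ‖mfderiv (𝓡 d) (𝓡 d) f p u‖ := by
      have : mfderiv (𝓡 d) (𝓡 d) f p (‖u‖⁻¹ • u : EuclideanSpace ℝ (Fin d))
        = ‖u‖⁻¹ • mfderiv (𝓡 d) (𝓡 d) f p u := map_smul (mfderiv (𝓡 d) (𝓡 d) f p) _ _
      simp only [q, this]
      rw [norm_smul, norm_inv, norm_norm]
    have h1 := hcle _ hmem
    have h2 := (le_abs_self _).trans ((hC _ hmem).trans (le_max_left C 1))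
    rw [hq1, inv_mul_eq_div] at h1 h2
    rw [le_div_iff₀ hu0] at h1
    rw [div_le_iff₀ hu0] at h2
    exact ⟨h1, h2⟩

end Metric

/-! ### Jacobian and expansion constant -/

section Pointwise

variable {d : ℕ} {M : Type*} [TopologicalSpace M] [ChartedSpace (EuclideanSpace ℝ (Fin d)) M]
  [RiemannianBundle (fun x : M ↦ TangentSpace (𝓡 d) x)]

/-- The Riemannian norms of the differentials of two maps with the same germ agree; the statement
takes care of the two tangent spaces, which are equal propositionally only. -/
lemma norm_mfderiv_congr {N : Type*} [TopologicalSpace N]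
    [ChartedSpace (EuclideanSpace ℝ (Fin d)) N] {f g : N → M} {p : N} (h : f =ᶠ[𝓝 p] g)
    (u : TangentSpace (𝓡 d) p) :
    ‖mfderiv (𝓡 d) (𝓡 d) f p u‖ = ‖mfderiv (𝓡 d) (𝓡 d) g p u‖ := by
  have key : ∀ y z : M, y = z → ∀ (v : TangentSpace (𝓡 d) y) (w : TangentSpace (𝓡 d) z),
      (v : EuclideanSpace ℝ (Fin d)) = w → ‖v‖ = ‖w‖ := by
    rintro y _ rfl v w h
    exact congrArg (fun v : TangentSpace (𝓡 d) y ↦ ‖v‖) h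
  refine key _ _ h.eq_of_nhds _ _ ?_
  rw [h.mfderiv_eq]
  rfl

lemma jacobian_nonneg (φ : M → M) (x : M) : 0 ≤ jacobian (d := d) φ x := abs_nonneg _

lemma jacobian_pos {φ : M → M} {x : M}
    (h : Function.Bijective (mfderiv (𝓡 d) (𝓡 d) φ x)) : 0 < jacobian (d := d) φ x := by
  have := (LinearEquiv.ofBijective (mfderiv (𝓡 d) (𝓡 d) φ x).toLinearMap h).isUnit_det
    (tangentBasis x).toBasis (tangentBasis (φ x)).toBasis
  exact abs_pos.2 this.ne_zero

lemma jacobian_comp {ψ φ : M → M} {x : M} (hψ : MDifferentiableAt (𝓡 d) (𝓡 d) ψ (φ x))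
    (hφ : MDifferentiableAt (𝓡 d) (𝓡 d) φ x) :
    jacobian (d := d) (ψ ∘ φ) x = jacobian (d := d) ψ (φ x) * jacobian (d := d) φ x := by
  unfold jacobian
  rw [← abs_mul, ← Matrix.det_mul, mfderiv_comp x hψ hφ]
  congr 2
  exact LinearMap.toMatrix_comp _ (tangentBasis (φ x)).toBasis _ _ _

lemma jacobian_id (x : M) : jacobian (d := d) id x = 1 := by
  unfold jacobian
  rw [mfderiv_id]
  have : LinearMap.toMatrix (tangentBasis x).toBasis (tangentBasis (id x)).toBasis
      (ContinuousLinearMap.id ℝ (TangentSpace (𝓡 d) x)).toLinearMap = 1 :=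
    LinearMap.toMatrix_id (tangentBasis x).toBasis
  rw [this]
  simp

lemma expansionConst_nonneg (φ : M → M) (x : M) : 0 ≤ expansionConst (d := d) φ x :=
  Real.iInf_nonneg fun _ ↦ norm_nonneg _

lemma expansionConst_mul_norm_le (φ : M → M) (x : M) (v : TangentSpace (𝓡 d) x) :
    expansionConst (d := d) φ x * ‖v‖ ≤ ‖mfderiv (𝓡 d) (𝓡 d) φ x v‖ := by
  rcases eq_or_ne v 0 with rfl | hv
  · simp
  · have hv0 : 0 < ‖v‖ := norm_pos_iff.2 hv
    have h1 : expansionConst (d := d) φ x ≤ ‖mfderiv (𝓡 d) (𝓡 d) φ x (‖v‖⁻¹ • v)‖ :=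
      ciInf_le (f := fun v : {v : TangentSpace (𝓡 d) x // ‖v‖ = 1} ↦
        ‖mfderiv (𝓡 d) (𝓡 d) φ x v.1‖) ⟨0, by rintro _ ⟨_, rfl⟩; exact norm_nonneg _⟩
        ⟨‖v‖⁻¹ • v, by simp [norm_smul, hv0.ne']⟩
    rw [map_smul, norm_smul, norm_inv, norm_norm, inv_mul_eq_div, le_div_iff₀ hv0] at h1
    exact h1

lemma exists_unit_tangent (hd : 1 ≤ d) (x : M) : ∃ v : TangentSpace (𝓡 d) x, ‖v‖ = 1 :=
  ⟨tangentBasis x ⟨0, hd⟩, (tangentBasis x).orthonormal.1 _⟩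

lemma le_expansionConst (hd : 1 ≤ d) {φ : M → M} {x : M} {c : ℝ}
    (h : ∀ v : TangentSpace (𝓡 d) x, c * ‖v‖ ≤ ‖mfderiv (𝓡 d) (𝓡 d) φ x v‖) :
    c ≤ expansionConst (d := d) φ x := by
  obtain ⟨v, hv⟩ := exists_unit_tangent hd x
  have : Nonempty {v : TangentSpace (𝓡 d) x // ‖v‖ = 1} := ⟨⟨v, hv⟩⟩
  refine le_ciInf fun w ↦ ?_
  simpa [w.2] using h w.1

lemma expansionConst_le (hd : 1 ≤ d) {φ : M → M} {x : M} {C : ℝ}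
    (h : ∀ v : TangentSpace (𝓡 d) x, ‖mfderiv (𝓡 d) (𝓡 d) φ x v‖ ≤ C * ‖v‖) :
    expansionConst (d := d) φ x ≤ C := by
  obtain ⟨v, hv⟩ := exists_unit_tangent hd x
  have h1 := (expansionConst_mul_norm_le φ x v).trans (h v)
  simpa [hv] using h1

lemma mul_expansionConst_le (hd : 1 ≤ d) {ψ φ : M → M} {x : M}
    (hψ : MDifferentiableAt (𝓡 d) (𝓡 d) ψ (φ x)) (hφ : MDifferentiableAt (𝓡 d) (𝓡 d) φ x) :
    expansionConst (d := d) ψ (φ x) * expansionConst (d := d) φ x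
      ≤ expansionConst (d := d) (ψ ∘ φ) x := by
  refine le_expansionConst hd fun v ↦ ?_
  rw [mfderiv_comp x hψ hφ, mul_assoc]
  exact (mul_le_mul_of_nonneg_left (expansionConst_mul_norm_le φ x v)
    (expansionConst_nonneg _ _)).trans (expansionConst_mul_norm_le ψ (φ x) _)

lemma expansionConst_id (hd : 1 ≤ d) (x : M) : expansionConst (d := d) id x = 1 := by
  refine le_antisymm (expansionConst_le hd fun v ↦ ?_) (le_expansionConst hd fun v ↦ ?_) <;>
  · rw [mfderiv_id, one_mul]
    exact le_rfl

end Pointwise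

/-! ### Riemannian density of a parametrization -/

section Density

variable {d : ℕ} {M : Type*} [TopologicalSpace M] [ChartedSpace (EuclideanSpace ℝ (Fin d)) M]
  [RiemannianBundle (fun x : M ↦ TangentSpace (𝓡 d) x)]

/-- The Jacobian of a map from the Euclidean space to a Riemannian manifold, computed in
orthonormal bases. For the inverse of a chart, this is the density of the Riemannian volume. -/
def density (f : EuclideanSpace ℝ (Fin d) → M) (p : EuclideanSpace ℝ (Fin d)) : ℝ :=
  |(LinearMap.toMatrix (EuclideanSpace.basisFun (Fin d) ℝ).toBasis (tangentBasis (f p)).toBasis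
      (mfderiv (𝓡 d) (𝓡 d) f p).toLinearMap).det|

/-- The Gram matrix of the coordinate vectors of a parametrization. -/
def gram (f : EuclideanSpace ℝ (Fin d) → M) (p : EuclideanSpace ℝ (Fin d)) :
    Matrix (Fin d) (Fin d) ℝ :=
  Matrix.of fun i j ↦ inner ℝ (mfderiv (𝓡 d) (𝓡 d) f p (EuclideanSpace.basisFun (Fin d) ℝ i))
    (mfderiv (𝓡 d) (𝓡 d) f p (EuclideanSpace.basisFun (Fin d) ℝ j))

lemma density_nonneg (f : EuclideanSpace ℝ (Fin d) → M) (p : EuclideanSpace ℝ (Fin d)) :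
    0 ≤ density f p := abs_nonneg _

lemma density_pos {f : EuclideanSpace ℝ (Fin d) → M} {p : EuclideanSpace ℝ (Fin d)}
    (h : Function.Bijective (mfderiv (𝓡 d) (𝓡 d) f p)) : 0 < density f p := by
  have := (LinearEquiv.ofBijective (mfderiv (𝓡 d) (𝓡 d) f p).toLinearMap h).isUnit_det
    (EuclideanSpace.basisFun (Fin d) ℝ).toBasis (tangentBasis (f p)).toBasis
  exact abs_pos.2 this.ne_zero

/-- The Gram matrix is `Aᵀ * A`, where `A` is the matrix of the differential in an orthonormal
basis. In particular the density does not depend on the choice of this basis. -/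
lemma density_sq (f : EuclideanSpace ℝ (Fin d) → M) (p : EuclideanSpace ℝ (Fin d)) :
    density f p ^ 2 = (gram f p).det := by
  unfold density
  set A := LinearMap.toMatrix (EuclideanSpace.basisFun (Fin d) ℝ).toBasis
    (tangentBasis (f p)).toBasis (mfderiv (𝓡 d) (𝓡 d) f p).toLinearMap with hA
  have hG : gram f p = A.transpose * A := by
    ext i j
    have hentry : ∀ a b, A a b = inner ℝ (tangentBasis (f p) a)
        (mfderiv (𝓡 d) (𝓡 d) f p (EuclideanSpace.basisFun (Fin d) ℝ b)) := by
      intro a b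
      refine (LinearMap.toMatrix_apply _ _ _ _ _).trans ?_
      rw [OrthonormalBasis.coe_toBasis_repr_apply, OrthonormalBasis.repr_apply_apply,
        OrthonormalBasis.coe_toBasis]
      rfl
    rw [Matrix.mul_apply]
    simp only [Matrix.transpose_apply, hentry, gram, Matrix.of_apply]
    rw [← OrthonormalBasis.sum_inner_mul_inner (tangentBasis (f p))]
    exact Finset.sum_congr rfl fun a _ ↦ by rw [real_inner_comm]
  rw [hG, Matrix.det_mul, Matrix.det_transpose, sq_abs, sq]

/-- Change of parametrization. -/
lemma density_comp {f : EuclideanSpace ℝ (Fin d) → M}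
    {F : EuclideanSpace ℝ (Fin d) → EuclideanSpace ℝ (Fin d)} {p : EuclideanSpace ℝ (Fin d)}
    (hf : MDifferentiableAt (𝓡 d) (𝓡 d) f (F p)) (hF : DifferentiableAt ℝ F p) :
    density (f ∘ F) p = density f (F p) * |(fderiv ℝ F p).det| := by
  unfold density
  rw [mfderiv_comp p hf hF.mdifferentiableAt, ContinuousLinearMap.det,
    ← LinearMap.det_toMatrix (EuclideanSpace.basisFun (Fin d) ℝ).toBasis, ← abs_mul,
    ← Matrix.det_mul, mfderiv_eq_fderiv]
  congr 2
  exact LinearMap.toMatrix_comp _ (EuclideanSpace.basisFun (Fin d) ℝ).toBasis _ _ _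

lemma density_map_comp {f : EuclideanSpace ℝ (Fin d) → M} {φ : M → M}
    {p : EuclideanSpace ℝ (Fin d)} (hφ : MDifferentiableAt (𝓡 d) (𝓡 d) φ (f p))
    (hf : MDifferentiableAt (𝓡 d) (𝓡 d) f p) :
    density (φ ∘ f) p = jacobian (d := d) φ (f p) * density f p := by
  unfold density jacobian
  rw [mfderiv_comp p hφ hf, ← abs_mul, ← Matrix.det_mul]
  congr 2
  exact LinearMap.toMatrix_comp _ (tangentBasis (f p)).toBasis _ _ _

lemma density_congr {f g : EuclideanSpace ℝ (Fin d) → M} {p : EuclideanSpace ℝ (Fin d)}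
    (h : f =ᶠ[𝓝 p] g) : density f p = density g p := by
  unfold density
  rw [h.mfderiv_eq, h.eq_of_nhds]

variable [IsManifold (𝓡 d) ∞ M] [IsContMDiffRiemannianBundle (𝓡 d) ∞ (EuclideanSpace ℝ (Fin d))
    (fun x : M ↦ TangentSpace (𝓡 d) x)]

/-- The matrix that defines the density depends on the arbitrary bases `tangentBasis`; the density
is nevertheless smooth, being the square root of the determinant of the Gram matrix. -/
lemma contDiffOn_density {f : EuclideanSpace ℝ (Fin d) → M}
    {U : Set (EuclideanSpace ℝ (Fin d))} (hU : IsOpen U) {m n : ℕ}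
    (hf : ContMDiffOn (𝓡 d) (𝓡 d) (n : WithTop ℕ∞) f U) (hmn : m + 1 ≤ n)
    (hbij : ∀ p ∈ U, Function.Bijective (mfderiv (𝓡 d) (𝓡 d) f p)) :
    ContDiffOn ℝ m (density f) U := by
  have hgram : ∀ i j, ContDiffOn ℝ m (fun p ↦ gram f p i j) U := fun i j ↦
    (contDiffOn_inner_mfderiv hU hf hmn).comp (f := fun p ↦ (p,
      EuclideanSpace.basisFun (Fin d) ℝ i, EuclideanSpace.basisFun (Fin d) ℝ j))
      (by fun_prop) fun p hp ↦ ⟨hp, Set.mem_univ _⟩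
  have hdet : ContDiffOn ℝ m (fun p ↦ (gram f p).det) U := by
    simp only [Matrix.det_apply]
    refine ContDiffOn.sum fun σ _ ↦ ContDiffOn.const_smul _ ?_
    exact contDiffOn_prod fun i _ ↦ hgram _ _
  have h : ContDiffOn ℝ m (fun p ↦ Real.sqrt (gram f p).det) U := by
    refine hdet.sqrt fun p hp ↦ ?_
    rw [← density_sq]
    exact pow_ne_zero 2 (density_pos (hbij p hp)).ne'
  refine h.congr fun p _ ↦ ?_
  rw [← density_sq, Real.sqrt_sq (density_nonneg _ _)]

end Density

section ChartDensity

variable {d : ℕ} {M : Type*} [TopologicalSpace M] [ChartedSpace (EuclideanSpace ℝ (Fin d)) M]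
  [IsManifold (𝓡 d) ∞ M]
  {e : OpenPartialHomeomorph M (EuclideanSpace ℝ (Fin d))}

omit [IsManifold (𝓡 d) ∞ M] in
lemma mdifferentiable_of_mem_maximalAtlas (he : e ∈ IsManifold.maximalAtlas (𝓡 d) ∞ M) :
    e.MDifferentiable (𝓡 d) (𝓡 d) :=
  ⟨(contMDiffOn_of_mem_maximalAtlas he).mdifferentiableOn (by simp),
    (contMDiffOn_symm_of_mem_maximalAtlas he).mdifferentiableOn (by simp)⟩

omit [IsManifold (𝓡 d) ∞ M] in
lemma bijective_mfderiv_symm (he : e ∈ IsManifold.maximalAtlas (𝓡 d) ∞ M)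
    {p : EuclideanSpace ℝ (Fin d)} (hp : p ∈ e.target) :
    Function.Bijective (mfderiv (𝓡 d) (𝓡 d) e.symm p) :=
  (mdifferentiable_of_mem_maximalAtlas he).symm.mfderiv_bijective hp

omit [IsManifold (𝓡 d) ∞ M] in
lemma bijective_mfderiv_comp_symm (he : e ∈ IsManifold.maximalAtlas (𝓡 d) ∞ M)
    {p : EuclideanSpace ℝ (Fin d)} (hp : p ∈ e.target) {φ : M → M}
    (hφ : MDifferentiableAt (𝓡 d) (𝓡 d) φ (e.symm p))
    (hφ' : Function.Bijective (mfderiv (𝓡 d) (𝓡 d) φ (e.symm p))) :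
    Function.Bijective (mfderiv (𝓡 d) (𝓡 d) (φ ∘ e.symm) p) := by
  rw [mfderiv_comp p hφ ((mdifferentiable_of_mem_maximalAtlas he).symm.mdifferentiableAt hp)]
  exact hφ'.comp (bijective_mfderiv_symm he hp)

variable [RiemannianBundle (fun x : M ↦ TangentSpace (𝓡 d) x)]
  [IsContMDiffRiemannianBundle (𝓡 d) ∞ (EuclideanSpace ℝ (Fin d))
    (fun x : M ↦ TangentSpace (𝓡 d) x)]

/-- In a chart, the Jacobian is a quotient of two densities, hence it loses one derivative only. -/
lemma contMDiff_jacobian {r : ℕ} (hr : 1 ≤ r) {φ : M → M}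
    (hφ : ContMDiff (𝓡 d) (𝓡 d) (r : WithTop ℕ∞) φ)
    (hφ' : ∀ x, Function.Bijective (mfderiv (𝓡 d) (𝓡 d) φ x)) :
    ContMDiff (𝓡 d) 𝓘(ℝ, ℝ) ((r - 1 : ℕ) : WithTop ℕ∞) (jacobian (d := d) φ) := by
  intro x
  have hφd : MDifferentiable (𝓡 d) (𝓡 d) φ :=
    hφ.mdifferentiable (by exact_mod_cast (by omega : r ≠ 0))
  set e := chartAt (EuclideanSpace ℝ (Fin d)) x
  have he : e ∈ IsManifold.maximalAtlas (𝓡 d) ∞ M := IsManifold.chart_mem_maximalAtlas x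
  have hes := contMDiffOn_symm_of_mem_maximalAtlas he
  have hle : (r : WithTop ℕ∞) ≤ ∞ := natCast_le_infty r
  have h1 := contDiffOn_density (m := r - 1) e.open_target (hφ.comp_contMDiffOn (hes.of_le hle))
    (by omega) fun p hp ↦ bijective_mfderiv_comp_symm he hp (hφd _) (hφ' _)
  have h2 := contDiffOn_density (m := r - 1) e.open_target (hes.of_le hle)
    (by omega) fun p hp ↦ bijective_mfderiv_symm he hp
  have h3 : ContDiffOn ℝ (r - 1 : ℕ) (fun p ↦ density (φ ∘ e.symm) p / density e.symm p)
      e.target := h1.div h2 fun p hp ↦ (density_pos (bijective_mfderiv_symm he hp)).ne'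
  have hx : x ∈ e.source := mem_chart_source _ x
  have h4 := (contMDiffAt_of_mem_maximalAtlas he hx).of_le
    (m := ((r - 1 : ℕ) : WithTop ℕ∞)) (natCast_le_infty _)
  have h5 := (h3.contDiffAt (e.open_target.mem_nhds (e.map_source hx))).contMDiffAt.comp x h4
  refine h5.congr_of_eventuallyEq ?_
  filter_upwards [e.open_source.mem_nhds hx] with y hy
  have hy' := e.map_source hy
  have := density_map_comp (p := e y) (hφd (e.symm (e y)))
    ((mdifferentiable_of_mem_maximalAtlas he).symm.mdifferentiableAt hy')
  simp only [Function.comp_apply] at this ⊢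
  rw [eq_div_iff (density_pos (bijective_mfderiv_symm he hy')).ne']
  rw [this, e.left_inv hy]

end ChartDensity

/-! ### Local branches of the inverse -/

section Branches

variable {d : ℕ} {M : Type*} [TopologicalSpace M] [ChartedSpace (EuclideanSpace ℝ (Fin d)) M]

/-- A `C^r` map whose differentials are all invertible. -/
structure IsRegularMap (d r : ℕ) {M : Type*} [TopologicalSpace M]
    [ChartedSpace (EuclideanSpace ℝ (Fin d)) M] (φ : M → M) : Prop where
  contMDiff : ContMDiff (𝓡 d) (𝓡 d) (r : WithTop ℕ∞) φ
  bijective : ∀ x, Function.Bijective (mfderiv (𝓡 d) (𝓡 d) φ x)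
  one_le : 1 ≤ r

namespace IsRegularMap

variable {r : ℕ} {φ : M → M}

lemma ne_zero (h : IsRegularMap d r φ) : (r : WithTop ℕ∞) ≠ 0 := by
  have := h.one_le
  exact_mod_cast (by omega : r ≠ 0)

lemma mdifferentiable (h : IsRegularMap d r φ) : MDifferentiable (𝓡 d) (𝓡 d) φ :=
  h.contMDiff.mdifferentiable h.ne_zero

lemma id (hr : 1 ≤ r) : IsRegularMap d r (id : M → M) :=
  ⟨contMDiff_id, fun x ↦ by rw [mfderiv_id]; exact Function.bijective_id, hr⟩

lemma comp {ψ : M → M} (hψ : IsRegularMap d r ψ) (hφ : IsRegularMap d r φ) :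
    IsRegularMap d r (ψ ∘ φ) :=
  ⟨hψ.contMDiff.comp hφ.contMDiff, fun x ↦ by
    rw [mfderiv_comp x (hψ.mdifferentiable _) (hφ.mdifferentiable _)]
    exact (hψ.bijective _).comp (hφ.bijective _), hφ.one_le⟩

lemma iterate (h : IsRegularMap d r φ) (n : ℕ) : IsRegularMap d r φ^[n] := by
  induction n with
  | zero => exact IsRegularMap.id h.one_le
  | succ n ih => exact ih.comp h

variable [IsManifold (𝓡 d) ∞ M]

/-- The inverse function theorem on a manifold. -/
lemma exists_openPartialHomeomorph (h : IsRegularMap d r φ) (x : M) :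
    ∃ Φ : OpenPartialHomeomorph M M, x ∈ Φ.source ∧ Set.EqOn φ Φ Φ.source ∧
      ContMDiffAt (𝓡 d) (𝓡 d) (r : WithTop ℕ∞) Φ.symm (φ x) := by
  set e₁ := chartAt (EuclideanSpace ℝ (Fin d)) x
  set e₂ := chartAt (EuclideanSpace ℝ (Fin d)) (φ x)
  have he₁ : e₁ ∈ IsManifold.maximalAtlas (𝓡 d) ∞ M := IsManifold.chart_mem_maximalAtlas x
  have he₂ : e₂ ∈ IsManifold.maximalAtlas (𝓡 d) ∞ M := IsManifold.chart_mem_maximalAtlas (φ x)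
  have hx₁ : x ∈ e₁.source := mem_chart_source _ x
  have hx₂ : φ x ∈ e₂.source := mem_chart_source _ (φ x)
  have hp₁ : e₁ x ∈ e₁.target := e₁.map_source hx₁
  have hinv : e₁.symm (e₁ x) = x := e₁.left_inv hx₁
  -- the inverse function theorem is applied to `φ` read in charts
  set F : EuclideanSpace ℝ (Fin d) → EuclideanSpace ℝ (Fin d) := e₂ ∘ (φ ∘ e₁.symm) with hF
  have hFx : F (e₁ x) = e₂ (φ x) := by simp [hF, hinv]
  have s₁ : ContMDiffAt (𝓡 d) (𝓡 d) (r : WithTop ℕ∞) (φ ∘ e₁.symm) (e₁ x) :=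
    h.contMDiff.contMDiffAt.comp _
      ((contMDiffAt_symm_of_mem_maximalAtlas he₁ hp₁).of_le (natCast_le_infty r))
  have s₂ : ContMDiffAt (𝓡 d) (𝓡 d) (r : WithTop ℕ∞) e₂ ((φ ∘ e₁.symm) (e₁ x)) := by
    simp only [Function.comp_apply, hinv]
    exact (contMDiffAt_of_mem_maximalAtlas he₂ hx₂).of_le (natCast_le_infty r)
  have hFc : ContDiffAt ℝ r F (e₁ x) := (s₂.comp _ s₁).contDiffAt
  have hFb : Function.Bijective (fderiv ℝ F (e₁ x)) := by
    rw [← mfderiv_eq_fderiv, hF, mfderiv_comp _ (s₂.mdifferentiableAt h.ne_zero)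
      (s₁.mdifferentiableAt h.ne_zero)]
    have b₁ := bijective_mfderiv_comp_symm he₁ hp₁ (h.mdifferentiable _) (h.bijective _)
    have b₂ := (mdifferentiable_of_mem_maximalAtlas he₂).mfderiv_bijective
      (x := (φ ∘ e₁.symm) (e₁ x)) (by simpa [hinv] using hx₂)
    exact b₂.comp b₁
  set F' : EuclideanSpace ℝ (Fin d) ≃L[ℝ] EuclideanSpace ℝ (Fin d) :=
    (LinearEquiv.ofBijective (fderiv ℝ F (e₁ x)).toLinearMap hFb).toContinuousLinearEquiv
  have hF' : HasFDerivAt F (F' : EuclideanSpace ℝ (Fin d) →L[ℝ] EuclideanSpace ℝ (Fin d))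
      (e₁ x) := (hFc.differentiableAt h.ne_zero).hasFDerivAt
  set Φ₀ := hFc.toOpenPartialHomeomorph F hF' h.ne_zero
  have hΦ₀ : e₁ x ∈ Φ₀.source := hFc.mem_toOpenPartialHomeomorph_source hF' h.ne_zero
  have hΦ₀c : ∀ p, Φ₀ p = F p := fun p ↦ rfl
  set Φ₁ := (e₁.trans Φ₀).trans e₂.symm
  set Φ := Φ₁.restrOpen (φ ⁻¹' e₂.source) (e₂.open_source.preimage h.contMDiff.continuous)
  refine ⟨Φ, ?_, ?_, ?_⟩
  · have : Φ₀ (e₁ x) ∈ e₂.target := by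
      rw [hΦ₀c, hFx]
      exact e₂.map_source hx₂
    simp [Φ, Φ₁, hx₁, hΦ₀, hx₂, this]
  · intro z hz
    simp only [Φ, Φ₁, OpenPartialHomeomorph.restrOpen_source, OpenPartialHomeomorph.trans_source,
      Set.mem_inter_iff, Set.mem_preimage] at hz
    have hz₁ : z ∈ e₁.source := hz.1.1.1
    change φ z = e₂.symm (F (e₁ z))
    simp only [hF, Function.comp_apply, e₁.left_inv hz₁]
    exact (e₂.left_inv hz.2).symm
  · have t₁ : ContMDiffAt (𝓡 d) (𝓡 d) (r : WithTop ℕ∞) e₂ (φ x) :=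
      (contMDiffAt_of_mem_maximalAtlas he₂ hx₂).of_le (natCast_le_infty r)
    have t₂ : ContMDiffAt (𝓡 d) (𝓡 d) (r : WithTop ℕ∞) Φ₀.symm (e₂ (φ x)) := by
      have := hFc.to_localInverse hF' h.ne_zero
      rw [hFx] at this
      exact this.contMDiffAt
    have t₃ : ContMDiffAt (𝓡 d) (𝓡 d) (r : WithTop ℕ∞) e₁.symm (Φ₀.symm (e₂ (φ x))) := by
      have h0 : Φ₀.symm (e₂ (φ x)) = e₁ x := by
        rw [← hFx, ← hΦ₀c]
        exact Φ₀.left_inv hΦ₀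
      rw [h0]
      exact (contMDiffAt_symm_of_mem_maximalAtlas he₁ hp₁).of_le (natCast_le_infty r)
    have t₄ := t₂.comp (φ x) t₁
    exact ContMDiffAt.comp (g := e₁.symm) (φ x) t₃ t₄

lemma isLocalHomeomorph (h : IsRegularMap d r φ) : IsLocalHomeomorph φ :=
  IsLocalHomeomorph.mk φ fun x ↦
    let ⟨Φ, hx, heq, _⟩ := h.exists_openPartialHomeomorph x
    ⟨Φ, hx, heq⟩

variable [T2Space M] [CompactSpace M]

lemma finite_fiber (h : IsRegularMap d r φ) (y : M) : (φ ⁻¹' {y}).Finite := by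
  refine (isClosed_singleton.preimage h.contMDiff.continuous).isCompact.finite
    (IsDiscrete.of_openPartialHomeomorph φ subset_rfl fun x _ ↦ ?_)
  obtain ⟨Φ, hx, rfl⟩ := h.isLocalHomeomorph x
  exact ⟨Φ, hx, rfl⟩

/-- Near `y₀` the inverse of a regular map splits into `C^r` branches, indexed by the fibre
of `y₀`. -/
lemma exists_branches (h : IsRegularMap d r φ) (y₀ : M) :
    ∃ V : Set M, IsOpen V ∧ y₀ ∈ V ∧ ∃ b : M → M → M, ∀ y ∈ V,
      (∀ a ∈ φ ⁻¹' {y₀}, b a y₀ = a ∧ φ (b a y) = y ∧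
        ContMDiffAt (𝓡 d) (𝓡 d) (r : WithTop ℕ∞) (b a) y) ∧
      Set.InjOn (fun a ↦ b a y) (φ ⁻¹' {y₀}) ∧
      φ ⁻¹' {y} = (fun a ↦ b a y) '' (φ ⁻¹' {y₀}) := by
  have hfin := h.finite_fiber y₀
  choose Φ hΦx hΦeq hΦs using h.exists_openPartialHomeomorph
  -- disjoint neighbourhoods of the preimages, on each of which `φ` is invertible
  obtain ⟨U, hU, hdisj⟩ := hfin.t2_separation
  set W : M → Set M := fun a ↦ U a ∩ (Φ a).source
  have hWo : ∀ a, IsOpen (W a) := fun a ↦ (hU a).2.inter (Φ a).open_source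
  have hWa : ∀ a, a ∈ W a := fun a ↦ ⟨(hU a).1, hΦx a⟩
  have hsm : ∀ a ∈ φ ⁻¹' {y₀}, ∃ S : Set M, IsOpen S ∧ y₀ ∈ S ∧ ∀ y ∈ S,
      ContMDiffAt (𝓡 d) (𝓡 d) (r : WithTop ℕ∞) (Φ a).symm y := by
    intro a ha
    have h1 := hΦs a
    rw [show φ a = y₀ from ha] at h1
    have : IsManifold (𝓡 d) (r : WithTop ℕ∞) M := IsManifold.of_le (natCast_le_infty r)
    have h2 := (contMDiffAt_iff_contMDiffAt_nhds (by simp)).1 h1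
    obtain ⟨S, hS, hSo, hyS⟩ := eventually_nhds_iff.1 h2
    exact ⟨S, hSo, hyS, hS⟩
  choose! S hSo hyS hSs using hsm
  -- points close to `y₀` have no preimage outside the neighbourhoods `W a`, because `φ` is closed
  set V₀ : Set M := (φ '' (⋃ a ∈ φ ⁻¹' {y₀}, W a)ᶜ)ᶜ
  have hV₀ : IsOpen V₀ := by
    rw [isOpen_compl_iff]
    exact h.contMDiff.continuous.isClosedMap _
      (isOpen_biUnion fun a _ ↦ hWo a).isClosed_compl
  have hV₀mem : ∀ {x}, φ x ∈ V₀ → ∃ a ∈ φ ⁻¹' {y₀}, x ∈ W a := by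
    intro x hx
    by_contra! hcon
    refine hx ⟨x, ?_, rfl⟩
    simp only [Set.mem_compl_iff, Set.mem_iUnion]
    rintro ⟨a, ha, hxa⟩
    exact hcon a ha hxa
  set V : Set M := V₀ ∩ ⋂ a ∈ φ ⁻¹' {y₀}, (φ '' W a ∩ S a)
  have hinv : ∀ {a x}, x ∈ W a → (Φ a).symm (φ x) = x := by
    intro a x hx
    rw [hΦeq a hx.2]
    exact (Φ a).left_inv hx.2
  refine ⟨V, hV₀.inter (hfin.isOpen_biInter fun a ha ↦
    (h.isLocalHomeomorph.isOpenMap _ (hWo a)).inter (hSo a ha)), ⟨?_, ?_⟩,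
    fun a ↦ (Φ a).symm, fun y hy ↦ ⟨fun a ha ↦ ⟨?_, ?_, ?_⟩, ?_, ?_⟩⟩
  · rintro ⟨x, hx, hxy⟩
    exact hx (Set.mem_biUnion (show x ∈ φ ⁻¹' {y₀} from hxy) (hWa x))
  · simp only [Set.mem_iInter]
    exact fun a ha ↦ ⟨⟨a, hWa a, ha⟩, hyS a ha⟩
  · rw [← show φ a = y₀ from ha]
    exact hinv (hWa a)
  · obtain ⟨⟨x, hx, rfl⟩, -⟩ := Set.mem_iInter₂.1 hy.2 a ha
    exact congrArg φ (hinv hx)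
  · exact hSs a ha y (Set.mem_iInter₂.1 hy.2 a ha).2
  · intro a ha a' ha' heq
    obtain ⟨⟨x, hx, hxy⟩, -⟩ := Set.mem_iInter₂.1 hy.2 a ha
    obtain ⟨⟨x', hx', hxy'⟩, -⟩ := Set.mem_iInter₂.1 hy.2 a' ha'
    simp only [← hxy, hinv hx] at heq
    rw [hxy, ← hxy', hinv hx'] at heq
    by_contra hne
    exact Set.disjoint_left.1 (hdisj ha ha' hne) hx.1 (heq ▸ hx'.1)
  · ext x
    constructor
    · intro hx
      have hx' : φ x = y := hx
      obtain ⟨a, ha, hxa⟩ := hV₀mem (x := x) (hx'.symm ▸ hy.1)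
      exact ⟨a, ha, by simp only [← hx', hinv hxa]⟩
    · rintro ⟨a, ha, rfl⟩
      obtain ⟨⟨x, hx, rfl⟩, -⟩ := Set.mem_iInter₂.1 hy.2 a ha
      simp [hinv hx]

/-- The cardinality of the fibres is locally constant, hence constant. -/
lemma ncard_fiber_eq [ConnectedSpace M] (h : IsRegularMap d r φ) (y y' : M) :
    (φ ⁻¹' {y}).ncard = (φ ⁻¹' {y'}).ncard := by
  have : IsLocallyConstant fun y ↦ (φ ⁻¹' {y}).ncard := by
    rw [IsLocallyConstant.iff_eventually_eq]
    intro y₀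
    obtain ⟨V, hVo, hyV, b, hb⟩ := h.exists_branches y₀
    filter_upwards [hVo.mem_nhds hyV] with y hy
    rw [(hb y hy).2.2, (hb y hy).2.1.ncard_image]
  exact this.apply_eq_of_preconnectedSpace _ _

end IsRegularMap

end Branches

/-! ### Weighted transfer operators -/

section Transfer

variable {d : ℕ} {M : Type*} [TopologicalSpace M] [ChartedSpace (EuclideanSpace ℝ (Fin d)) M]

/-- The transfer operator `ρ ↦ (y ↦ ∑_{φ x = y} w x * ρ x)` with weight `w`. -/
def wtransfer {M : Type*} (φ : M → M) (w ρ : M → ℝ) (y : M) : ℝ :=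
  ∑ᶠ x ∈ φ ⁻¹' {y}, w x * ρ x

lemma transfer_eq_wtransfer [RiemannianBundle (fun x : M ↦ TangentSpace (𝓡 d) x)] (φ : M → M)
    (ρ : M → ℝ) :
    transfer (d := d) φ ρ = wtransfer φ (fun x ↦ (jacobian (d := d) φ x)⁻¹) ρ := by
  ext y
  simp only [transfer, wtransfer, div_eq_inv_mul]

variable [IsManifold (𝓡 d) ∞ M] [T2Space M] [CompactSpace M]

namespace IsRegularMap

variable {r : ℕ} {φ ψ : M → M} (h : IsRegularMap d r φ)

/-- The fibre of a regular map, as a finite set. -/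
def fiber (y : M) : Finset M := (h.finite_fiber y).toFinset

@[simp] lemma mem_fiber {x y : M} : x ∈ h.fiber y ↔ φ x = y := by
  simp [fiber]

lemma card_fiber [ConnectedSpace M] (y : M) : (h.fiber y).card = degree φ := by
  rw [degree, h.ncard_fiber_eq _ y, fiber, ← Set.ncard_eq_toFinset_card _ (h.finite_fiber y)]

lemma wtransfer_apply (w ρ : M → ℝ) (y : M) :
    wtransfer φ w ρ y = ∑ x ∈ h.fiber y, w x * ρ x := by
  rw [wtransfer, finsum_mem_eq_finite_toFinset_sum _ (h.finite_fiber y), fiber]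

/-- Near a point, a transfer operator is a finite sum over the local inverse branches. -/
lemma exists_wtransfer_eq_sum (y₀ : M) :
    ∃ V : Set M, IsOpen V ∧ y₀ ∈ V ∧ ∃ b : M → M → M,
      (∀ y ∈ V, ∀ a ∈ h.fiber y₀, b a y₀ = a ∧ φ (b a y) = y ∧
        ContMDiffAt (𝓡 d) (𝓡 d) (r : WithTop ℕ∞) (b a) y) ∧
      ∀ f : M → ℝ, ∀ y ∈ V, ∑ x ∈ h.fiber y, f x = ∑ a ∈ h.fiber y₀, f (b a y) := by
  classical
  obtain ⟨V, hVo, hyV, b, hb⟩ := h.exists_branches y₀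
  refine ⟨V, hVo, hyV, b, fun y hy a ha ↦ (hb y hy).1 a ((h.mem_fiber).1 ha), fun f y hy ↦ ?_⟩
  have himg : h.fiber y = (h.fiber y₀).image fun a ↦ b a y := by
    ext x
    have := Set.ext_iff.1 (hb y hy).2.2 x
    simpa using this
  rw [himg, Finset.sum_image]
  intro a ha a' ha'
  exact (hb y hy).2.1 ((h.mem_fiber).1 ha) ((h.mem_fiber).1 ha')

lemma sum_fiber_comp (hψ : IsRegularMap d r ψ) (f : M → ℝ) (y : M) :
    ∑ x ∈ h.fiber y, ∑ z ∈ hψ.fiber x, f z = ∑ z ∈ (h.comp hψ).fiber y, f z := by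
  classical
  rw [← Finset.sum_fiberwise_of_maps_to (s := (h.comp hψ).fiber y) (t := h.fiber y) (g := ψ)
    (fun z hz ↦ by simpa using hz)]
  refine Finset.sum_congr rfl fun x hx ↦ Finset.sum_congr ?_ fun _ _ ↦ rfl
  ext z
  have hx' : φ x = y := by simpa using hx
  simp only [mem_fiber, Finset.mem_filter, Function.comp_apply]
  exact ⟨fun hz ↦ ⟨by rw [hz, hx'], hz⟩, fun hz ↦ hz.2⟩

include h in
lemma wtransfer_comp (hψ : IsRegularMap d r ψ) (w v ρ : M → ℝ) :
    wtransfer φ w (wtransfer ψ v ρ) = wtransfer (φ ∘ ψ) (fun z ↦ w (ψ z) * v z) ρ := by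
  ext y
  rw [h.wtransfer_apply, (h.comp hψ).wtransfer_apply, ← h.sum_fiber_comp hψ]
  refine Finset.sum_congr rfl fun x _ ↦ ?_
  rw [hψ.wtransfer_apply, Finset.mul_sum]
  refine Finset.sum_congr rfl fun z hz ↦ ?_
  rw [(hψ.mem_fiber).1 hz, mul_assoc]

include h in
lemma wtransfer_contMDiff {m : ℕ} (hm : m ≤ r) {w ρ : M → ℝ}
    (hw : ContMDiff (𝓡 d) 𝓘(ℝ, ℝ) (m : WithTop ℕ∞) w)
    (hρ : ContMDiff (𝓡 d) 𝓘(ℝ, ℝ) (m : WithTop ℕ∞) ρ) :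
    ContMDiff (𝓡 d) 𝓘(ℝ, ℝ) (m : WithTop ℕ∞) (wtransfer φ w ρ) := by
  intro y₀
  obtain ⟨V, hVo, hyV, b, hb, hsum⟩ := h.exists_wtransfer_eq_sum y₀
  have h1 : ContMDiffAt (𝓡 d) 𝓘(ℝ, ℝ) (m : WithTop ℕ∞)
      (fun y ↦ ∑ a ∈ h.fiber y₀, w (b a y) * ρ (b a y)) y₀ := by
    refine ContMDiffAt.sum fun a ha ↦ ?_
    have hba := ((hb y₀ hyV a ha).2.2).of_le (m := (m : WithTop ℕ∞)) (by exact_mod_cast hm)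
    exact (hw.contMDiffAt.comp y₀ hba).mul (hρ.contMDiffAt.comp y₀ hba)
  refine h1.congr_of_eventuallyEq ?_
  filter_upwards [hVo.mem_nhds hyV] with y hy
  rw [h.wtransfer_apply]
  exact hsum (fun x ↦ w x * ρ x) y hy

include h in
lemma wtransfer_add (w ρ σ : M → ℝ) :
    wtransfer φ w (ρ + σ) = wtransfer φ w ρ + wtransfer φ w σ := by
  ext y
  simp [h.wtransfer_apply, mul_add, Finset.sum_add_distrib]

include h in
lemma wtransfer_smul (w ρ : M → ℝ) (c : ℝ) :
    wtransfer φ w (c • ρ) = c • wtransfer φ w ρ := by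
  ext y
  simp [h.wtransfer_apply, Finset.mul_sum, mul_left_comm]

end IsRegularMap

end Transfer

section TransferOperator

variable {d : ℕ} {M : Type*} [TopologicalSpace M] [ChartedSpace (EuclideanSpace ℝ (Fin d)) M]
  [IsManifold (𝓡 d) ∞ M] [T2Space M] [CompactSpace M]
  [RiemannianBundle (fun x : M ↦ TangentSpace (𝓡 d) x)]
  [IsContMDiffRiemannianBundle (𝓡 d) ∞ (EuclideanSpace ℝ (Fin d))
    (fun x : M ↦ TangentSpace (𝓡 d) x)]

namespace IsRegularMap

variable {r : ℕ} {φ : M → M} (h : IsRegularMap d r φ)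

omit [IsManifold (𝓡 d) ∞ M] [T2Space M] [CompactSpace M]
  [IsContMDiffRiemannianBundle (𝓡 d) ∞ (EuclideanSpace ℝ (Fin d))
    (fun x : M ↦ TangentSpace (𝓡 d) x)] in
include h in
lemma jacobian_pos (x : M) : 0 < jacobian (d := d) φ x :=
  RuelleTransfer.jacobian_pos (h.bijective x)

omit [T2Space M] [CompactSpace M] in
include h in
lemma contMDiff_inv_jacobian : ContMDiff (𝓡 d) 𝓘(ℝ, ℝ) ((r - 1 : ℕ) : WithTop ℕ∞)
    fun x ↦ (jacobian (d := d) φ x)⁻¹ := by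
  intro x
  exact ((contMDiff_jacobian h.one_le h.contMDiff h.bijective) x).inv₀ (h.jacobian_pos x).ne'

/-- The transfer operator of a regular map as an endomorphism of the space of `C^{r-1}`
functions. -/
def transferOp : Module.End ℝ (CkSpace d M (r - 1)) where
  toFun ρ := ⟨transfer (d := d) φ ρ, by
    rw [transfer_eq_wtransfer]
    exact h.wtransfer_contMDiff (Nat.sub_le r 1) h.contMDiff_inv_jacobian ρ.contMDiff⟩
  map_add' ρ σ := by
    ext y
    change transfer (d := d) φ (ρ + σ : CkSpace d M (r - 1)) y
      = transfer (d := d) φ ρ y + transfer (d := d) φ σ y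
    rw [transfer_eq_wtransfer, transfer_eq_wtransfer, transfer_eq_wtransfer,
      ContMDiffMap.coe_add, h.wtransfer_add]
    rfl
  map_smul' c ρ := by
    ext y
    change transfer (d := d) φ (c • ρ : CkSpace d M (r - 1)) y = c • transfer (d := d) φ ρ y
    rw [transfer_eq_wtransfer, transfer_eq_wtransfer, ContMDiffMap.coe_smul, h.wtransfer_smul]
    rfl

lemma transferOp_apply (ρ : CkSpace d M (r - 1)) (y : M) :
    h.transferOp ρ y = transfer (d := d) φ ρ y := rfl

lemma coe_transferOp (ρ : CkSpace d M (r - 1)) :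
    ⇑(h.transferOp ρ) = wtransfer φ (fun x ↦ (jacobian (d := d) φ x)⁻¹) ρ :=
  transfer_eq_wtransfer φ ρ

omit [IsContMDiffRiemannianBundle (𝓡 d) ∞ (EuclideanSpace ℝ (Fin d))
  (fun x : M ↦ TangentSpace (𝓡 d) x)] in
include h in
lemma transfer_comp {ψ : M → M} (hψ : IsRegularMap d r ψ) (ρ : M → ℝ) :
    transfer (d := d) φ (transfer (d := d) ψ ρ) = transfer (d := d) (φ ∘ ψ) ρ := by
  rw [transfer_eq_wtransfer, transfer_eq_wtransfer, transfer_eq_wtransfer, h.wtransfer_comp hψ]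
  congr 1
  ext z
  rw [jacobian_comp (h.mdifferentiable _) (hψ.mdifferentiable _), mul_inv]

/-- The powers of the transfer operator are the transfer operators of the iterates. -/
lemma transferOp_pow (n : ℕ) : h.transferOp ^ n = (h.iterate n).transferOp := by
  induction n with
  | zero =>
    ext ρ y
    rw [transferOp_apply, transfer_eq_wtransfer, (h.iterate 0).wtransfer_apply]
    have : (h.iterate 0).fiber y = {y} := by
      ext x
      simp
    rw [this, Finset.sum_singleton]
    change ρ y = (jacobian (d := d) _root_.id y)⁻¹ * ρ y
    rw [jacobian_id, inv_one, one_mul]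
  | succ n ih =>
    ext ρ y
    rw [pow_succ, Module.End.mul_apply, ih, transferOp_apply, transferOp_apply]
    have : ⇑(h.transferOp ρ) = transfer (d := d) φ ρ := rfl
    rw [this, (h.iterate n).transfer_comp h]
    rfl

end IsRegularMap

end TransferOperator

/-! ### Seminorms of the `C^k` topology -/

section Seminorms

variable {d : ℕ} {M : Type*} [TopologicalSpace M]
  {m : ℕ} {e : Fin m → OpenPartialHomeomorph M (EuclideanSpace ℝ (Fin d))}

/-- The supremum, over the charts of an atlas and over the closed unit ball, of the norm of the
`j`-th derivative in the chart. -/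
def chartSeminorm (e : Fin m → OpenPartialHomeomorph M (EuclideanSpace ℝ (Fin d))) (j : ℕ)
    (ρ : M → ℝ) : ℝ :=
  ⨆ p : Fin m × Metric.closedBall (0 : EuclideanSpace ℝ (Fin d)) 1,
    ‖iteratedFDeriv ℝ j (ρ ∘ (e p.1).symm) p.2‖

lemma chartSeminorm_nonneg (j : ℕ) (ρ : M → ℝ) : 0 ≤ chartSeminorm e j ρ :=
  Real.iSup_nonneg fun _ ↦ norm_nonneg _

namespace IsNormAtlas

variable [ChartedSpace (EuclideanSpace ℝ (Fin d)) M] (he : IsNormAtlas e)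

include he

lemma mem_target {i : Fin m} {p : EuclideanSpace ℝ (Fin d)} (hp : p ∈ Metric.closedBall 0 1) :
    p ∈ (e i).target :=
  he.ball_subset i (Metric.closedBall_subset_closedBall one_le_two hp)

lemma contDiffAt_comp_symm {k : ℕ} {ρ : M → ℝ} {i : Fin m} {p : EuclideanSpace ℝ (Fin d)}
    (hp : p ∈ (e i).target) (hρ : ContMDiff (𝓡 d) 𝓘(ℝ, ℝ) (k : WithTop ℕ∞) ρ) :
    ContDiffAt ℝ k (ρ ∘ (e i).symm) p :=
  (hρ.contMDiffAt.comp p ((contMDiffAt_symm_of_mem_maximalAtlas (he.smooth i) hp).of_le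
    (natCast_le_infty k))).contDiffAt

lemma norm_iteratedFDeriv_le_chartSeminorm {k j : ℕ} (hj : j ≤ k) {ρ : M → ℝ}
    (hρ : ContMDiff (𝓡 d) 𝓘(ℝ, ℝ) (k : WithTop ℕ∞) ρ) (i : Fin m)
    {p : EuclideanSpace ℝ (Fin d)} (hp : p ∈ Metric.closedBall 0 1) :
    ‖iteratedFDeriv ℝ j (ρ ∘ (e i).symm) p‖ ≤ chartSeminorm e j ρ := by
  have hbd : ∀ i, ∃ C, ∀ p ∈ Metric.closedBall (0 : EuclideanSpace ℝ (Fin d)) 1,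
      ‖iteratedFDeriv ℝ j (ρ ∘ (e i).symm) p‖ ≤ C := by
    intro i
    refine (isCompact_closedBall _ _).exists_bound_of_continuousOn fun p hp ↦ ?_
    have h1 := (he.contDiffAt_comp_symm (he.mem_target (i := i) hp) hρ).iteratedFDeriv_right
      (m := 0) (i := j) (by rw [zero_add]; exact_mod_cast hj)
    exact h1.continuousAt.continuousWithinAt
  choose C hC using hbd
  refine le_ciSup (f := fun p : Fin m × Metric.closedBall (0 : EuclideanSpace ℝ (Fin d)) 1 ↦
    ‖iteratedFDeriv ℝ j (ρ ∘ (e p.1).symm) p.2‖) ⟨∑ i, |C i|, ?_⟩ (i, ⟨p, hp⟩)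
  rintro _ ⟨⟨i, q⟩, rfl⟩
  exact ((hC i q q.2).trans (le_abs_self _)).trans
    (Finset.single_le_sum (f := fun i ↦ |C i|) (fun _ _ ↦ abs_nonneg _) (Finset.mem_univ i))

lemma chartSeminorm_le [Nonempty M] {j : ℕ} {ρ : M → ℝ} {C : ℝ}
    (h : ∀ i, ∀ p ∈ Metric.closedBall (0 : EuclideanSpace ℝ (Fin d)) 1,
      ‖iteratedFDeriv ℝ j (ρ ∘ (e i).symm) p‖ ≤ C) : chartSeminorm e j ρ ≤ C := by
  obtain ⟨i, -⟩ := he.cover (Classical.arbitrary M)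
  have : Nonempty (Fin m × Metric.closedBall (0 : EuclideanSpace ℝ (Fin d)) 1) :=
    ⟨i, 0, by simp⟩
  exact ciSup_le fun p ↦ h p.1 p.2 p.2.2

lemma abs_le_chartSeminorm_zero {ρ : M → ℝ} (hρ : Continuous ρ) (x : M) :
    |ρ x| ≤ chartSeminorm e 0 ρ := by
  obtain ⟨i, hx, hx'⟩ := he.cover x
  have h1 := he.norm_iteratedFDeriv_le_chartSeminorm (k := 0) le_rfl
    (contMDiff_zero_iff.2 hρ) i (Metric.ball_subset_closedBall hx')
  rwa [norm_iteratedFDeriv_zero, Function.comp_apply, (e i).left_inv hx] at h1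

lemma iSup_abs_eq_chartSeminorm_zero [Nonempty M] {ρ : M → ℝ} (hρ : Continuous ρ) :
    ⨆ x, |ρ x| = chartSeminorm e 0 ρ := by
  refine le_antisymm (ciSup_le fun x ↦ he.abs_le_chartSeminorm_zero hρ x)
    (he.chartSeminorm_le fun i p _ ↦ ?_)
  rw [norm_iteratedFDeriv_zero]
  exact le_ciSup (f := fun x ↦ |ρ x|) ⟨chartSeminorm e 0 ρ, by
    rintro _ ⟨x, rfl⟩
    exact he.abs_le_chartSeminorm_zero hρ x⟩ _

lemma atlasNorm_eq_sum [Nonempty M] (k : ℕ) {ρ : M → ℝ} (hρ : Continuous ρ) :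
    atlasNorm e k ρ = ∑ j ∈ Finset.range (k + 1), chartSeminorm e j ρ := by
  rw [atlasNorm, he.iSup_abs_eq_chartSeminorm_zero hρ, Finset.sum_range_succ', add_comm]
  congr 1
  rw [Finset.range_eq_Ico, Finset.sum_Ico_add' (fun j ↦ chartSeminorm e j ρ) 0 k 1, zero_add]
  rfl

end IsNormAtlas

end Seminorms

/-! ### Derivatives of the transfer operator in charts -/

section ChartEstimate

variable {d : ℕ} {M : Type*} [TopologicalSpace M] [ChartedSpace (EuclideanSpace ℝ (Fin d)) M]
  [IsManifold (𝓡 d) ∞ M] [RiemannianBundle (fun x : M ↦ TangentSpace (𝓡 d) x)]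
  {m : ℕ} {e : Fin m → OpenPartialHomeomorph M (EuclideanSpace ℝ (Fin d))}

omit [IsManifold (𝓡 d) ∞ M] in
/-- The differential of an inverse branch read in charts is controlled by the expansion constant
of the map. -/
lemma IsNormAtlas.expansionConst_mul_norm_branch_le (he : IsNormAtlas e)
    {φ b : M → M} {i j : Fin m} {p : EuclideanSpace ℝ (Fin d)} (hp : p ∈ Metric.closedBall 0 1)
    (hb : MDifferentiableAt (𝓡 d) (𝓡 d) b ((e i).symm p))
    (hφ : MDifferentiableAt (𝓡 d) (𝓡 d) φ (b ((e i).symm p)))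
    (hφb : ∀ᶠ y in 𝓝 ((e i).symm p), φ (b y) = y)
    (hsrc : b ((e i).symm p) ∈ (e j).source) (u : EuclideanSpace ℝ (Fin d)) :
    expansionConst (d := d) φ (b ((e i).symm p)) *
        ‖mfderiv (𝓡 d) (𝓡 d) (e j).symm (e j (b ((e i).symm p)))
          (fderiv ℝ (e j ∘ b ∘ (e i).symm) p u)‖
      ≤ ‖mfderiv (𝓡 d) (𝓡 d) (e i).symm p u‖ := by
  set H : EuclideanSpace ℝ (Fin d) → EuclideanSpace ℝ (Fin d) := e j ∘ b ∘ (e i).symm with hHdef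
  have hsymm : MDifferentiableAt (𝓡 d) (𝓡 d) (e i).symm p :=
    (mdifferentiable_of_mem_maximalAtlas (he.smooth i)).symm.mdifferentiableAt (he.mem_target hp)
  have hbs : MDifferentiableAt (𝓡 d) (𝓡 d) (b ∘ (e i).symm) p := hb.comp p hsymm
  have hej : MDifferentiableAt (𝓡 d) (𝓡 d) (e j) ((b ∘ (e i).symm) p) :=
    (mdifferentiable_of_mem_maximalAtlas (he.smooth j)).mdifferentiableAt hsrc
  have hH : MDifferentiableAt (𝓡 d) (𝓡 d) H p := hej.comp p hbs
  have hejs : MDifferentiableAt (𝓡 d) (𝓡 d) (e j).symm (H p) :=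
    (mdifferentiable_of_mem_maximalAtlas (he.smooth j)).symm.mdifferentiableAt
      ((e j).map_source hsrc)
  have eq₁ : (e j).symm ∘ H =ᶠ[𝓝 p] b ∘ (e i).symm := by
    filter_upwards [hbs.continuousAt ((e j).open_source.mem_nhds hsrc)] with q hq
    exact (e j).left_inv hq
  have hHp : (e j).symm (H p) = b ((e i).symm p) := (e j).left_inv hsrc
  have eq₂ : φ ∘ ((e j).symm ∘ H) =ᶠ[𝓝 p] (e i).symm := by
    filter_upwards [eq₁, hsymm.continuousAt.eventually hφb] with q hq hq'
    rw [Function.comp_apply, hq, Function.comp_apply, hq']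
  have hφ' : MDifferentiableAt (𝓡 d) (𝓡 d) φ (((e j).symm ∘ H) p) := by
    rw [Function.comp_apply, hHp]
    exact hφ
  have h1 : ‖mfderiv (𝓡 d) (𝓡 d) (φ ∘ ((e j).symm ∘ H)) p u‖
      ≤ ‖mfderiv (𝓡 d) (𝓡 d) (e i).symm p u‖ := (norm_mfderiv_congr eq₂ u).le
  rw [mfderiv_comp p hφ' (hejs.comp p hH), mfderiv_comp p hejs hH] at h1
  have h2 := expansionConst_mul_norm_le φ (((e j).symm ∘ H) p)
    ((mfderiv (𝓡 d) (𝓡 d) (e j).symm (H p)) ((mfderiv (𝓡 d) (𝓡 d) H p) u))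
  rw [mfderiv_eq_fderiv] at h2 h1
  have h3 : expansionConst (d := d) φ (b ((e i).symm p))
      = expansionConst (d := d) φ (((e j).symm ∘ H) p) := by rw [Function.comp_apply, hHp]
  rw [h3]
  exact h2.trans h1

omit [IsManifold (𝓡 d) ∞ M] in
lemma IsNormAtlas.norm_fderiv_branch_le (he : IsNormAtlas e) {c C : ℝ} (hc : 0 < c)
    (hcC : ∀ i, ∀ p ∈ Metric.closedBall (0 : EuclideanSpace ℝ (Fin d)) 1,
      ∀ u : EuclideanSpace ℝ (Fin d), c * ‖u‖ ≤ ‖mfderiv (𝓡 d) (𝓡 d) (e i).symm p u‖ ∧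
        ‖mfderiv (𝓡 d) (𝓡 d) (e i).symm p u‖ ≤ C * ‖u‖) (hC : 0 < C)
    {φ b : M → M} {i j : Fin m} {p : EuclideanSpace ℝ (Fin d)} (hp : p ∈ Metric.closedBall 0 1)
    (hb : MDifferentiableAt (𝓡 d) (𝓡 d) b ((e i).symm p))
    (hφ : MDifferentiableAt (𝓡 d) (𝓡 d) φ (b ((e i).symm p)))
    (hφb : ∀ᶠ y in 𝓝 ((e i).symm p), φ (b y) = y)
    (hE : 0 < expansionConst (d := d) φ (b ((e i).symm p)))
    (hsrc : b ((e i).symm p) ∈ (e j).source)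
    (hball : e j (b ((e i).symm p)) ∈ Metric.closedBall 0 1) :
    ‖fderiv ℝ (e j ∘ b ∘ (e i).symm) p‖
      ≤ C / c * (expansionConst (d := d) φ (b ((e i).symm p)))⁻¹ := by
  refine ContinuousLinearMap.opNorm_le_bound _ (by positivity) fun u ↦ ?_
  have h1 := (he.expansionConst_mul_norm_branch_le hp hb hφ hφb hsrc u).trans (hcC i p hp u).2
  have h2 := (hcC j _ hball (fderiv ℝ (e j ∘ b ∘ (e i).symm) p u)).1
  have h4 := (mul_le_mul_of_nonneg_left h2 (expansionConst_nonneg φ _)).trans h1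
  rw [← div_eq_mul_inv, div_div, div_mul_eq_mul_div, le_div_iff₀ (by positivity)]
  linarith [h4]

variable [IsContMDiffRiemannianBundle (𝓡 d) ∞ (EuclideanSpace ℝ (Fin d))
    (fun x : M ↦ TangentSpace (𝓡 d) x)]

/-- In the charts of a finite atlas, the Riemannian norm is uniformly comparable to the Euclidean
norm. -/
lemma IsNormAtlas.exists_norm_bounds (he : IsNormAtlas e) : ∃ c C : ℝ, 0 < c ∧ 0 < C ∧
    ∀ i, ∀ p ∈ Metric.closedBall (0 : EuclideanSpace ℝ (Fin d)) 1,
      ∀ u : EuclideanSpace ℝ (Fin d), c * ‖u‖ ≤ ‖mfderiv (𝓡 d) (𝓡 d) (e i).symm p u‖ ∧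
        ‖mfderiv (𝓡 d) (𝓡 d) (e i).symm p u‖ ≤ C * ‖u‖ := by
  have h1 : ∀ i, ∃ c C : ℝ, 0 < c ∧ 0 < C ∧
      ∀ p ∈ Metric.closedBall (0 : EuclideanSpace ℝ (Fin d)) 1,
      ∀ u : EuclideanSpace ℝ (Fin d), c * ‖u‖ ≤ ‖mfderiv (𝓡 d) (𝓡 d) (e i).symm p u‖ ∧
        ‖mfderiv (𝓡 d) (𝓡 d) (e i).symm p u‖ ≤ C * ‖u‖ := fun i ↦
    exists_norm_mfderiv_bounds (e i).open_target
      ((contMDiffOn_symm_of_mem_maximalAtlas (he.smooth i)).of_le (natCast_le_infty 1))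
      (isCompact_closedBall _ _) (fun p hp ↦ he.mem_target hp)
      fun p hp ↦ (bijective_mfderiv_symm (he.smooth i) (he.mem_target hp)).1
  choose c C hc hC h using h1
  have hsum : ∀ f : Fin m → ℝ, (∀ i, 0 < f i) → ∀ i, f i ≤ 1 + ∑ i, f i := fun f hf i ↦
    (Finset.single_le_sum (f := f) (fun i _ ↦ (hf i).le) (Finset.mem_univ i)).trans (by simp)
  have hpos : ∀ f : Fin m → ℝ, (∀ i, 0 < f i) → 0 < 1 + ∑ i, f i := fun f hf ↦
    add_pos_of_pos_of_nonneg one_pos (Finset.sum_nonneg fun i _ ↦ (hf i).le)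
  refine ⟨(1 + ∑ i, (c i)⁻¹)⁻¹, 1 + ∑ i, C i, inv_pos.2 (hpos _ fun i ↦ inv_pos.2 (hc i)),
    hpos _ hC, fun i p hp u ↦ ⟨le_trans ?_ (h i p hp u).1, (h i p hp u).2.trans ?_⟩⟩
  · gcongr
    rw [inv_le_comm₀ (hpos _ fun i ↦ inv_pos.2 (hc i)) (hc i)]
    exact hsum _ (fun i ↦ inv_pos.2 (hc i)) i
  · gcongr
    exact hsum _ hC i

end ChartEstimate

section SeminormEstimate

variable {d : ℕ} {M : Type*} [TopologicalSpace M] [ChartedSpace (EuclideanSpace ℝ (Fin d)) M]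
  [IsManifold (𝓡 d) ∞ M] [RiemannianBundle (fun x : M ↦ TangentSpace (𝓡 d) x)]
  [IsContMDiffRiemannianBundle (𝓡 d) ∞ (EuclideanSpace ℝ (Fin d))
    (fun x : M ↦ TangentSpace (𝓡 d) x)]
  {m : ℕ} {e : Fin m → OpenPartialHomeomorph M (EuclideanSpace ℝ (Fin d))}

namespace IsNormAtlas

/-- Each point is covered by a chart, in which the norms of the differentials are bounded by
compactness. -/
lemma exists_norm_mfderiv_self_bounds (he : IsNormAtlas e) {r : ℕ} {φ : M → M}
    (h : IsRegularMap d r φ) :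
    ∃ a b : ℝ, 0 < a ∧ 0 < b ∧ ∀ x, ∀ v : TangentSpace (𝓡 d) x,
      a * ‖v‖ ≤ ‖mfderiv (𝓡 d) (𝓡 d) φ x v‖ ∧ ‖mfderiv (𝓡 d) (𝓡 d) φ x v‖ ≤ b * ‖v‖ := by
  obtain ⟨c, C, hc, hC, hcC⟩ := he.exists_norm_bounds
  have h1 : ∀ i, ∃ a b : ℝ, 0 < a ∧ 0 < b ∧
      ∀ p ∈ Metric.closedBall (0 : EuclideanSpace ℝ (Fin d)) 1,
      ∀ u : EuclideanSpace ℝ (Fin d), a * ‖u‖ ≤ ‖mfderiv (𝓡 d) (𝓡 d) (φ ∘ (e i).symm) p u‖ ∧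
        ‖mfderiv (𝓡 d) (𝓡 d) (φ ∘ (e i).symm) p u‖ ≤ b * ‖u‖ := fun i ↦
    exists_norm_mfderiv_bounds (e i).open_target
      ((h.contMDiff.of_le (by exact_mod_cast h.one_le)).comp_contMDiffOn
        ((contMDiffOn_symm_of_mem_maximalAtlas (he.smooth i)).of_le (natCast_le_infty 1)))
      (isCompact_closedBall _ _) (fun p hp ↦ he.mem_target hp)
      fun p hp ↦ (bijective_mfderiv_comp_symm (he.smooth i) (he.mem_target hp)
        (h.mdifferentiable _) (h.bijective _)).1
  choose a b ha hb hab using h1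
  have hx : ∀ x, ∃ i, ∀ v : TangentSpace (𝓡 d) x, a i / C * ‖v‖ ≤ ‖mfderiv (𝓡 d) (𝓡 d) φ x v‖ ∧
      ‖mfderiv (𝓡 d) (𝓡 d) φ x v‖ ≤ b i / c * ‖v‖ := by
    intro x
    obtain ⟨i, hx, hxb⟩ := he.cover x
    refine ⟨i, ?_⟩
    have hp := Metric.ball_subset_closedBall hxb
    set p := e i x
    have hpx : (e i).symm p = x := (e i).left_inv hx
    rw [← hpx]
    have hsurj := (bijective_mfderiv_symm (he.smooth i) (he.mem_target hp)).2
    have hs : MDifferentiableAt (𝓡 d) (𝓡 d) (e i).symm p :=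
      (mdifferentiable_of_mem_maximalAtlas (he.smooth i)).symm.mdifferentiableAt
        (he.mem_target hp)
    have hcomp := mfderiv_comp p (h.mdifferentiable _) hs
    intro v
    obtain ⟨u, rfl⟩ := hsurj v
    constructor
    · have h2 := (hab i p hp u).1
      rw [hcomp] at h2
      refine le_trans ?_ h2
      rw [div_mul_eq_mul_div, div_le_iff₀ hC, mul_assoc, mul_comm _ C]
      exact mul_le_mul_of_nonneg_left (hcC i p hp u).2 (ha i).le
    · have h2 := (hab i p hp u).2
      rw [hcomp] at h2
      refine le_trans h2 ?_
      rw [div_mul_eq_mul_div, le_div_iff₀ hc, mul_assoc, mul_comm _ c]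
      exact mul_le_mul_of_nonneg_left (hcC i p hp u).1 (hb i).le
  have hsum : ∀ f : Fin m → ℝ, (∀ i, 0 < f i) → ∀ i, f i ≤ 1 + ∑ i, f i := fun f hf i ↦
    (Finset.single_le_sum (f := f) (fun i _ ↦ (hf i).le) (Finset.mem_univ i)).trans (by simp)
  have hpos : ∀ f : Fin m → ℝ, (∀ i, 0 < f i) → 0 < 1 + ∑ i, f i := fun f hf ↦
    add_pos_of_pos_of_nonneg one_pos (Finset.sum_nonneg fun i _ ↦ (hf i).le)
  have ha' : ∀ i, 0 < (a i / C)⁻¹ := fun i ↦ inv_pos.2 (div_pos (ha i) hC)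
  have hb' : ∀ i, 0 < b i / c := fun i ↦ div_pos (hb i) hc
  refine ⟨(1 + ∑ i, (a i / C)⁻¹)⁻¹, 1 + ∑ i, b i / c, inv_pos.2 (hpos _ ha'), hpos _ hb',
    fun x v ↦ ?_⟩
  obtain ⟨i, hi⟩ := hx x
  refine ⟨le_trans (mul_le_mul_of_nonneg_right ?_ (norm_nonneg v)) (hi v).1,
    (hi v).2.trans (mul_le_mul_of_nonneg_right (hsum _ hb' i) (norm_nonneg v))⟩
  rw [inv_le_comm₀ (hpos _ ha') (div_pos (ha i) hC)]
  exact hsum _ ha' i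

lemma exists_expansionConst_bounds (hd : 1 ≤ d) (he : IsNormAtlas e) {r : ℕ} {φ : M → M}
    (h : IsRegularMap d r φ) :
    ∃ a b : ℝ, 0 < a ∧ 0 < b ∧ ∀ x, a ≤ expansionConst (d := d) φ x ∧
      expansionConst (d := d) φ x ≤ b := by
  obtain ⟨a, b, ha, hb, hab⟩ := he.exists_norm_mfderiv_self_bounds h
  exact ⟨a, b, ha, hb, fun x ↦ ⟨le_expansionConst hd fun v ↦ (hab x v).1,
    expansionConst_le hd fun v ↦ (hab x v).2⟩⟩

lemma expansionConst_pos (hd : 1 ≤ d) (he : IsNormAtlas e) {r : ℕ} {φ : M → M}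
    (h : IsRegularMap d r φ) (x : M) : 0 < expansionConst (d := d) φ x := by
  obtain ⟨a, b, ha, -, hab⟩ := he.exists_expansionConst_bounds hd h
  exact ha.trans_le (hab x).1

/-- The contribution of one inverse branch to the derivative of order `k` of a transfer operator,
near a point of a chart. -/
lemma exists_branch_estimate (hd : 1 ≤ d) (he : IsNormAtlas e) {c C : ℝ} (hc : 0 < c)
    (hC : 0 < C) (hcC : ∀ i, ∀ p ∈ Metric.closedBall (0 : EuclideanSpace ℝ (Fin d)) 1,
      ∀ u : EuclideanSpace ℝ (Fin d), c * ‖u‖ ≤ ‖mfderiv (𝓡 d) (𝓡 d) (e i).symm p u‖ ∧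
        ‖mfderiv (𝓡 d) (𝓡 d) (e i).symm p u‖ ≤ C * ‖u‖)
    {r k : ℕ} (hk : k + 1 ≤ r) {φ : M → M} (h : IsRegularMap d r φ) {w : M → ℝ}
    (hw : ContMDiff (𝓡 d) 𝓘(ℝ, ℝ) (k : WithTop ℕ∞) w) {b : M → M} {V : Set M} (hV : IsOpen V)
    (hb : ∀ y ∈ V, φ (b y) = y ∧ ContMDiffAt (𝓡 d) (𝓡 d) (r : WithTop ℕ∞) b y)
    (i : Fin m) {p₀ : EuclideanSpace ℝ (Fin d)} (hp₀ : p₀ ∈ Metric.closedBall 0 1)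
    (hp₀V : (e i).symm p₀ ∈ V) :
    ∃ D : ℝ, 0 ≤ D ∧ ∀ᶠ p in 𝓝 p₀, p ∈ Metric.closedBall 0 1 → ∀ ρ : M → ℝ,
      ContMDiff (𝓡 d) 𝓘(ℝ, ℝ) (k : WithTop ℕ∞) ρ →
      ContDiffAt ℝ k ((fun x ↦ w x * ρ x) ∘ b ∘ (e i).symm) p ∧
      ‖iteratedFDeriv ℝ k ((fun x ↦ w x * ρ x) ∘ b ∘ (e i).symm) p‖ ≤
        (Fintype.card (OrderedFinpartition k) : ℝ) * (C / c) ^ k *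
          (|w (b ((e i).symm p))| * (expansionConst (d := d) φ (b ((e i).symm p)))⁻¹ ^ k) *
          chartSeminorm e k ρ + D * ∑ j ∈ Finset.range k, chartSeminorm e j ρ := by
  obtain ⟨j, hj, hjb⟩ := he.cover (b ((e i).symm p₀))
  set H : EuclideanSpace ℝ (Fin d) → EuclideanSpace ℝ (Fin d) := e j ∘ b ∘ (e i).symm with hH
  have hkr : (k : WithTop ℕ∞) ≤ r := by exact_mod_cast (by omega : k ≤ r)
  have hsym : ∀ p ∈ (e i).target, ContMDiffAt (𝓡 d) (𝓡 d) (r : WithTop ℕ∞) (e i).symm p :=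
    fun p hp ↦ (contMDiffAt_symm_of_mem_maximalAtlas (he.smooth i) hp).of_le (natCast_le_infty r)
  have hHs : ∀ p ∈ (e i).target, (e i).symm p ∈ V → b ((e i).symm p) ∈ (e j).source →
      ContDiffAt ℝ r H p := by
    intro p hp hpV hpj
    have h1 := ((hb _ hpV).2).comp p (hsym p hp)
    have h2 := (contMDiffAt_of_mem_maximalAtlas (he.smooth j) hpj).of_le (natCast_le_infty r)
    exact (ContMDiffAt.comp (g := e j) p h2 h1).contDiffAt
  have ht₀ := he.mem_target (i := i) hp₀
  have hc₀ : ContinuousAt (e i).symm p₀ := (hsym p₀ ht₀).continuousAt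
  have hbc₀ : ContinuousAt (b ∘ (e i).symm) p₀ :=
    ContinuousAt.comp (g := b) ((hb _ hp₀V).2).continuousAt hc₀
  have hH₀ := hHs p₀ ht₀ hp₀V hj
  have ev₁ : ∀ᶠ p in 𝓝 p₀, p ∈ (e i).target ∧ (e i).symm p ∈ V ∧
      b ((e i).symm p) ∈ (e j).source ∧ H p ∈ Metric.ball 0 1 := by
    filter_upwards [(e i).open_target.mem_nhds ht₀, hc₀ (hV.mem_nhds hp₀V),
      hbc₀ ((e j).open_source.mem_nhds hj),
      hH₀.continuousAt (Metric.isOpen_ball.mem_nhds hjb)] with p h1 h2 h3 h4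
    exact ⟨h1, h2, h3, h4⟩
  -- bounds of the derivatives of the weight and of the branch, uniform near `p₀`
  have hwj : ContDiffAt ℝ k (w ∘ (e j).symm) (H p₀) :=
    he.contDiffAt_comp_symm (he.mem_target (Metric.ball_subset_closedBall hjb)) hw
  obtain ⟨B, hB⟩ : ∃ B : ℝ, ∀ᶠ p in 𝓝 p₀, ∀ l ≤ k,
      ‖iteratedFDeriv ℝ l (w ∘ (e j).symm) (H p)‖ ≤ B ∧ ‖iteratedFDeriv ℝ l H p‖ ≤ B := by
    have hl : ∀ l ∈ Finset.range (k + 1), ∃ B : ℝ, ∀ᶠ p in 𝓝 p₀,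
        ‖iteratedFDeriv ℝ l (w ∘ (e j).symm) (H p)‖ ≤ B ∧ ‖iteratedFDeriv ℝ l H p‖ ≤ B := by
      intro l hl
      have hlk : (0 : WithTop ℕ∞) + l ≤ k := by
        rw [zero_add]
        exact_mod_cast Nat.lt_succ_iff.1 (Finset.mem_range.1 hl)
      have c1 : ContinuousAt (fun p ↦ ‖iteratedFDeriv ℝ l (w ∘ (e j).symm) (H p)‖) p₀ :=
        (ContinuousAt.comp (g := iteratedFDeriv ℝ l (w ∘ (e j).symm))
          (hwj.iteratedFDeriv_right (m := 0) hlk).continuousAt hH₀.continuousAt).norm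
      have c2 : ContinuousAt (fun p ↦ ‖iteratedFDeriv ℝ l H p‖) p₀ :=
        ((hH₀.of_le hkr).iteratedFDeriv_right (m := 0) hlk).continuousAt.norm
      refine ⟨max (‖iteratedFDeriv ℝ l (w ∘ (e j).symm) (H p₀)‖ + 1)
        (‖iteratedFDeriv ℝ l H p₀‖ + 1), ?_⟩
      filter_upwards [c1.eventually_le_const (lt_add_one _),
        c2.eventually_le_const (lt_add_one _)] with p h1 h2
      exact ⟨h1.trans (le_max_left _ _), h2.trans (le_max_right _ _)⟩
    choose! B hB using hl
    refine ⟨∑ l ∈ Finset.range (k + 1), |B l|, ?_⟩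
    filter_upwards [(Filter.eventually_all_finset _).2 hB] with p hp l hlk
    have hmem := Finset.mem_range.2 (Nat.lt_succ_of_le hlk)
    have hle : B l ≤ ∑ l ∈ Finset.range (k + 1), |B l| := (le_abs_self _).trans
      (Finset.single_le_sum (f := fun l ↦ |B l|) (fun _ _ ↦ abs_nonneg _) hmem)
    exact ⟨(hp l hmem).1.trans hle, (hp l hmem).2.trans hle⟩
  obtain ⟨D, hD, hest⟩ := exists_norm_iteratedFDeriv_mul_comp_le
    (E := EuclideanSpace ℝ (Fin d)) (F := EuclideanSpace ℝ (Fin d)) k B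
  refine ⟨D, hD, ?_⟩
  filter_upwards [ev₁.eventually_nhds, hB] with p hev hBp hpb ρ hρ
  obtain ⟨hpt, hpV, hpj, hHp⟩ := hev.self_of_nhds
  have hHcb := Metric.ball_subset_closedBall hHp
  have heq : (fun x ↦ w x * ρ x) ∘ b ∘ (e i).symm =ᶠ[𝓝 p]
      (fun q ↦ (w ∘ (e j).symm) q * (ρ ∘ (e j).symm) q) ∘ H := by
    filter_upwards [hev] with q hq
    simp only [hH, Function.comp_apply, (e j).left_inv hq.2.2.1]
  have hwc := he.contDiffAt_comp_symm (he.mem_target (i := j) hHcb) hw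
  have hρc := he.contDiffAt_comp_symm (he.mem_target (i := j) hHcb) hρ
  have hHc := (hHs p hpt hpV hpj).of_le hkr
  refine ⟨((hwc.mul hρc).comp p hHc).congr_of_eventuallyEq heq, ?_⟩
  rw [(heq.iteratedFDeriv ℝ k).self_of_nhds]
  refine (hest _ _ H p hwc hρc hHc (fun l hl ↦ (hBp l hl).1)
    fun l _ hl ↦ (hBp l hl).2).trans ?_
  have hjx : (e j).symm (H p) = b ((e i).symm p) := (e j).left_inv hpj
  have hE := he.expansionConst_pos hd h (b ((e i).symm p))
  have hfd : ‖fderiv ℝ H p‖ ≤ C / c * (expansionConst (d := d) φ (b ((e i).symm p)))⁻¹ :=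
    he.norm_fderiv_branch_le hc hcC hC hpb
      ((hb _ hpV).2.mdifferentiableAt h.ne_zero) (h.mdifferentiable _)
      (by filter_upwards [hV.mem_nhds hpV] with y hy using (hb y hy).1) hE hpj hHcb
  have hsemi : ∀ l ≤ k, ‖iteratedFDeriv ℝ l (ρ ∘ (e j).symm) (H p)‖ ≤ chartSeminorm e l ρ :=
    fun l hl ↦ he.norm_iteratedFDeriv_le_chartSeminorm hl hρ j hHcb
  refine add_le_add (mul_le_mul ?_ (hsemi k le_rfl) (norm_nonneg _) (by positivity))
    (mul_le_mul_of_nonneg_left (Finset.sum_le_sum fun l hl ↦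
      hsemi l (Finset.mem_range.1 hl).le) hD)
  rw [Function.comp_apply, hjx, mul_assoc]
  refine mul_le_mul_of_nonneg_left ?_ (Nat.cast_nonneg _)
  calc |w (b ((e i).symm p))| * ‖fderiv ℝ H p‖ ^ k
      ≤ |w (b ((e i).symm p))|
        * (C / c * (expansionConst (d := d) φ (b ((e i).symm p)))⁻¹) ^ k := by gcongr
    _ = _ := by rw [mul_pow]; ring

variable [T2Space M] [CompactSpace M]

/-- The seminorm of order `k` of the image of a weighted transfer operator: the seminorm of order
`k` is multiplied by a sum over the fibres, with a constant `K` that does not depend on the map,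
and the other terms only involve seminorms of lower order. -/
lemma exists_seminorm_estimate [Nonempty M] (hd : 1 ≤ d) (he : IsNormAtlas e) (k : ℕ) :
    ∃ K : ℝ, 0 < K ∧ ∀ (r : ℕ) (φ : M → M) (h : IsRegularMap d r φ) (w : M → ℝ) (S : ℝ),
      k + 1 ≤ r → ContMDiff (𝓡 d) 𝓘(ℝ, ℝ) (k : WithTop ℕ∞) w →
      (∀ y, ∑ x ∈ h.fiber y, |w x| * (expansionConst (d := d) φ x)⁻¹ ^ k ≤ S) →
      ∃ D : ℝ, 0 ≤ D ∧ ∀ ρ : M → ℝ, ContMDiff (𝓡 d) 𝓘(ℝ, ℝ) (k : WithTop ℕ∞) ρ →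
        chartSeminorm e k (wtransfer φ w ρ) ≤ K * S * chartSeminorm e k ρ
          + D * ∑ j ∈ Finset.range k, chartSeminorm e j ρ := by
  obtain ⟨c, C, hc, hC, hcC⟩ := he.exists_norm_bounds
  refine ⟨Fintype.card (OrderedFinpartition k) * (C / c) ^ k, ?_, ?_⟩
  · have : 0 < Fintype.card (OrderedFinpartition k) :=
      Fintype.card_pos_iff.2 ⟨OrderedFinpartition.atomic k⟩
    positivity
  intro r φ h w S hk hw hS
  set K : ℝ := (Fintype.card (OrderedFinpartition k) : ℝ) * (C / c) ^ k
  have hK : 0 ≤ K := by positivity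
  have hloc : ∀ i, ∃ D : ℝ, 0 ≤ D ∧
      ∀ p ∈ Metric.closedBall (0 : EuclideanSpace ℝ (Fin d)) 1, ∀ ρ : M → ℝ,
        ContMDiff (𝓡 d) 𝓘(ℝ, ℝ) (k : WithTop ℕ∞) ρ →
        ‖iteratedFDeriv ℝ k (wtransfer φ w ρ ∘ (e i).symm) p‖ ≤ K * S * chartSeminorm e k ρ
          + D * ∑ j ∈ Finset.range k, chartSeminorm e j ρ := by
    intro i
    -- by compactness of the ball it suffices to find `D` near each point
    refine (isCompact_closedBall (0 : EuclideanSpace ℝ (Fin d)) 1).induction_on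
      (p := fun s ↦ ∃ D : ℝ, 0 ≤ D ∧ ∀ p ∈ s, ∀ ρ : M → ℝ,
        ContMDiff (𝓡 d) 𝓘(ℝ, ℝ) (k : WithTop ℕ∞) ρ →
        ‖iteratedFDeriv ℝ k (wtransfer φ w ρ ∘ (e i).symm) p‖ ≤ K * S * chartSeminorm e k ρ
          + D * ∑ j ∈ Finset.range k, chartSeminorm e j ρ) ⟨0, le_rfl, by simp⟩ ?_ ?_ ?_
    · rintro s t hst ⟨D, hD, hDt⟩
      exact ⟨D, hD, fun p hp ↦ hDt p (hst hp)⟩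
    · rintro s t ⟨D, hD, hDs⟩ ⟨D', hD', hDt⟩
      have hnn : ∀ ρ : M → ℝ, 0 ≤ ∑ j ∈ Finset.range k, chartSeminorm e j ρ :=
        fun ρ ↦ Finset.sum_nonneg fun _ _ ↦ chartSeminorm_nonneg _ _
      refine ⟨max D D', hD.trans (le_max_left _ _), ?_⟩
      rintro p (hp | hp) ρ hρ
      · exact (hDs p hp ρ hρ).trans (add_le_add_right
          (mul_le_mul_of_nonneg_right (le_max_left _ _) (hnn ρ)) _)
      · exact (hDt p hp ρ hρ).trans (add_le_add_right
          (mul_le_mul_of_nonneg_right (le_max_right _ _) (hnn ρ)) _)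
    · intro p₀ hp₀
      obtain ⟨V, hV, hyV, b, hb, hsum⟩ := h.exists_wtransfer_eq_sum ((e i).symm p₀)
      have hbr := fun a (ha : a ∈ h.fiber ((e i).symm p₀)) ↦
        he.exists_branch_estimate hd hc hC hcC hk h hw (b := b a) hV
          (fun y hy ↦ (hb y hy a ha).2) i hp₀ hyV
      choose! D hD hDp using hbr
      have hc₀ : ContinuousAt (e i).symm p₀ :=
        (e i).symm.continuousAt (he.mem_target hp₀)
      have hev := ((Filter.eventually_all_finset _).2 hDp).and
        (hc₀.eventually (hV.mem_nhds hyV)).eventually_nhds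
      refine ⟨{p | p ∈ Metric.closedBall (0 : EuclideanSpace ℝ (Fin d)) 1 ∧
        (∀ a ∈ h.fiber ((e i).symm p₀), p ∈ Metric.closedBall 0 1 → ∀ ρ : M → ℝ,
          ContMDiff (𝓡 d) 𝓘(ℝ, ℝ) (k : WithTop ℕ∞) ρ →
          ContDiffAt ℝ k ((fun x ↦ w x * ρ x) ∘ b a ∘ (e i).symm) p ∧
          ‖iteratedFDeriv ℝ k ((fun x ↦ w x * ρ x) ∘ b a ∘ (e i).symm) p‖ ≤
            K * (|w (b a ((e i).symm p))|
              * (expansionConst (d := d) φ (b a ((e i).symm p)))⁻¹ ^ k) *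
              chartSeminorm e k ρ + D a * ∑ j ∈ Finset.range k, chartSeminorm e j ρ) ∧
        ∀ᶠ q in 𝓝 p, (e i).symm q ∈ V}, ?_, ∑ a ∈ h.fiber ((e i).symm p₀), D a,
        Finset.sum_nonneg hD, ?_⟩
      · filter_upwards [self_mem_nhdsWithin, mem_nhdsWithin_of_mem_nhds hev] with p hp hp'
        exact ⟨hp, hp'.1, hp'.2⟩
      · rintro p ⟨hpb, hpD, hpV⟩ ρ hρ
        have heq : wtransfer φ w ρ ∘ (e i).symm =ᶠ[𝓝 p] fun q ↦
            ∑ a ∈ h.fiber ((e i).symm p₀), ((fun x ↦ w x * ρ x) ∘ b a ∘ (e i).symm) q := by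
          filter_upwards [hpV] with q hq
          rw [Function.comp_apply, h.wtransfer_apply]
          exact hsum (fun x ↦ w x * ρ x) _ hq
        rw [(heq.iteratedFDeriv ℝ k).self_of_nhds,
          iteratedFDeriv_fun_sum_apply fun a ha ↦ (hpD a ha hpb ρ hρ).1]
        refine (norm_sum_le _ _).trans ((Finset.sum_le_sum fun a ha ↦
          (hpD a ha hpb ρ hρ).2).trans ?_)
        rw [Finset.sum_add_distrib, ← Finset.sum_mul, ← Finset.sum_mul, ← Finset.mul_sum,
          ← hsum (fun x ↦ |w x| * (expansionConst (d := d) φ x)⁻¹ ^ k) _ hpV.self_of_nhds]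
        gcongr
        · exact chartSeminorm_nonneg _ _
        · exact hS _
  choose D hD hDi using hloc
  refine ⟨∑ i, D i, Finset.sum_nonneg fun i _ ↦ hD i, fun ρ hρ ↦
    he.chartSeminorm_le fun i p hp ↦ (hDi i p hp ρ hρ).trans ?_⟩
  gcongr
  · exact Finset.sum_nonneg fun _ _ ↦ chartSeminorm_nonneg _ _
  · exact Finset.single_le_sum (f := D) (fun i _ ↦ hD i) (Finset.mem_univ i)

end IsNormAtlas

end SeminormEstimate

/-! ### Spectral radius of a bounded operator -/

section SpectralRadius

variable {V : Type*} [AddCommGroup V] [Module ℝ V] {N : Seminorm ℝ V} {A B : Module.End ℝ V}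

lemma opNorm_le {C : ℝ} (hC : 0 ≤ C) (h : ∀ v, N (A v) ≤ C * N v) : opNorm N A ≤ C := by
  refine Real.iSup_le (fun v ↦ (h v).trans ?_) hC
  exact (mul_le_mul_of_nonneg_left v.2 hC).trans (mul_one C).le

lemma opNorm_nonneg : 0 ≤ opNorm N A := Real.iSup_nonneg fun _ ↦ apply_nonneg _ _

lemma IsBoundedOp.le_opNorm (hA : IsBoundedOp N A) (v : V) : N (A v) ≤ opNorm N A * N v := by
  obtain ⟨C, hC⟩ := hA
  rcases (apply_nonneg N v).eq_or_lt with h0 | h0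
  · have := hC v
    rw [← h0, mul_zero] at this ⊢
    exact this
  · have hbdd : BddAbove (Set.range fun v : {v : V // N v ≤ 1} ↦ N (A v.1)) := by
      refine ⟨|C|, ?_⟩
      rintro _ ⟨v, rfl⟩
      refine (hC v).trans ((mul_le_mul_of_nonneg_right (le_abs_self C) (apply_nonneg _ _)).trans ?_)
      exact (mul_le_mul_of_nonneg_left v.2 (abs_nonneg C)).trans (mul_one _).le
    have hmem : N ((N v)⁻¹ • v) ≤ 1 := by
      rw [map_smul_eq_mul, norm_inv, Real.norm_of_nonneg h0.le, inv_mul_cancel₀ h0.ne']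
    have := le_ciSup hbdd ⟨(N v)⁻¹ • v, hmem⟩
    simp only [map_smul, map_smul_eq_mul, norm_inv, Real.norm_of_nonneg h0.le] at this
    rwa [inv_mul_le_iff₀ h0, mul_comm] at this

lemma IsBoundedOp.mul (hA : IsBoundedOp N A) (hB : IsBoundedOp N B) : IsBoundedOp N (A * B) :=
  ⟨opNorm N A * opNorm N B, fun v ↦ (hA.le_opNorm (B v)).trans (by
    rw [mul_assoc]
    exact mul_le_mul_of_nonneg_left (hB.le_opNorm v) opNorm_nonneg)⟩

lemma IsBoundedOp.opNorm_mul_le (hA : IsBoundedOp N A) (hB : IsBoundedOp N B) :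
    opNorm N (A * B) ≤ opNorm N A * opNorm N B :=
  opNorm_le (mul_nonneg opNorm_nonneg opNorm_nonneg) fun v ↦ (hA.le_opNorm (B v)).trans (by
    rw [mul_assoc]
    exact mul_le_mul_of_nonneg_left (hB.le_opNorm v) opNorm_nonneg)

lemma IsBoundedOp.pow (hA : IsBoundedOp N A) (n : ℕ) : IsBoundedOp N (A ^ n) := by
  induction n with
  | zero => exact ⟨1, fun v ↦ by simp⟩
  | succ n ih => exact ih.mul hA

/-- Fekete's lemma gives the existence of the spectral radius as soon as the norms of the powers
are bounded from below. -/
lemma IsBoundedOp.tendsto_radiusSeq (hA : IsBoundedOp N A) {c : ℝ} (hc : 0 < c)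
    (hcA : ∀ n, c ≤ opNorm N (A ^ n)) :
    Tendsto (radiusSeq N A) atTop (𝓝 (specRadius N A)) := by
  have hpos : ∀ n, 0 < opNorm N (A ^ n) := fun n ↦ hc.trans_le (hcA n)
  have hsub : Subadditive fun n ↦ Real.log (opNorm N (A ^ n)) := by
    intro m n
    beta_reduce
    rw [← Real.log_mul (hpos m).ne' (hpos n).ne', pow_add]
    exact Real.log_le_log (by rw [← pow_add]; exact hpos _) ((hA.pow m).opNorm_mul_le (hA.pow n))
  have hbdd : BddBelow (Set.range fun n : ℕ ↦ Real.log (opNorm N (A ^ n)) / n) := by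
    refine ⟨-|Real.log c|, ?_⟩
    rintro _ ⟨n, rfl⟩
    rcases Nat.eq_zero_or_pos n with rfl | hn
    · simp
    · have hn' : (1 : ℝ) ≤ n := by exact_mod_cast hn
      rw [le_div_iff₀ (by positivity)]
      have h1 : Real.log c ≤ Real.log (opNorm N (A ^ n)) := Real.log_le_log hc (hcA n)
      nlinarith [neg_abs_le (Real.log c), abs_nonneg (Real.log c)]
  refine tendsto_nhds_limUnder ⟨Real.exp hsub.lim, ?_⟩
  refine ((Real.continuous_exp.tendsto _).comp (hsub.tendsto_lim hbdd)).congr fun n ↦ ?_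
  rw [Function.comp_apply, radiusSeq, Real.rpow_def_of_pos (hpos n), mul_one_div]

lemma IsBoundedOp.one_le_specRadius (hA : IsBoundedOp N A) {c : ℝ} (hc : 0 < c)
    (hcA : ∀ n, c ≤ opNorm N (A ^ n)) : 1 ≤ specRadius N A := by
  have h1 : Tendsto (fun n : ℕ ↦ c ^ (1 / (n : ℝ))) atTop (𝓝 1) := by
    have := (tendsto_const_nhds (x := c)).rpow tendsto_one_div_atTop_nhds_zero_nat
      (Or.inl hc.ne')
    simpa using this
  refine le_of_tendsto_of_tendsto' h1 (hA.tendsto_radiusSeq hc hcA) fun n ↦ ?_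
  exact Real.rpow_le_rpow hc.le (hcA n) (by positivity)

/-- Exponential bounds along the multiples of `n` suffice, because the limit that defines the
spectral radius exists. -/
lemma specRadius_pow_le (hlim : Tendsto (radiusSeq N A) atTop (𝓝 (specRadius N A)))
    {n : ℕ} (hn : 0 < n) {b s : ℝ} (hb : 0 < b) (hs : 0 ≤ s)
    (h : ∀ l : ℕ, opNorm N (A ^ (n * l)) ≤ b * s ^ l) : specRadius N A ^ n ≤ s := by
  have hsub : Tendsto (fun l : ℕ ↦ n * l) atTop atTop := tendsto_id.const_mul_atTop' hn
  have h1 := (hlim.comp hsub).pow n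
  have h2 : Tendsto (fun l : ℕ ↦ b ^ (1 / (l : ℝ)) * s) atTop (𝓝 (1 * s)) := by
    have := (tendsto_const_nhds (x := b)).rpow tendsto_one_div_atTop_nhds_zero_nat
      (Or.inl hb.ne')
    simp only [Real.rpow_zero] at this
    exact this.mul_const s
  rw [one_mul] at h2
  refine le_of_tendsto_of_tendsto h1 h2 ?_
  filter_upwards [eventually_gt_atTop 0] with l hl
  have hl' : (l : ℝ) ≠ 0 := by exact_mod_cast hl.ne'
  have hn' : (n : ℝ) ≠ 0 := by exact_mod_cast hn.ne'
  have e1 : (radiusSeq N A (n * l)) ^ n = opNorm N (A ^ (n * l)) ^ (1 / (l : ℝ)) := by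
    rw [radiusSeq, ← Real.rpow_natCast, ← Real.rpow_mul opNorm_nonneg]
    congr 1
    push_cast
    field_simp
  rw [Function.comp_apply, e1]
  refine (Real.rpow_le_rpow opNorm_nonneg (h l) (by positivity)).trans ?_
  rw [Real.mul_rpow hb.le (by positivity), ← Real.rpow_natCast s l, ← Real.rpow_mul hs,
    mul_one_div_cancel hl', Real.rpow_one]

/-- If an operator is block triangular for a finite family of seminorms, with diagonal entries at
most `α`, then its powers grow at most like those of any `s > α`: in the equivalent norm
`∑ η ^ j * p j` with `η` small, the terms below the diagonal are negligible. -/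
lemma exists_pow_le_of_triangular {r : ℕ} {p : ℕ → V → ℝ} (hp : ∀ j v, 0 ≤ p j v) {a b : ℝ}
    (ha : 0 < a) (hb : 0 < b) (hN : ∀ v, a * ∑ j ∈ Finset.range r, p j v ≤ N v ∧
      N v ≤ b * ∑ j ∈ Finset.range r, p j v) {α D s : ℝ} (hα : 0 ≤ α) (hD : 0 ≤ D)
    (htri : ∀ k < r, ∀ v, p k (B v) ≤ α * p k v + D * ∑ j ∈ Finset.range k, p j v)
    (hs : α < s) : ∃ C : ℝ, 0 < C ∧ ∀ l v, N ((B ^ l) v) ≤ C * s ^ l * N v := by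
  have hs0 : 0 < s := hα.trans_lt hs
  obtain ⟨η, hη0, hη1, hηs⟩ : ∃ η : ℝ, 0 < η ∧ η ≤ 1 ∧ α + D * r * η ≤ s := by
    refine ⟨min 1 ((s - α) / (D * r + 1)), lt_min one_pos (div_pos (sub_pos.2 hs) (by positivity)),
      min_le_left _ _, ?_⟩
    have h1 : D * r * min 1 ((s - α) / (D * r + 1)) ≤ D * r * ((s - α) / (D * r + 1)) :=
      mul_le_mul_of_nonneg_left (min_le_right _ _) (by positivity)
    have h2 : D * r * ((s - α) / (D * r + 1)) ≤ s - α := by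
      rw [mul_div_assoc', div_le_iff₀ (by positivity)]
      nlinarith [sub_pos.2 hs, mul_nonneg hD (Nat.cast_nonneg (α := ℝ) r)]
    linarith
  set q : V → ℝ := fun v ↦ ∑ k ∈ Finset.range r, η ^ k * p k v with hq
  have hq0 : ∀ v, 0 ≤ q v := fun v ↦ Finset.sum_nonneg fun k _ ↦ mul_nonneg (by positivity) (hp k v)
  have hstep : ∀ v, q (B v) ≤ s * q v := by
    intro v
    have h1 : ∀ k ∈ Finset.range r, η ^ k * p k (B v) ≤ α * (η ^ k * p k v) + D * η * q v := by
      intro k hk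
      have hkr := Finset.mem_range.1 hk
      have h2 : η ^ k * ∑ j ∈ Finset.range k, p j v ≤ η * q v := by
        rw [Finset.mul_sum, hq, Finset.mul_sum]
        refine (Finset.sum_le_sum fun j hj ↦ ?_).trans (Finset.sum_le_sum_of_subset_of_nonneg
          (Finset.range_subset_range.2 hkr.le) fun j _ _ ↦
            mul_nonneg hη0.le (mul_nonneg (by positivity) (hp j v)))
        have hjk := Finset.mem_range.1 hj
        rw [← mul_assoc, ← pow_succ']
        exact mul_le_mul_of_nonneg_right (pow_le_pow_of_le_one hη0.le hη1 hjk) (hp j v)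
      have h3 := mul_le_mul_of_nonneg_left (htri k hkr v) (pow_nonneg hη0.le k)
      nlinarith [mul_le_mul_of_nonneg_left h2 hD]
    refine (Finset.sum_le_sum h1).trans ?_
    rw [Finset.sum_add_distrib, ← Finset.mul_sum, Finset.sum_const, Finset.card_range, nsmul_eq_mul]
    change α * q v + r * (D * η * q v) ≤ s * q v
    nlinarith [mul_le_mul_of_nonneg_right hηs (hq0 v)]
  have hpow : ∀ l v, q ((B ^ l) v) ≤ s ^ l * q v := by
    intro l
    induction l with
    | zero => simp
    | succ l ih =>
      intro v
      rw [pow_succ', Module.End.mul_apply, pow_succ', mul_assoc]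
      exact (hstep _).trans (mul_le_mul_of_nonneg_left (ih v) hs0.le)
  have hup : ∀ v, q v ≤ a⁻¹ * N v := by
    intro v
    rw [le_inv_mul_iff₀ ha]
    refine le_trans (mul_le_mul_of_nonneg_left (Finset.sum_le_sum fun k _ ↦ ?_) ha.le) (hN v).1
    exact mul_le_of_le_one_left (hp k v) (pow_le_one₀ hη0.le hη1)
  have hlow : ∀ v, N v ≤ b * (η⁻¹ ^ r * q v) := by
    intro v
    refine (hN v).2.trans (mul_le_mul_of_nonneg_left ?_ hb.le)
    rw [hq, Finset.mul_sum]
    refine Finset.sum_le_sum fun k hk ↦ ?_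
    rw [← mul_assoc]
    refine le_mul_of_one_le_left (hp k v) ?_
    rw [inv_pow, inv_mul_eq_div, one_le_div (by positivity)]
    exact pow_le_pow_of_le_one hη0.le hη1 (Finset.mem_range.1 hk).le
  refine ⟨b * η⁻¹ ^ r * a⁻¹, by positivity, fun l v ↦ (hlow _).trans ?_⟩
  calc b * (η⁻¹ ^ r * q ((B ^ l) v)) ≤ b * (η⁻¹ ^ r * (s ^ l * (a⁻¹ * N v))) := by
        gcongr
        exact (hpow l v).trans (mul_le_mul_of_nonneg_left (hup v) (by positivity))
    _ = _ := by ring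

/-- The spectral radius of an operator, one power of which is block triangular. -/
lemma specRadius_pow_le_of_triangular
    (hlim : Tendsto (radiusSeq N A) atTop (𝓝 (specRadius N A))) {n : ℕ} (hn : 0 < n)
    {r : ℕ} {p : ℕ → V → ℝ} (hp : ∀ j v, 0 ≤ p j v) {a b : ℝ}
    (ha : 0 < a) (hb : 0 < b) (hN : ∀ v, a * ∑ j ∈ Finset.range r, p j v ≤ N v ∧
      N v ≤ b * ∑ j ∈ Finset.range r, p j v) {α D : ℝ} (hα : 0 ≤ α) (hD : 0 ≤ D)
    (htri : ∀ k < r, ∀ v, p k ((A ^ n) v) ≤ α * p k v + D * ∑ j ∈ Finset.range k, p j v) :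
    specRadius N A ^ n ≤ α := by
  refine le_of_forall_gt_imp_ge_of_dense fun s hs ↦ ?_
  have hs0 : 0 < s := hα.trans_lt hs
  obtain ⟨C, hC, hCl⟩ := exists_pow_le_of_triangular hp ha hb hN hα hD htri hs
  refine specRadius_pow_le hlim hn hC hs0.le fun l ↦ opNorm_le (by positivity) fun v ↦ ?_
  rw [pow_mul]
  exact hCl l v

end SpectralRadius

/-! ### The Riemannian volume -/

section Volume

open MeasureTheory

section Cells

variable {d : ℕ} {M : Type*} [TopologicalSpace M]
  {m : ℕ} {e : Fin m → OpenPartialHomeomorph M (EuclideanSpace ℝ (Fin d))}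

/-- The part of the `i`-th chart domain that is mapped to the open unit ball. -/
def chartBall (e : Fin m → OpenPartialHomeomorph M (EuclideanSpace ℝ (Fin d))) (i : Fin m) :
    Set M :=
  (e i).source ∩ e i ⁻¹' Metric.ball 0 1

/-- The chart balls made disjoint: these cells form a partition of `M`. -/
def chartCell (e : Fin m → OpenPartialHomeomorph M (EuclideanSpace ℝ (Fin d))) (i : Fin m) :
    Set M :=
  chartBall e i \ ⋃ j : {j // j < i}, chartBall e j

/-- The image of the `i`-th cell in the `i`-th chart. -/
def cellDomain (e : Fin m → OpenPartialHomeomorph M (EuclideanSpace ℝ (Fin d))) (i : Fin m) :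
    Set (EuclideanSpace ℝ (Fin d)) :=
  Metric.ball 0 1 ∩ (e i).symm ⁻¹' chartCell e i

lemma isOpen_chartBall (i : Fin m) : IsOpen (chartBall e i) :=
  (e i).isOpen_inter_preimage Metric.isOpen_ball

lemma measurableSet_inter_preimage_chartCell {f : EuclideanSpace ℝ (Fin d) → M}
    {s : Set (EuclideanSpace ℝ (Fin d))} (hs : IsOpen s) (hf : ContinuousOn f s) (i : Fin m) :
    MeasurableSet (s ∩ f ⁻¹' chartCell e i) := by
  have h1 : s ∩ f ⁻¹' chartCell e i = (s ∩ f ⁻¹' chartBall e i) \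
      (s ∩ f ⁻¹' ⋃ j : {j // j < i}, chartBall e j) := by
    ext p
    simp only [chartCell, Set.mem_inter_iff, Set.mem_preimage, Set.mem_sdiff]
    tauto
  rw [h1]
  exact (hf.isOpen_inter_preimage hs (isOpen_chartBall i)).measurableSet.diff
    (hf.isOpen_inter_preimage hs (isOpen_iUnion fun j ↦ isOpen_chartBall _)).measurableSet

lemma eq_of_mem_chartCell {i j : Fin m} {x : M} (hi : x ∈ chartCell e i) (hj : x ∈ chartCell e j) :
    i = j := by
  rcases lt_trichotomy i j with h | h | h
  · exact absurd (Set.mem_iUnion.2 ⟨⟨i, h⟩, hi.1⟩) hj.2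
  · exact h
  · exact absurd (Set.mem_iUnion.2 ⟨⟨j, h⟩, hj.1⟩) hi.2

lemma setLIntegral_eq_sum_of_eq_zero {α ι : Type*} [MeasurableSpace α] {μ : Measure α} [Fintype ι]
    {D : Set α} (hD : MeasurableSet D) {s : ι → Set α} (hs : ∀ i, MeasurableSet (s i))
    (hsD : ∀ i, s i ⊆ D) (hdisj : Pairwise (Function.onFun Disjoint s)) {g : α → ENNReal}
    (hg : ∀ p ∈ D, (∀ i, p ∉ s i) → g p = 0) :
    ∫⁻ p in D, g p ∂μ = ∑ i, ∫⁻ p in s i, g p ∂μ := by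
  have hU : MeasurableSet (⋃ i, s i) := MeasurableSet.iUnion hs
  have h1 : ∫⁻ p in D \ ⋃ i, s i, g p ∂μ = 0 := by
    rw [setLIntegral_congr_fun (g := fun _ ↦ 0) (hD.diff hU) fun p hp ↦
      hg p hp.1 fun i hi ↦ hp.2 (Set.mem_iUnion.2 ⟨i, hi⟩)]
    simp
  rw [← lintegral_inter_add_sdiff g D hU, h1, add_zero,
    Set.inter_eq_right.2 (Set.iUnion_subset hsD), lintegral_iUnion hs hdisj, tsum_fintype]

lemma mem_cellDomain {i : Fin m} {x : M} (hx : x ∈ chartCell e i) :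
    e i x ∈ cellDomain e i ∧ (e i).symm (e i x) = x := by
  have h1 := (e i).left_inv hx.1.1
  exact ⟨⟨hx.1.2, by rwa [Set.mem_preimage, h1]⟩, h1⟩

namespace IsNormAtlas

variable [ChartedSpace (EuclideanSpace ℝ (Fin d)) M] (he : IsNormAtlas e)

include he

lemma continuousOn_symm (i : Fin m) :
    ContinuousOn (e i).symm (Metric.ball (0 : EuclideanSpace ℝ (Fin d)) 1) :=
  (e i).continuousOn_symm.mono fun _ hp ↦ he.mem_target (Metric.ball_subset_closedBall hp)

lemma exists_mem_chartCell (x : M) : ∃ i, x ∈ chartCell e i := by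
  classical
  have hne : (Finset.univ.filter fun i ↦ x ∈ chartBall e i).Nonempty := by
    obtain ⟨i, hi⟩ := he.cover x
    exact ⟨i, by simpa [chartBall] using hi⟩
  obtain ⟨i, hi, hmin⟩ := Finset.exists_min_image _ id hne
  refine ⟨i, (Finset.mem_filter.1 hi).2, fun h ↦ ?_⟩
  obtain ⟨⟨j, hj⟩, hx⟩ := Set.mem_iUnion.1 h
  exact absurd (hmin j (by simpa using hx)) (not_le.2 hj)

lemma measurableSet_cellDomain (i : Fin m) : MeasurableSet (cellDomain e i) :=
  measurableSet_inter_preimage_chartCell Metric.isOpen_ball (he.continuousOn_symm i) i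

end IsNormAtlas

end Cells

variable {d : ℕ} {M : Type*} [TopologicalSpace M] [ChartedSpace (EuclideanSpace ℝ (Fin d)) M]
  [RiemannianBundle (fun x : M ↦ TangentSpace (𝓡 d) x)]
  {m : ℕ} {e : Fin m → OpenPartialHomeomorph M (EuclideanSpace ℝ (Fin d))}

/-- The integral of the positive part of `f` against the Riemannian volume, computed cell by cell
in the charts. -/
def volumeIntegral (e : Fin m → OpenPartialHomeomorph M (EuclideanSpace ℝ (Fin d))) (f : M → ℝ) :
    ENNReal :=
  ∑ i, ∫⁻ p in cellDomain e i, ENNReal.ofReal (f ((e i).symm p) * density (e i).symm p)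

lemma volumeIntegral_mono {f g : M → ℝ} (h : ∀ x, f x ≤ g x) :
    volumeIntegral e f ≤ volumeIntegral e g :=
  Finset.sum_le_sum fun _ _ ↦ lintegral_mono fun _ ↦
    ENNReal.ofReal_le_ofReal (mul_le_mul_of_nonneg_right (h _) (density_nonneg _ _))

lemma volumeIntegral_const_mul {c : ℝ} (hc : 0 ≤ c) (f : M → ℝ) :
    volumeIntegral e (fun x ↦ c * f x) = ENNReal.ofReal c * volumeIntegral e f := by
  simp only [volumeIntegral, Finset.mul_sum]
  refine Finset.sum_congr rfl fun i _ ↦ ?_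
  rw [← lintegral_const_mul' _ _ ENNReal.ofReal_ne_top]
  simp only [mul_assoc, ENNReal.ofReal_mul hc]

namespace IsNormAtlas

variable [IsManifold (𝓡 d) ∞ M] (he : IsNormAtlas e)

include he

variable [T2Space M] [CompactSpace M] in
/-- Change of variables for a function supported in a set on which the map is injective. -/
lemma volumeIntegral_wtransfer_of_injOn {r : ℕ} {φ : M → M} (h : IsRegularMap d r φ) {U : Set M}
    (hU : IsOpen U) (hinj : Set.InjOn φ U) {f : M → ℝ} (hf : ∀ x ∉ U, f x = 0) :
    volumeIntegral e (wtransfer φ (fun x ↦ (jacobian (d := d) φ x)⁻¹) f) = volumeIntegral e f := by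
  set w : M → ℝ := fun x ↦ (jacobian (d := d) φ x)⁻¹
  -- the points of `U` in the cell `i` whose image is in the cell `j`, read in the chart `i`
  set s : Fin m → Fin m → Set (EuclideanSpace ℝ (Fin d)) := fun i j ↦
    cellDomain e i ∩ (Metric.ball 0 1 ∩ (e i).symm ⁻¹' U) ∩
      (Metric.ball 0 1 ∩ (φ ∘ (e i).symm) ⁻¹' chartCell e j) with hs
  set F : Fin m → Fin m → EuclideanSpace ℝ (Fin d) → EuclideanSpace ℝ (Fin d) := fun i j ↦
    e j ∘ (φ ∘ (e i).symm) with hF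
  have hmem : ∀ {i j p}, p ∈ s i j ↔ p ∈ cellDomain e i ∧ (e i).symm p ∈ U ∧
      φ ((e i).symm p) ∈ chartCell e j := by
    intro i j p
    simp only [hs, Set.mem_inter_iff, Set.mem_preimage, Function.comp_apply, cellDomain]
    tauto
  have htar : ∀ {i p}, p ∈ cellDomain e i → p ∈ (e i).target := fun hp ↦
    he.mem_target (Metric.ball_subset_closedBall hp.1)
  have hsm : ∀ i j, MeasurableSet (s i j) := fun i j ↦
    ((he.measurableSet_cellDomain i).inter ((he.continuousOn_symm i).isOpen_inter_preimage
      Metric.isOpen_ball hU).measurableSet).inter (measurableSet_inter_preimage_chartCell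
        Metric.isOpen_ball (h.contMDiff.continuous.comp_continuousOn (he.continuousOn_symm i)) j)
  have hsymmF : ∀ {i j p}, p ∈ s i j → (e j).symm (F i j p) = φ ((e i).symm p) := fun hp ↦
    (e _).left_inv (hmem.1 hp).2.2.1.1
  have hFdiff : ∀ {i j p}, p ∈ s i j → DifferentiableAt ℝ (F i j) p := by
    intro i j p hp
    have h1 : MDifferentiableAt (𝓡 d) (𝓡 d) (φ ∘ (e i).symm) p :=
      (h.mdifferentiable _).comp p ((mdifferentiable_of_mem_maximalAtlas
        (he.smooth i)).symm.mdifferentiableAt (htar (hmem.1 hp).1))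
    have h2 : MDifferentiableAt (𝓡 d) (𝓡 d) (e j) ((φ ∘ (e i).symm) p) :=
      (mdifferentiable_of_mem_maximalAtlas (he.smooth j)).mdifferentiableAt
        (hmem.1 hp).2.2.1.1
    exact (h2.comp p h1).differentiableAt
  have hFinj : ∀ i j, Set.InjOn (F i j) (s i j) := by
    intro i j p hp q hq hpq
    have h1 : φ ((e i).symm p) = φ ((e i).symm q) := by
      rw [← hsymmF hp, ← hsymmF hq, hpq]
    exact (e i).symm.injOn (htar (hmem.1 hp).1) (htar (hmem.1 hq).1)
      (hinj (hmem.1 hp).2.1 (hmem.1 hq).2.1 h1)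
  have hFder : ∀ i j, ∀ p ∈ s i j, HasFDerivWithinAt (F i j) (fderiv ℝ (F i j) p) (s i j) p :=
    fun i j p hp ↦ (hFdiff hp).hasFDerivAt.hasFDerivWithinAt
  -- by injectivity, at most one point of each fibre contributes to the sum
  have hval : ∀ x ∈ U, wtransfer φ w f (φ x) = w x * f x := by
    intro x hx
    rw [h.wtransfer_apply]
    refine Finset.sum_eq_single_of_mem x (by simp) fun z hz hzx ↦ ?_
    have hzU : z ∉ U := fun hzU ↦ hzx (hinj hzU hx ((h.mem_fiber).1 hz))
    rw [hf z hzU, mul_zero]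
  have hloc : ∀ i j,
      ∫⁻ q in F i j '' s i j,
        ENNReal.ofReal (wtransfer φ w f ((e j).symm q) * density (e j).symm q)
      = ∫⁻ p in s i j, ENNReal.ofReal (f ((e i).symm p) * density (e i).symm p) := by
    intro i j
    rw [lintegral_image_eq_lintegral_abs_det_fderiv_mul _ (hsm i j) (hFder i j) (hFinj i j)]
    refine setLIntegral_congr_fun (hsm i j) fun p hp ↦ ?_
    have hp' := hmem.1 hp
    -- both sides are the density of `φ ∘ (e i).symm`, which is `(e j).symm ∘ F i j` near `p`
    have hdens : density (e j).symm (F i j p) * |(fderiv ℝ (F i j) p).det|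
        = jacobian (d := d) φ ((e i).symm p) * density (e i).symm p := by
      have h1 : MDifferentiableAt (𝓡 d) (𝓡 d) (e i).symm p :=
        (mdifferentiable_of_mem_maximalAtlas (he.smooth i)).symm.mdifferentiableAt (htar hp'.1)
      rw [← density_comp _ (hFdiff hp), ← density_map_comp (h.mdifferentiable _) h1]
      · refine density_congr ?_
        have h2 : ContinuousAt (φ ∘ (e i).symm) p :=
          h.contMDiff.continuous.continuousAt.comp ((e i).symm.continuousAt (htar hp'.1))
        filter_upwards [h2.preimage_mem_nhds ((e j).open_source.mem_nhds hp'.2.2.1.1)] with q hq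
        exact (e j).left_inv hq
      · exact (mdifferentiable_of_mem_maximalAtlas (he.smooth j)).symm.mdifferentiableAt
          ((e j).map_source hp'.2.2.1.1)
    beta_reduce
    rw [← ENNReal.ofReal_mul (abs_nonneg _), hsymmF hp, hval _ hp'.2.1]
    congr 1
    have hJ := RuelleTransfer.jacobian_pos (h.bijective ((e i).symm p))
    calc _ = w ((e i).symm p) * f ((e i).symm p) *
          (density (e j).symm (F i j p) * |(fderiv ℝ (F i j) p).det|) := by ring
      _ = _ := by
        rw [hdens]
        simp only [w]
        field_simp
  have hleft : ∀ j, ∫⁻ q in cellDomain e j,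
        ENNReal.ofReal (wtransfer φ w f ((e j).symm q) * density (e j).symm q)
      = ∑ i, ∫⁻ q in F i j '' s i j,
        ENNReal.ofReal (wtransfer φ w f ((e j).symm q) * density (e j).symm q) := by
    intro j
    refine setLIntegral_eq_sum_of_eq_zero (he.measurableSet_cellDomain j)
      (fun i ↦ measurable_image_of_fderivWithin (hsm i j) (hFder i j) (hFinj i j)) ?_ ?_ ?_
    · rintro i _ ⟨p, hp, rfl⟩
      exact (mem_cellDomain (hmem.1 hp).2.2).1
    · intro i i' hii'
      refine Set.disjoint_left.2 ?_
      rintro _ ⟨p, hp, rfl⟩ ⟨p', hp', heq⟩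
      have h1 : φ ((e i').symm p') = φ ((e i).symm p) := by
        rw [← hsymmF hp, ← hsymmF hp', heq]
      have h2 := hinj (hmem.1 hp').2.1 (hmem.1 hp).2.1 h1
      exact hii' (eq_of_mem_chartCell (hmem.1 hp).1.2 (h2 ▸ (hmem.1 hp').1.2))
    · intro q hq hqs
      have h0 : wtransfer φ w f ((e j).symm q) = 0 := by
        rw [h.wtransfer_apply]
        refine Finset.sum_eq_zero fun x hx ↦ ?_
        by_cases hxU : x ∈ U
        · exfalso
          have hx' : φ x = (e j).symm q := (h.mem_fiber).1 hx
          obtain ⟨i, hi⟩ := he.exists_mem_chartCell x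
          obtain ⟨h1, h2⟩ := mem_cellDomain hi
          refine hqs i ⟨e i x, hmem.2 ⟨h1, by rwa [h2], by rw [h2, hx']; exact hq.2⟩, ?_⟩
          simp only [hF, Function.comp_apply, h2, hx']
          exact (e j).right_inv (htar hq)
        · rw [hf x hxU, mul_zero]
      rw [h0, zero_mul, ENNReal.ofReal_zero]
  have hright : ∀ i, ∫⁻ p in cellDomain e i,
        ENNReal.ofReal (f ((e i).symm p) * density (e i).symm p)
      = ∑ j, ∫⁻ p in s i j, ENNReal.ofReal (f ((e i).symm p) * density (e i).symm p) := by
    intro i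
    refine setLIntegral_eq_sum_of_eq_zero (he.measurableSet_cellDomain i) (hsm i)
      (fun j p hp ↦ (hmem.1 hp).1) ?_ ?_
    · intro j j' hjj'
      exact Set.disjoint_left.2 fun p hp hp' ↦
        hjj' (eq_of_mem_chartCell (hmem.1 hp).2.2 (hmem.1 hp').2.2)
    · intro p hp hps
      rw [hf, zero_mul, ENNReal.ofReal_zero]
      intro hpU
      obtain ⟨j, hj⟩ := he.exists_mem_chartCell (φ ((e i).symm p))
      exact hps j (hmem.2 ⟨hp, hpU, hj⟩)
  simp only [volumeIntegral, hleft, hright, hloc]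
  exact Finset.sum_comm

variable [IsContMDiffRiemannianBundle (𝓡 d) ∞ (EuclideanSpace ℝ (Fin d))
    (fun x : M ↦ TangentSpace (𝓡 d) x)]

lemma continuousOn_density (i : Fin m) :
    ContinuousOn (density (e i).symm) (Metric.closedBall 0 1) :=
  (contDiffOn_density (m := 0) (n := 1) (e i).open_target
    ((contMDiffOn_symm_of_mem_maximalAtlas (he.smooth i)).of_le (natCast_le_infty 1)) le_rfl
    fun _ hp ↦ bijective_mfderiv_symm (he.smooth i) hp).continuousOn.mono fun _ hp ↦
      he.mem_target hp

lemma volumeIntegral_sum {ι : Type*} [Fintype ι] {f : ι → M → ℝ} (hf : ∀ k, Continuous (f k))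
    (hf0 : ∀ k x, 0 ≤ f k x) :
    volumeIntegral e (fun x ↦ ∑ k, f k x) = ∑ k, volumeIntegral e (f k) := by
  simp only [volumeIntegral]
  rw [Finset.sum_comm]
  refine Finset.sum_congr rfl fun i _ ↦ ?_
  rw [← lintegral_finsetSum' (μ := volume.restrict (cellDomain e i))]
  · refine lintegral_congr fun p ↦ ?_
    rw [Finset.sum_mul, ENNReal.ofReal_sum_of_nonneg fun k _ ↦
      mul_nonneg (hf0 k _) (density_nonneg _ _)]
  · intro k _
    have h1 : ContinuousOn (fun p ↦ f k ((e i).symm p) * density (e i).symm p)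
        (Metric.ball 0 1) :=
      ((hf k).comp_continuousOn (he.continuousOn_symm i)).mul
        ((he.continuousOn_density i).mono Metric.ball_subset_closedBall)
    exact ((h1.aemeasurable Metric.isOpen_ball.measurableSet).mono_measure
      (Measure.restrict_mono Set.inter_subset_left le_rfl)).ennreal_ofReal

lemma volumeIntegral_one_ne_top : volumeIntegral e (fun _ ↦ 1) ≠ ⊤ := by
  refine (ENNReal.sum_lt_top.2 fun i _ ↦ ?_).ne
  obtain ⟨C, hC⟩ := (isCompact_closedBall _ _).exists_bound_of_continuousOn
    (he.continuousOn_density i)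
  calc ∫⁻ p in cellDomain e i, ENNReal.ofReal (1 * density (e i).symm p)
      ≤ ∫⁻ _ in cellDomain e i, ENNReal.ofReal C := by
        refine setLIntegral_mono' (he.measurableSet_cellDomain i) fun p hp ↦
          ENNReal.ofReal_le_ofReal ?_
        rw [one_mul]
        exact (le_abs_self _).trans (hC p (Metric.ball_subset_closedBall hp.1))
    _ = ENNReal.ofReal C * volume (cellDomain e i) := setLIntegral_const _ _
    _ < ⊤ := ENNReal.mul_lt_top ENNReal.ofReal_lt_top
        ((measure_mono Set.inter_subset_left).trans_lt measure_ball_lt_top)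

open Classical in
/-- Otherwise the `i`-th chart ball would be covered by finitely many null sets, hence so would
the unit ball. -/
lemma volumeIntegral_chartBall_ne_zero (i : Fin m) :
    volumeIntegral e ((chartBall e i).indicator fun _ ↦ 1) ≠ 0 := by
  intro h0
  have h1 : ∀ j, volume (cellDomain e j ∩ (Metric.ball 0 1 ∩ (e j).symm ⁻¹' chartBall e i)) = 0 := by
    intro j
    have h2 := (Finset.sum_eq_zero_iff.1 h0) j (Finset.mem_univ j)
    have hopen := (he.continuousOn_symm j).isOpen_inter_preimage Metric.isOpen_ball
      (isOpen_chartBall (e := e) i)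
    have hms := (he.measurableSet_cellDomain j).inter hopen.measurableSet
    have h3 : ∫⁻ p in cellDomain e j ∩ (Metric.ball 0 1 ∩ (e j).symm ⁻¹' chartBall e i),
        ENNReal.ofReal (density (e j).symm p) = 0 := by
      rw [← nonpos_iff_eq_zero, ← h2]
      refine le_trans (le_of_eq (setLIntegral_congr_fun hms fun p hp ↦ ?_))
        (lintegral_mono_set (Set.inter_subset_left (t := Metric.ball 0 1 ∩
          (e j).symm ⁻¹' chartBall e i)))
      rw [Set.indicator_of_mem (s := chartBall e i) (a := (e j).symm p) hp.2.2, one_mul]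
    have hmeas : AEMeasurable (fun p ↦ ENNReal.ofReal (density (e j).symm p))
        (volume.restrict (cellDomain e j ∩ (Metric.ball 0 1 ∩ (e j).symm ⁻¹' chartBall e i))) :=
      (((he.continuousOn_density j).aemeasurable
        Metric.isClosed_closedBall.measurableSet).mono_measure (Measure.restrict_mono
          (fun p hp ↦ Metric.ball_subset_closedBall hp.1.1) le_rfl)).ennreal_ofReal
    rw [lintegral_eq_zero_iff' hmeas, Filter.EventuallyEq, ae_restrict_iff' hms] at h3
    refine measure_mono_null (fun p hp ↦ ?_) h3
    simp only [Set.mem_compl_iff, Set.mem_ofPred_eq, not_forall]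
    refine ⟨hp, ?_⟩
    have := density_pos (bijective_mfderiv_symm (he.smooth j)
      (he.mem_target (Metric.ball_subset_closedBall hp.1.1)))
    simpa using this
  have h2 : ∀ j, volume ((e i ∘ (e j).symm) ''
      (cellDomain e j ∩ (Metric.ball 0 1 ∩ (e j).symm ⁻¹' chartBall e i))) = 0 := by
    intro j
    refine addHaar_image_eq_zero_of_differentiableOn_of_addHaar_eq_zero _ (fun p hp ↦ ?_) (h1 j)
    have h3 : MDifferentiableAt (𝓡 d) (𝓡 d) (e j).symm p :=
      (mdifferentiable_of_mem_maximalAtlas (he.smooth j)).symm.mdifferentiableAt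
        (he.mem_target (Metric.ball_subset_closedBall hp.1.1))
    have h4 : MDifferentiableAt (𝓡 d) (𝓡 d) (e i) ((e j).symm p) :=
      (mdifferentiable_of_mem_maximalAtlas (he.smooth i)).mdifferentiableAt hp.2.2.1
    exact (h4.comp p h3).differentiableAt.differentiableWithinAt
  have h3 : volume (Metric.ball (0 : EuclideanSpace ℝ (Fin d)) 1) = 0 := by
    refine measure_mono_null (fun q hq ↦ ?_) (measure_iUnion_null h2)
    have hq' := he.mem_target (i := i) (Metric.ball_subset_closedBall hq)
    obtain ⟨j, hj⟩ := he.exists_mem_chartCell ((e i).symm q)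
    obtain ⟨h4, h5⟩ := mem_cellDomain hj
    refine Set.mem_iUnion.2 ⟨j, e j ((e i).symm q), ⟨h4, h4.1, ?_⟩, ?_⟩
    · rw [Set.mem_preimage, h5]
      exact ⟨(e i).map_target hq', by rwa [Set.mem_preimage, (e i).right_inv hq']⟩
    · rw [Function.comp_apply, h5, (e i).right_inv hq']
  exact (Metric.measure_ball_pos volume (0 : EuclideanSpace ℝ (Fin d)) one_pos).ne' h3

variable [T2Space M] [CompactSpace M]

/-- The transfer operator with weight `1/J` preserves the volume. -/
lemma volumeIntegral_wtransfer_one {r : ℕ} {φ : M → M} (h : IsRegularMap d r φ) :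
    volumeIntegral e (wtransfer φ (fun x ↦ (jacobian (d := d) φ x)⁻¹) fun _ ↦ 1)
      = volumeIntegral e fun _ ↦ 1 := by
  classical
  set w : M → ℝ := fun x ↦ (jacobian (d := d) φ x)⁻¹
  have hloc : ∀ x : M, ∃ U : Set M, IsOpen U ∧ x ∈ U ∧ Set.InjOn φ U := by
    intro x
    obtain ⟨Φ, hx, hΦ⟩ := h.isLocalHomeomorph x
    exact ⟨Φ.source, Φ.open_source, hx, hΦ ▸ Φ.injOn⟩
  choose U hUo hxU hUinj using hloc
  -- a partition of unity reduces the claim to functions with small support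
  obtain ⟨t, ht⟩ := isCompact_univ.elim_nhds_subcover U fun x _ ↦ (hUo x).mem_nhds (hxU x)
  obtain ⟨f, hf⟩ := SmoothPartitionOfUnity.exists_isSubordinate (𝓡 d) (s := Set.univ)
    isClosed_univ (fun x : t ↦ U x) (fun x ↦ hUo x) (by
      intro x hx
      obtain ⟨a, ha, hxa⟩ := Set.mem_iUnion₂.1 (ht.2 hx)
      exact Set.mem_iUnion.2 ⟨⟨a, ha⟩, hxa⟩)
  have hsum : (fun _ : M ↦ (1 : ℝ)) = fun x ↦ ∑ k, f k x := by
    ext x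
    rw [← f.sum_eq_one (Set.mem_univ x), finsum_eq_sum_of_fintype]
  have hw0 : ContMDiff (𝓡 d) 𝓘(ℝ, ℝ) ((0 : ℕ) : WithTop ℕ∞) w :=
    h.contMDiff_inv_jacobian.of_le (by exact_mod_cast Nat.zero_le _)
  have hcont : ∀ k, Continuous (wtransfer φ w (f k)) := fun k ↦
    (h.wtransfer_contMDiff (m := 0) (Nat.zero_le r) hw0
      ((f k).contMDiff.of_le (natCast_le_infty 0))).continuous
  have hTsum : wtransfer φ w (fun _ ↦ 1) = fun y ↦ ∑ k, wtransfer φ w (f k) y := by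
    ext y
    simp only [h.wtransfer_apply]
    rw [Finset.sum_comm]
    refine Finset.sum_congr rfl fun x _ ↦ ?_
    rw [← Finset.mul_sum, ← congrFun hsum x]
  rw [hTsum, he.volumeIntegral_sum hcont, hsum,
    he.volumeIntegral_sum (fun k ↦ (f k).contMDiff.continuous) fun k x ↦ f.nonneg k x]
  · refine Finset.sum_congr rfl fun k _ ↦ he.volumeIntegral_wtransfer_of_injOn h (hUo k)
      (hUinj k) fun x hx ↦ ?_
    by_contra h0
    exact hx (hf k (subset_tsupport _ h0))
  · intro k y
    rw [h.wtransfer_apply]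
    exact Finset.sum_nonneg fun x _ ↦
      mul_nonneg (inv_nonneg.2 (h.jacobian_pos x).le) (f.nonneg k x)

/-- The transferred volume density has mean `1`, hence its supremum is at least `1`. -/
lemma one_le_of_wtransfer_one_le [Nonempty M] {r : ℕ} {φ : M → M} (h : IsRegularMap d r φ) {s : ℝ}
    (hs : ∀ y, wtransfer φ (fun x ↦ (jacobian (d := d) φ x)⁻¹) (fun _ ↦ 1) y ≤ s) : 1 ≤ s := by
  have hs0 : 0 ≤ s := by
    refine le_trans ?_ (hs (Classical.arbitrary M))
    rw [h.wtransfer_apply]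
    exact Finset.sum_nonneg fun x _ ↦
      mul_nonneg (inv_nonneg.2 (h.jacobian_pos x).le) zero_le_one
  obtain ⟨i, -⟩ := he.cover (Classical.arbitrary M)
  have hpos : volumeIntegral e (fun _ : M ↦ 1) ≠ 0 := fun h0 ↦
    he.volumeIntegral_chartBall_ne_zero i (le_zero_iff.1 (h0 ▸ volumeIntegral_mono fun x ↦
      Set.indicator_le_self' (fun _ _ ↦ zero_le_one) x))
  have h1 := volumeIntegral_mono (e := e) (g := fun _ ↦ s * 1) fun y ↦ (hs y).trans_eq
    (mul_one s).symm
  rw [he.volumeIntegral_wtransfer_one h, volumeIntegral_const_mul hs0] at h1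
  by_contra! hlt
  refine absurd h1 (not_le.2 ?_)
  calc ENNReal.ofReal s * volumeIntegral e (fun _ : M ↦ 1)
      < 1 * volumeIntegral e (fun _ : M ↦ 1) :=
        ENNReal.mul_lt_mul_left hpos he.volumeIntegral_one_ne_top (by simpa using hlt)
    _ = _ := one_mul _

/-- A function that is at most `Λ` times the transferred volume density is not uniformly large
on a chart ball, since that ball has a definite share of the volume. -/
lemma exists_le_mul_of_le_wtransfer : ∃ κ : ℝ, 0 < κ ∧ ∀ {r : ℕ} {φ : M → M},
    IsRegularMap d r φ → ∀ {c Λ : ℝ} (i : Fin m), 0 ≤ Λ →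
    (∀ x ∈ chartBall e i,
      c ≤ Λ * wtransfer φ (fun x ↦ (jacobian (d := d) φ x)⁻¹) (fun _ ↦ 1) x) → c ≤ κ * Λ := by
  classical
  set a := (volumeIntegral e (fun _ : M ↦ 1)).toReal
  set b := fun i ↦ (volumeIntegral e ((chartBall e i).indicator fun _ ↦ 1)).toReal
  have hle : ∀ i, volumeIntegral e ((chartBall e i).indicator fun _ ↦ 1)
      ≤ volumeIntegral e fun _ ↦ 1 := fun i ↦ volumeIntegral_mono fun x ↦
    Set.indicator_le_self' (fun _ _ ↦ zero_le_one) x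
  have hbtop : ∀ i, volumeIntegral e ((chartBall e i).indicator fun _ ↦ 1) ≠ ⊤ := fun i ↦
    ne_top_of_le_ne_top he.volumeIntegral_one_ne_top (hle i)
  have hb : ∀ i, 0 < b i := fun i ↦
    ENNReal.toReal_pos (he.volumeIntegral_chartBall_ne_zero i) (hbtop i)
  have ha : 0 ≤ a := ENNReal.toReal_nonneg
  refine ⟨∑ i, a / b i + 1, add_pos_of_nonneg_of_pos
    (Finset.sum_nonneg fun i _ ↦ div_nonneg ha (hb i).le) one_pos, ?_⟩
  intro r φ h c Λ i hΛ hc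
  have hsum : a / b i ≤ ∑ i, a / b i + 1 :=
    (Finset.single_le_sum (f := fun i ↦ a / b i) (fun i _ ↦ div_nonneg ha (hb i).le)
      (Finset.mem_univ i)).trans (le_add_of_nonneg_right zero_le_one)
  rcases le_or_gt c 0 with hc0 | hc0
  · exact hc0.trans (mul_nonneg ((div_nonneg ha (hb i).le).trans hsum) hΛ)
  have h1 : volumeIntegral e (fun x ↦ c * (chartBall e i).indicator (fun _ ↦ 1) x)
      ≤ volumeIntegral e fun x ↦
        Λ * wtransfer φ (fun x ↦ (jacobian (d := d) φ x)⁻¹) (fun _ ↦ 1) x := by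
    refine volumeIntegral_mono fun x ↦ ?_
    by_cases hx : x ∈ chartBall e i
    · rw [Set.indicator_of_mem hx, mul_one]
      exact hc x hx
    · rw [Set.indicator_of_notMem hx, mul_zero, h.wtransfer_apply]
      exact mul_nonneg hΛ (Finset.sum_nonneg fun x _ ↦
        mul_nonneg (inv_nonneg.2 (h.jacobian_pos x).le) zero_le_one)
  rw [volumeIntegral_const_mul hc0.le, volumeIntegral_const_mul hΛ,
    he.volumeIntegral_wtransfer_one h] at h1
  have h2 := ENNReal.toReal_mono
    (ENNReal.mul_ne_top ENNReal.ofReal_ne_top he.volumeIntegral_one_ne_top) h1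
  rw [ENNReal.toReal_mul, ENNReal.toReal_mul, ENNReal.toReal_ofReal hc0.le,
    ENNReal.toReal_ofReal hΛ] at h2
  refine le_trans ?_ (mul_le_mul_of_nonneg_right hsum hΛ)
  rw [div_mul_eq_mul_div, le_div_iff₀ (hb i), mul_comm a]
  exact h2

end IsNormAtlas

end Volume

/-! ### Existence of the expansion rates -/

section Rates

/-- Fekete's lemma for a superadditive sequence of at most linear growth. -/
lemma exists_tendsto_of_superadditive {v : ℕ → ℝ} (hv : ∀ m n, v m + v n ≤ v (m + n)) {B : ℝ}
    (hB : ∀ n : ℕ, v n ≤ n * B) : ∃ l, Tendsto (fun n : ℕ ↦ 1 / (n : ℝ) * v n) atTop (𝓝 l) := by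
  have hsub : Subadditive fun n ↦ -v n := fun m n ↦ by linarith [hv m n]
  have hbdd : BddBelow (Set.range fun n : ℕ ↦ -v n / n) := by
    refine ⟨min 0 (-B), ?_⟩
    rintro _ ⟨n, rfl⟩
    rcases n.eq_zero_or_pos with rfl | hn
    · simp
    · have hn' : (0 : ℝ) < n := by exact_mod_cast hn
      refine (min_le_right _ _).trans ?_
      rw [le_div_iff₀ hn']
      linarith [hB n, mul_comm B (n : ℝ)]
  refine ⟨-hsub.lim, (hsub.tendsto_lim hbdd).neg.congr fun n ↦ ?_⟩
  ring

variable {d : ℕ} {M : Type*} [TopologicalSpace M] [ChartedSpace (EuclideanSpace ℝ (Fin d)) M]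
  [IsManifold (𝓡 d) ∞ M]
  [RiemannianBundle (fun x : M ↦ TangentSpace (𝓡 d) x)]
  [IsContMDiffRiemannianBundle (𝓡 d) ∞ (EuclideanSpace ℝ (Fin d))
    (fun x : M ↦ TangentSpace (𝓡 d) x)]
  {m : ℕ} {e : Fin m → OpenPartialHomeomorph M (EuclideanSpace ℝ (Fin d))}

lemma IsRegularMap.exists_jacobian_bounds [CompactSpace M] [Nonempty M] {r : ℕ} {φ : M → M}
    (h : IsRegularMap d r φ) :
    ∃ a b : ℝ, 0 < a ∧ 0 < b ∧ ∀ x, a ≤ jacobian (d := d) φ x ∧ jacobian (d := d) φ x ≤ b := by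
  have hc : Continuous (jacobian (d := d) φ) :=
    (contMDiff_jacobian h.one_le h.contMDiff h.bijective).continuous
  obtain ⟨x₀, -, hx₀⟩ := isCompact_univ.exists_isMinOn Set.univ_nonempty hc.continuousOn
  obtain ⟨x₁, -, hx₁⟩ := isCompact_univ.exists_isMaxOn Set.univ_nonempty hc.continuousOn
  exact ⟨_, _, h.jacobian_pos x₀, h.jacobian_pos x₁, fun x ↦ ⟨hx₀ (Set.mem_univ x),
    hx₁ (Set.mem_univ x)⟩⟩

namespace IsNormAtlas

variable [Nonempty M] (he : IsNormAtlas e) (hd : 1 ≤ d) {r : ℕ} {φ : M → M}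
  (h : IsRegularMap d r φ)

include he hd h

lemma iInf_expansionConst_pos : 0 < ⨅ x, expansionConst (d := d) φ x := by
  obtain ⟨a, b, ha, hb, hab⟩ := he.exists_expansionConst_bounds hd h
  exact ha.trans_le (le_ciInf fun x ↦ (hab x).1)

omit [Nonempty M] in
lemma log_expansionConst_iterate_le : ∃ B : ℝ, ∀ (n : ℕ) (x : M),
    Real.log (expansionConst (d := d) φ^[n] x) ≤ n * B := by
  obtain ⟨a, b, ha, hb, hab⟩ := he.exists_norm_mfderiv_self_bounds h
  refine ⟨Real.log b, fun n x ↦ ?_⟩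
  rw [← Real.log_pow]
  refine Real.log_le_log (he.expansionConst_pos hd (h.iterate n) x) (expansionConst_le hd ?_)
  induction n generalizing x with
  | zero =>
    intro v
    rw [Function.iterate_zero, mfderiv_id, pow_zero, one_mul]
    exact le_rfl
  | succ n ih =>
    intro v
    rw [Function.iterate_succ, mfderiv_comp x ((h.iterate n).mdifferentiable _)
      (h.mdifferentiable _)]
    refine (ih (φ x) _).trans ?_
    rw [pow_succ, mul_assoc]
    exact mul_le_mul_of_nonneg_left (hab x v).2 (pow_nonneg hb.le n)

lemma tendsto_expansionSeq : Tendsto (expansionSeq (d := d) φ) atTop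
    (𝓝 (expansionRate (d := d) φ)) := by
  have hb : ∀ n, BddBelow (Set.range (expansionConst (d := d) φ^[n])) := fun n ↦
    ⟨0, by rintro _ ⟨x, rfl⟩; exact expansionConst_nonneg _ _⟩
  obtain ⟨B, hB⟩ := he.log_expansionConst_iterate_le hd h
  refine tendsto_nhds_limUnder (exists_tendsto_of_superadditive (B := B) (fun p q ↦ ?_) fun n ↦ ?_)
  · have hp := he.iInf_expansionConst_pos hd (h.iterate p)
    have hq := he.iInf_expansionConst_pos hd (h.iterate q)
    rw [← Real.log_mul hp.ne' hq.ne']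
    refine Real.log_le_log (mul_pos hp hq) (le_ciInf fun x ↦ ?_)
    rw [Function.iterate_add]
    exact (mul_le_mul (ciInf_le (hb p) _) (ciInf_le (hb q) x) hq.le
      (expansionConst_nonneg _ _)).trans (mul_expansionConst_le hd
        ((h.iterate p).mdifferentiable _) ((h.iterate q).mdifferentiable _))
  · exact (Real.log_le_log (he.iInf_expansionConst_pos hd (h.iterate n))
      (ciInf_le (hb n) (Classical.arbitrary M))).trans (hB n _)

variable [CompactSpace M]

omit he hd in
lemma _root_.RuelleTransfer.IsRegularMap.log_jacobian_iterate_le : ∃ B : ℝ, ∀ (n : ℕ) (x : M),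
    Real.log (jacobian (d := d) φ^[n] x) ≤ n * B := by
  obtain ⟨a, b, ha, hb, hab⟩ := h.exists_jacobian_bounds
  refine ⟨Real.log b, fun n x ↦ ?_⟩
  rw [← Real.log_pow]
  refine Real.log_le_log ((h.iterate n).jacobian_pos x) ?_
  induction n generalizing x with
  | zero => rw [Function.iterate_zero, jacobian_id, pow_zero]
  | succ n ih =>
    rw [Function.iterate_succ, jacobian_comp ((h.iterate n).mdifferentiable _)
      (h.mdifferentiable _), pow_succ]
    exact mul_le_mul (ih (φ x)) (hab x).2 (jacobian_nonneg _ _) (pow_nonneg hb.le n)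

lemma bddBelow_log_jacobian_add (k : ℕ) : BddBelow (Set.range fun x ↦
    Real.log (jacobian (d := d) φ x) + (k : ℝ) * Real.log (expansionConst (d := d) φ x)) := by
  obtain ⟨a, _, ha, _, hab⟩ := he.exists_expansionConst_bounds hd h
  obtain ⟨a', _, ha', _, hab'⟩ := h.exists_jacobian_bounds
  refine ⟨Real.log a' + k * Real.log a, ?_⟩
  rintro _ ⟨x, rfl⟩
  exact add_le_add (Real.log_le_log ha' (hab' x).1)
    (mul_le_mul_of_nonneg_left (Real.log_le_log ha (hab x).1) k.cast_nonneg)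

lemma tendsto_expansionVolumeSeq (k : ℕ) : Tendsto (expansionVolumeSeq (d := d) φ k) atTop
    (𝓝 (expansionVolumeRate (d := d) φ k)) := by
  have hb : ∀ n, _ := fun n ↦ he.bddBelow_log_jacobian_add hd (h.iterate n) k
  obtain ⟨B, hB⟩ := he.log_expansionConst_iterate_le hd h
  obtain ⟨B', hB'⟩ := h.log_jacobian_iterate_le
  refine tendsto_nhds_limUnder
    (exists_tendsto_of_superadditive (B := B' + k * B) (fun p q ↦ ?_) fun n ↦ ?_)
  · refine le_ciInf fun x ↦ ?_
    refine (add_le_add (ciInf_le (hb p) (φ^[q] x)) (ciInf_le (hb q) x)).trans ?_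
    have hEp := he.expansionConst_pos hd (h.iterate p) (φ^[q] x)
    have hEq := he.expansionConst_pos hd (h.iterate q) x
    have h1 : Real.log (expansionConst (d := d) φ^[p] (φ^[q] x))
        + Real.log (expansionConst (d := d) φ^[q] x)
        ≤ Real.log (expansionConst (d := d) φ^[p + q] x) := by
      rw [← Real.log_mul hEp.ne' hEq.ne', Function.iterate_add]
      exact Real.log_le_log (mul_pos hEp hEq) (mul_expansionConst_le hd
        ((h.iterate p).mdifferentiable _) ((h.iterate q).mdifferentiable _))
    have h2 : Real.log (jacobian (d := d) φ^[p + q] x)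
        = Real.log (jacobian (d := d) φ^[p] (φ^[q] x)) + Real.log (jacobian (d := d) φ^[q] x) := by
      rw [Function.iterate_add, jacobian_comp ((h.iterate p).mdifferentiable _)
        ((h.iterate q).mdifferentiable _), Real.log_mul ((h.iterate p).jacobian_pos _).ne'
        ((h.iterate q).jacobian_pos _).ne']
    have h3 := mul_le_mul_of_nonneg_left h1 (k.cast_nonneg (α := ℝ))
    linarith
  · refine (ciInf_le (hb n) (Classical.arbitrary M)).trans ?_
    have h3 := mul_le_mul_of_nonneg_left (hB n (Classical.arbitrary M)) (k.cast_nonneg (α := ℝ))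
    linarith [hB' n (Classical.arbitrary M)]

/-- The infimum in `expansionVolumeSeq` bounds `J⁻¹ * E⁻ᵏ` for the iterate `φ^[n]`. -/
lemma inv_jacobian_mul_pow_le (k n : ℕ) (hn : 0 < n) (x : M) :
    (jacobian (d := d) φ^[n] x)⁻¹ * (expansionConst (d := d) φ^[n] x)⁻¹ ^ k
      ≤ Real.exp (-expansionVolumeSeq (d := d) φ k n) ^ n := by
  have hE := he.expansionConst_pos hd (h.iterate n) x
  have hJ := (h.iterate n).jacobian_pos x
  have hn' : (n : ℝ) ≠ 0 := by exact_mod_cast hn.ne'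
  rw [← Real.exp_nat_mul, expansionVolumeSeq]
  have h1 := ciInf_le (he.bddBelow_log_jacobian_add hd (h.iterate n) k) x
  rw [← Real.exp_log hJ, ← Real.exp_log hE, ← Real.exp_neg, ← Real.exp_neg, ← Real.exp_nat_mul,
    ← Real.exp_add, Real.exp_le_exp]
  have h2 : ∀ t : ℝ, (n : ℝ) * -(1 / (n : ℝ) * t) = -t := fun t ↦ by field_simp
  rw [h2]
  linarith

end IsNormAtlas

end Rates

/-! ### Bounded distortion for expanding maps -/

section Distortion

section Cone

lemma IsNormAtlas.differentiableAt_comp_symm {d : ℕ} {M : Type*} [TopologicalSpace M]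
    [ChartedSpace (EuclideanSpace ℝ (Fin d)) M] {m : ℕ}
    {e : Fin m → OpenPartialHomeomorph M (EuclideanSpace ℝ (Fin d))} (he : IsNormAtlas e)
    {v : M → ℝ} (hv : ContMDiff (𝓡 d) 𝓘(ℝ, ℝ) ((1 : ℕ) : WithTop ℕ∞) v) {i : Fin m}
    {p : EuclideanSpace ℝ (Fin d)} (hp : p ∈ (e i).target) :
    DifferentiableAt ℝ (v ∘ (e i).symm) p :=
  (he.contDiffAt_comp_symm hp hv).differentiableAt (by simp)

variable {d : ℕ} {M : Type*} [TopologicalSpace M] [ChartedSpace (EuclideanSpace ℝ (Fin d)) M]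
  [RiemannianBundle (fun x : M ↦ TangentSpace (𝓡 d) x)]
  {m : ℕ} {e : Fin m → OpenPartialHomeomorph M (EuclideanSpace ℝ (Fin d))}

/-- The cone of positive `C^1` functions `v` with `‖D log v‖ ≤ Q` for the Riemannian metric, the
inequality being read in the charts of an atlas. -/
structure InLogLipschitzCone
    (e : Fin m → OpenPartialHomeomorph M (EuclideanSpace ℝ (Fin d))) (Q : ℝ) (v : M → ℝ) :
    Prop where
  pos : ∀ x, 0 < v x
  contMDiff : ContMDiff (𝓡 d) 𝓘(ℝ, ℝ) ((1 : ℕ) : WithTop ℕ∞) v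
  abs_fderiv_le : ∀ i, ∀ p ∈ Metric.closedBall (0 : EuclideanSpace ℝ (Fin d)) 1,
    ∀ u : EuclideanSpace ℝ (Fin d), |fderiv ℝ (v ∘ (e i).symm) p u|
      ≤ Q * v ((e i).symm p) * ‖mfderiv (𝓡 d) (𝓡 d) (e i).symm p u‖

lemma inLogLipschitzCone_one {Q : ℝ} (hQ : 0 ≤ Q) :
    InLogLipschitzCone e Q (fun _ : M ↦ (1 : ℝ)) where
  pos _ := one_pos
  contMDiff := contMDiff_const
  abs_fderiv_le i p _ u := by
    have h1 : (fun _ : M ↦ (1 : ℝ)) ∘ (e i).symm = fun _ ↦ 1 := rfl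
    rw [h1, fderiv_fun_const]
    simpa using mul_nonneg hQ (norm_nonneg _)

end Cone

variable {d : ℕ} {M : Type*} [TopologicalSpace M] [ChartedSpace (EuclideanSpace ℝ (Fin d)) M]
  [IsManifold (𝓡 d) ∞ M] [RiemannianBundle (fun x : M ↦ TangentSpace (𝓡 d) x)]
  {m : ℕ} {e : Fin m → OpenPartialHomeomorph M (EuclideanSpace ℝ (Fin d))}

omit [IsManifold (𝓡 d) ∞ M] in
/-- The pointwise form of the contraction of the cones under the transfer operator, for one inverse
branch `b` read in the charts `i` and `j`. -/
lemma IsNormAtlas.abs_fderiv_branch_le (he : IsNormAtlas e) {G Q : ℝ} (hG : 0 ≤ G) (hQ : 0 ≤ Q)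
    {w v : M → ℝ} (hw : InLogLipschitzCone e G w) (hv : InLogLipschitzCone e Q v) {lam : ℝ}
    (hlam : 0 < lam) {ψ b : M → M} {i j : Fin m} {p : EuclideanSpace ℝ (Fin d)}
    (hp : p ∈ Metric.closedBall 0 1) (hb : MDifferentiableAt (𝓡 d) (𝓡 d) b ((e i).symm p))
    (hψ : MDifferentiableAt (𝓡 d) (𝓡 d) ψ (b ((e i).symm p)))
    (hψb : ∀ᶠ y in 𝓝 ((e i).symm p), ψ (b y) = y)
    (hE : lam ≤ expansionConst (d := d) ψ (b ((e i).symm p)))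
    (hsrc : b ((e i).symm p) ∈ (e j).source)
    (hball : e j (b ((e i).symm p)) ∈ Metric.closedBall 0 1) (u : EuclideanSpace ℝ (Fin d)) :
    DifferentiableAt ℝ (fun q ↦ w (b ((e i).symm q)) * v (b ((e i).symm q))) p ∧
    |fderiv ℝ (fun q ↦ w (b ((e i).symm q)) * v (b ((e i).symm q))) p u|
      ≤ (G + Q) / lam * (w (b ((e i).symm p)) * v (b ((e i).symm p))) *
        ‖mfderiv (𝓡 d) (𝓡 d) (e i).symm p u‖ := by
  set H : EuclideanSpace ℝ (Fin d) → EuclideanSpace ℝ (Fin d) := e j ∘ b ∘ (e i).symm with hHdef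
  have hsymm : MDifferentiableAt (𝓡 d) (𝓡 d) (e i).symm p :=
    (mdifferentiable_of_mem_maximalAtlas (he.smooth i)).symm.mdifferentiableAt (he.mem_target hp)
  have hbs : MDifferentiableAt (𝓡 d) (𝓡 d) (b ∘ (e i).symm) p := hb.comp p hsymm
  have hej : MDifferentiableAt (𝓡 d) (𝓡 d) (e j) ((b ∘ (e i).symm) p) :=
    (mdifferentiable_of_mem_maximalAtlas (he.smooth j)).mdifferentiableAt hsrc
  have hH : DifferentiableAt ℝ H p := (hej.comp p hbs).differentiableAt
  have hHp : (e j).symm (H p) = b ((e i).symm p) := (e j).left_inv hsrc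
  have hHt : H p ∈ (e j).target := (e j).map_source hsrc
  have dw := he.differentiableAt_comp_symm hw.contMDiff hHt
  have dv := he.differentiableAt_comp_symm hv.contMDiff hHt
  have heq : (fun q ↦ w (b ((e i).symm q)) * v (b ((e i).symm q))) =ᶠ[𝓝 p]
      fun q ↦ (w ∘ (e j).symm) (H q) * (v ∘ (e j).symm) (H q) := by
    filter_upwards [hbs.continuousAt ((e j).open_source.mem_nhds hsrc)] with q hq
    have hq' : (e j).symm (H q) = b ((e i).symm q) := (e j).left_inv hq
    simp only [Function.comp_apply, hq']
  have hder := (dw.hasFDerivAt.comp p hH.hasFDerivAt).mul (dv.hasFDerivAt.comp p hH.hasFDerivAt)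
  have hder' := hder.congr_of_eventuallyEq heq
  refine ⟨hder'.differentiableAt, ?_⟩
  rw [hder'.fderiv]
  set n := ‖mfderiv (𝓡 d) (𝓡 d) (e j).symm (H p) (fderiv ℝ H p u)‖
  set N := ‖mfderiv (𝓡 d) (𝓡 d) (e i).symm p u‖
  have hn : lam * n ≤ N := (mul_le_mul_of_nonneg_right hE (norm_nonneg _)).trans
    (he.expansionConst_mul_norm_branch_le hp hb hψ hψb hsrc u)
  have h1 := hw.abs_fderiv_le j (H p) hball (fderiv ℝ H p u)
  have h2 := hv.abs_fderiv_le j (H p) hball (fderiv ℝ H p u)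
  have hwH : w ((e j).symm (H p)) = w (b ((e i).symm p)) := by rw [hHp]
  have hvH : v ((e j).symm (H p)) = v (b ((e i).symm p)) := by rw [hHp]
  rw [hwH] at h1
  rw [hvH] at h2
  set W := w (b ((e i).symm p))
  set X := v (b ((e i).symm p))
  have hW : 0 < W := hw.pos _
  have hX : 0 < X := hv.pos _
  calc _ = |W * fderiv ℝ (v ∘ (e j).symm) (H p) (fderiv ℝ H p u)
        + X * fderiv ℝ (w ∘ (e j).symm) (H p) (fderiv ℝ H p u)| := by
        simp only [_root_.add_apply, _root_.smul_apply,
          ContinuousLinearMap.comp_apply, smul_eq_mul, Function.comp_apply, hHp, W, X]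
    _ ≤ W * (Q * X * n) + X * (G * W * n) := by
        refine (abs_add_le _ _).trans ?_
        rw [abs_mul, abs_mul, abs_of_pos hW, abs_of_pos hX]
        exact add_le_add (mul_le_mul_of_nonneg_left h2 hW.le)
          (mul_le_mul_of_nonneg_left h1 hX.le)
    _ = (G + Q) * (W * X) / lam * (lam * n) := by field_simp; ring
    _ ≤ (G + Q) * (W * X) / lam * N := by gcongr
    _ = _ := by ring

omit [IsManifold (𝓡 d) ∞ M] in
/-- On a chart ball, the oscillation of the logarithm of a function of the cone is bounded. -/
lemma IsNormAtlas.le_exp_mul_of_mem_chartBall (he : IsNormAtlas e) {C : ℝ} (hC : 0 ≤ C)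
    (hCb : ∀ i, ∀ p ∈ Metric.closedBall (0 : EuclideanSpace ℝ (Fin d)) 1,
      ∀ u : EuclideanSpace ℝ (Fin d), ‖mfderiv (𝓡 d) (𝓡 d) (e i).symm p u‖ ≤ C * ‖u‖)
    {Q : ℝ} (hQ : 0 ≤ Q) {v : M → ℝ} (hv : InLogLipschitzCone e Q v) {i : Fin m} {x y : M}
    (hx : x ∈ chartBall e i) (hy : y ∈ chartBall e i) : v x ≤ Real.exp (Q * C * 2) * v y := by
  set f : EuclideanSpace ℝ (Fin d) → ℝ := fun p ↦ Real.log ((v ∘ (e i).symm) p)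
  have hd : ∀ p ∈ Metric.ball (0 : EuclideanSpace ℝ (Fin d)) 1,
      HasFDerivAt f (((v ∘ (e i).symm) p)⁻¹ • fderiv ℝ (v ∘ (e i).symm) p) p := fun p hp ↦
    (he.differentiableAt_comp_symm hv.contMDiff
      (he.mem_target (Metric.ball_subset_closedBall hp))).hasFDerivAt.log (hv.pos _).ne'
  have hbound : ∀ p ∈ Metric.ball (0 : EuclideanSpace ℝ (Fin d)) 1, ‖fderiv ℝ f p‖ ≤ Q * C := by
    intro p hp
    rw [(hd p hp).fderiv]
    refine ContinuousLinearMap.opNorm_le_bound _ (mul_nonneg hQ hC) fun u ↦ ?_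
    have hp' := Metric.ball_subset_closedBall hp
    have h1 := (hv.abs_fderiv_le i p hp' u).trans (mul_le_mul_of_nonneg_left (hCb i p hp' u)
      (mul_nonneg hQ (hv.pos _).le))
    have h2 := hv.pos ((e i).symm p)
    rw [_root_.smul_apply, smul_eq_mul, norm_mul, norm_inv, Function.comp_apply,
      Real.norm_of_nonneg h2.le, Real.norm_eq_abs, inv_mul_le_iff₀ h2]
    linarith
  have h1 := (convex_ball (0 : EuclideanSpace ℝ (Fin d)) 1).norm_image_sub_le_of_norm_fderiv_le
    (fun p hp ↦ (hd p hp).differentiableAt) hbound hy.2 hx.2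
  have h2 : ‖e i x - e i y‖ ≤ 2 := by
    have h3 := mem_ball_zero_iff.1 hx.2
    have h4 := mem_ball_zero_iff.1 hy.2
    exact (norm_sub_le _ _).trans (by linarith)
  have h3 : ∀ z ∈ chartBall e i, f (e i z) = Real.log (v z) := fun z hz ↦ by
    simp only [f, Function.comp_apply, (e i).left_inv hz.1]
  rw [h3 x hx, h3 y hy] at h1
  have h4 := (le_abs_self _).trans (h1.trans (mul_le_mul_of_nonneg_left h2 (mul_nonneg hQ hC)))
  rw [← Real.exp_log (hv.pos x), ← Real.exp_log (hv.pos y), ← Real.exp_add, Real.exp_le_exp]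
  linarith

variable [T2Space M] [CompactSpace M]

omit [RiemannianBundle (fun x : M ↦ TangentSpace (𝓡 d) x)] in
lemma IsRegularMap.wtransfer_pos [ConnectedSpace M] {r : ℕ} {ψ : M → M} (h : IsRegularMap d r ψ)
    {w v : M → ℝ} (hw : ∀ x, 0 < w x) (hv : ∀ x, 0 < v x) (y : M) : 0 < wtransfer ψ w v y := by
  rw [h.wtransfer_apply]
  refine Finset.sum_pos (fun x _ ↦ mul_pos (hw x) (hv x)) (Finset.card_pos.1 ?_)
  have h1 : Classical.arbitrary M ∈ h.fiber (ψ (Classical.arbitrary M)) := by simp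
  rw [h.card_fiber y, ← h.card_fiber (ψ (Classical.arbitrary M))]
  exact Finset.card_pos.2 ⟨_, h1⟩

/-- Transfer operators of expanding maps contract the logarithmic derivative. -/
lemma IsNormAtlas.inLogLipschitzCone_wtransfer [ConnectedSpace M] (he : IsNormAtlas e) {r : ℕ}
    {ψ : M → M} (h : IsRegularMap d r ψ) {G Q : ℝ} (hG : 0 ≤ G) (hQ : 0 ≤ Q) {w v : M → ℝ}
    (hw : InLogLipschitzCone e G w) (hv : InLogLipschitzCone e Q v) {lam : ℝ} (hlam : 0 < lam)
    (hE : ∀ x, lam ≤ expansionConst (d := d) ψ x) :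
    InLogLipschitzCone e ((G + Q) / lam) (wtransfer ψ w v) where
  pos := h.wtransfer_pos hw.pos hv.pos
  contMDiff := h.wtransfer_contMDiff h.one_le hw.contMDiff hv.contMDiff
  abs_fderiv_le i p hp u := by
    obtain ⟨V, hVo, hyV, b, hb, hsum⟩ := h.exists_wtransfer_eq_sum ((e i).symm p)
    have hc : ContinuousAt (e i).symm p := (e i).symm.continuousAt (he.mem_target hp)
    have heq : wtransfer ψ w v ∘ (e i).symm =ᶠ[𝓝 p] fun q ↦ ∑ a ∈ h.fiber ((e i).symm p),
        w (b a ((e i).symm q)) * v (b a ((e i).symm q)) := by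
      filter_upwards [hc (hVo.mem_nhds hyV)] with q hq
      rw [Function.comp_apply, h.wtransfer_apply, hsum (fun x ↦ w x * v x) _ hq]
    have hbr : ∀ a ∈ h.fiber ((e i).symm p),
        DifferentiableAt ℝ (fun q ↦ w (b a ((e i).symm q)) * v (b a ((e i).symm q))) p ∧
        |fderiv ℝ (fun q ↦ w (b a ((e i).symm q)) * v (b a ((e i).symm q))) p u|
          ≤ (G + Q) / lam * (w (b a ((e i).symm p)) * v (b a ((e i).symm p))) *
            ‖mfderiv (𝓡 d) (𝓡 d) (e i).symm p u‖ := by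
      intro a ha
      obtain ⟨j, hj, hjb⟩ := he.cover (b a ((e i).symm p))
      exact he.abs_fderiv_branch_le hG hQ hw hv hlam hp
        ((hb _ hyV a ha).2.2.mdifferentiableAt h.ne_zero) (h.mdifferentiable _)
        (by filter_upwards [hVo.mem_nhds hyV] with y hy using (hb y hy a ha).2.1) (hE _) hj
        (Metric.ball_subset_closedBall hjb) u
    rw [heq.fderiv_eq, fderiv_fun_sum fun a ha ↦ (hbr a ha).1, _root_.sum_apply,
      h.wtransfer_apply, hsum (fun x ↦ w x * v x) _ hyV, Finset.mul_sum, Finset.sum_mul]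
    exact (Finset.abs_sum_le_sum_abs _ _).trans (Finset.sum_le_sum fun a ha ↦ (hbr a ha).2)

variable [IsContMDiffRiemannianBundle (𝓡 d) ∞ (EuclideanSpace ℝ (Fin d))
    (fun x : M ↦ TangentSpace (𝓡 d) x)]

omit [T2Space M] [CompactSpace M] in
lemma IsNormAtlas.exists_inLogLipschitzCone (he : IsNormAtlas e) {w : M → ℝ} (hpos : ∀ x, 0 < w x)
    (hw : ContMDiff (𝓡 d) 𝓘(ℝ, ℝ) ((1 : ℕ) : WithTop ℕ∞) w) :
    ∃ G, 0 ≤ G ∧ InLogLipschitzCone e G w := by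
  obtain ⟨c, C, hc, hC, hcC⟩ := he.exists_norm_bounds
  have hB : ∀ i, ∃ B, ∀ p ∈ Metric.closedBall (0 : EuclideanSpace ℝ (Fin d)) 1,
      ‖((w ∘ (e i).symm) p)⁻¹ • fderiv ℝ (w ∘ (e i).symm) p‖ ≤ B := by
    intro i
    refine (isCompact_closedBall _ _).exists_bound_of_continuousOn fun p hp ↦ ?_
    have h1 := he.contDiffAt_comp_symm (he.mem_target (i := i) hp) hw
    have h2 : ContinuousAt (fderiv ℝ (w ∘ (e i).symm)) p :=
      (h1.fderiv_right (m := 0) (by simp)).continuousAt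
    exact ((h1.continuousAt.inv₀ (hpos _).ne').smul h2).continuousWithinAt
  choose B hB using hB
  refine ⟨(∑ i, |B i|) / c, div_nonneg (Finset.sum_nonneg fun _ _ ↦ abs_nonneg _) hc.le,
    hpos, hw, fun i p hp u ↦ ?_⟩
  have hw0 := hpos ((e i).symm p)
  have h1 : ‖fderiv ℝ (w ∘ (e i).symm) p‖ ≤ w ((e i).symm p) * ∑ i, |B i| := by
    have h2 := (hB i p hp).trans ((le_abs_self _).trans (Finset.single_le_sum
      (f := fun i ↦ |B i|) (fun _ _ ↦ abs_nonneg _) (Finset.mem_univ i)))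
    rwa [norm_smul, norm_inv, Function.comp_apply, Real.norm_of_nonneg hw0.le,
      inv_mul_le_iff₀ hw0] at h2
  have h3 := (hcC i p hp u).1
  calc |fderiv ℝ (w ∘ (e i).symm) p u| ≤ ‖fderiv ℝ (w ∘ (e i).symm) p‖ * ‖u‖ :=
        (Real.norm_eq_abs _).symm.trans_le (ContinuousLinearMap.le_opNorm _ _)
    _ ≤ (w ((e i).symm p) * ∑ i, |B i|) * ‖u‖ := by gcongr
    _ = (∑ i, |B i|) / c * w ((e i).symm p) * (c * ‖u‖) := by field_simp
    _ ≤ _ := mul_le_mul_of_nonneg_left h3 (mul_nonneg (div_nonneg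
        (Finset.sum_nonneg fun _ _ ↦ abs_nonneg _) hc.le) hw0.le)

/-- The weight `1/J` of a `C^1` map is merely continuous; it is uniformly close to a `C^1`
weight. -/
lemma IsRegularMap.exists_contMDiff_weight {r : ℕ} {ψ : M → M} (h : IsRegularMap d r ψ) {s : ℝ}
    (hs : 1 < s) : ∃ w : M → ℝ, ContMDiff (𝓡 d) 𝓘(ℝ, ℝ) ((1 : ℕ) : WithTop ℕ∞) w ∧
      ∀ x, (jacobian (d := d) ψ x)⁻¹ ≤ s * w x ∧ w x ≤ s * (jacobian (d := d) ψ x)⁻¹ := by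
  have hcont : Continuous fun x ↦ (jacobian (d := d) ψ x)⁻¹ := h.contMDiff_inv_jacobian.continuous
  have hs0 : 0 < s := one_pos.trans hs
  obtain ⟨g, hg⟩ := exists_contMDiffMap_forall_mem_convex_of_local_const (n := (⊤ : ℕ∞)) (𝓡 d)
    (t := fun x ↦ Set.Icc (s⁻¹ * (jacobian (d := d) ψ x)⁻¹) (s * (jacobian (d := d) ψ x)⁻¹))
    (fun x ↦ convex_Icc _ _) (fun x ↦ by
      have hJ : 0 < (jacobian (d := d) ψ x)⁻¹ := inv_pos.2 (h.jacobian_pos x)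
      refine ⟨(jacobian (d := d) ψ x)⁻¹, ?_⟩
      have h1 : s⁻¹ * (jacobian (d := d) ψ x)⁻¹ < (jacobian (d := d) ψ x)⁻¹ :=
        mul_lt_of_lt_one_left hJ (inv_lt_one_of_one_lt₀ hs)
      have h2 : (jacobian (d := d) ψ x)⁻¹ < s * (jacobian (d := d) ψ x)⁻¹ :=
        lt_mul_of_one_lt_left hJ hs
      filter_upwards [(hcont.const_mul s⁻¹).continuousAt.eventually_lt_const h1,
        (hcont.const_mul s).continuousAt.eventually_const_lt h2] with y h3 h4
      exact ⟨h3.le, h4.le⟩)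
  refine ⟨g, g.contMDiff.of_le (natCast_le_infty 1), fun x ↦ ⟨?_, (hg x).2⟩⟩
  exact (inv_mul_le_iff₀ hs0).1 (hg x).1

omit [IsContMDiffRiemannianBundle (𝓡 d) ∞ (EuclideanSpace ℝ (Fin d))
  (fun x : M ↦ TangentSpace (𝓡 d) x)] in
lemma IsRegularMap.transfer_iterate_succ {r : ℕ} {ψ : M → M} (h : IsRegularMap d r ψ) (n : ℕ)
    (ρ : M → ℝ) :
    transfer (d := d) ψ^[n + 1] ρ = transfer (d := d) ψ (transfer (d := d) ψ^[n] ρ) := by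
  rw [h.transfer_comp (h.iterate n), Function.iterate_succ']

/-- For an expanding map the iterates of the transfer operator grow subexponentially in sup norm:
the iterates of a nearby `C^1` weight stay in a cone, hence are comparable on each chart ball, and
the invariance of the volume bounds them from above at some point of the ball. -/
lemma IsNormAtlas.exists_transfer_iterate_one_le [ConnectedSpace M] (he : IsNormAtlas e) {r : ℕ}
    {ψ : M → M} (h : IsRegularMap d r ψ) {lam : ℝ} (hlam : 1 < lam)
    (hE : ∀ x, lam ≤ expansionConst (d := d) ψ x) {s : ℝ} (hs : 1 < s) :
    ∃ C : ℝ, 0 < C ∧ ∀ n y, transfer (d := d) ψ^[n] (fun _ ↦ 1) y ≤ C * (s ^ 2) ^ n := by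
  obtain ⟨w, hwC, hw⟩ := h.exists_contMDiff_weight hs
  have hs0 : 0 < s := one_pos.trans hs
  have hlam0 : 0 < lam := one_pos.trans hlam
  have hwpos : ∀ x, 0 < w x := fun x ↦
    pos_of_mul_pos_right ((inv_pos.2 (h.jacobian_pos x)).trans_le (hw x).1) hs0.le
  obtain ⟨G, hG, hGw⟩ := he.exists_inLogLipschitzCone hwpos hwC
  -- the fixed point of `Q ↦ (G + Q) / lam`
  set Q := G / (lam - 1) with hQdef
  have hlam1 : 0 < lam - 1 := sub_pos.2 hlam
  have hQ : 0 ≤ Q := div_nonneg hG hlam1.le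
  have hfix : (G + Q) / lam = Q := by
    rw [hQdef]
    field_simp
    ring
  set v : ℕ → M → ℝ := fun n ↦ (wtransfer ψ w)^[n] fun _ ↦ 1
  have hvsucc : ∀ n, v (n + 1) = wtransfer ψ w (v n) := fun n ↦
    Function.iterate_succ_apply' _ _ _
  have hcone : ∀ n, InLogLipschitzCone e Q (v n) := by
    intro n
    induction n with
    | zero => exact inLogLipschitzCone_one hQ
    | succ n ih =>
      rw [hvsucc, ← hfix]
      exact he.inLogLipschitzCone_wtransfer h hG hQ hGw ih hlam0 hE
  -- replacing `1/J` by `w` costs at most a factor `s` per iteration, in both directions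
  have hcmp : ∀ n y, transfer (d := d) ψ^[n] (fun _ ↦ 1) y ≤ s ^ n * v n y ∧
      v n y ≤ s ^ n * transfer (d := d) ψ^[n] (fun _ ↦ 1) y := by
    intro n
    induction n with
    | zero =>
      have h0 : ∀ y, transfer (d := d) ψ^[0] (fun _ ↦ 1) y = 1 := by
        intro y
        rw [transfer_eq_wtransfer, (h.iterate 0).wtransfer_apply]
        have : (h.iterate 0).fiber y = {y} := by
          ext x
          simp
        rw [this, Finset.sum_singleton, Function.iterate_zero, jacobian_id, inv_one, one_mul]
      intro y
      rw [h0]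
      simp [v]
    | succ n ih =>
      intro y
      rw [h.transfer_iterate_succ, hvsucc, transfer_eq_wtransfer, h.wtransfer_apply,
        h.wtransfer_apply, Finset.mul_sum, Finset.mul_sum]
      refine ⟨Finset.sum_le_sum fun x _ ↦ ?_, Finset.sum_le_sum fun x _ ↦ ?_⟩
      · have hJ := (inv_pos.2 (h.jacobian_pos x)).le
        have hv := (hcone n).pos x
        calc _ ≤ (s * w x) * (s ^ n * v n x) :=
              (mul_le_mul_of_nonneg_left (ih x).1 hJ).trans
                (mul_le_mul_of_nonneg_right (hw x).1 (by positivity))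
          _ = _ := by ring
      · have hJ := (inv_pos.2 (h.jacobian_pos x)).le
        have hT : 0 ≤ s ^ n * transfer (d := d) ψ^[n] (fun _ ↦ 1) x :=
          ((hcone n).pos x).le.trans (ih x).2
        calc _ ≤ (s * (jacobian (d := d) ψ x)⁻¹)
              * (s ^ n * transfer (d := d) ψ^[n] (fun _ ↦ 1) x) :=
              (mul_le_mul_of_nonneg_left (ih x).2 (hwpos x).le).trans
                (mul_le_mul_of_nonneg_right (hw x).2 hT)
          _ = _ := by ring
  obtain ⟨c, C, hc, hC, hcC⟩ := he.exists_norm_bounds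
  obtain ⟨κ, hκ, hκb⟩ := he.exists_le_mul_of_le_wtransfer
  set K := Real.exp (Q * C * 2)
  have hK : 0 < K := Real.exp_pos _
  refine ⟨K * κ, mul_pos hK hκ, fun n y ↦ ?_⟩
  obtain ⟨i, hi⟩ := he.cover y
  have hle : K⁻¹ * v n y ≤ κ * s ^ n := by
    refine hκb (h.iterate n) i (by positivity) fun z hz ↦ ?_
    rw [← transfer_eq_wtransfer]
    refine le_trans ?_ (hcmp n z).2
    rw [inv_mul_le_iff₀ hK]
    exact he.le_exp_mul_of_mem_chartBall hC.le (fun i p hp u ↦ (hcC i p hp u).2) hQ (hcone n)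
      hi hz
  rw [inv_mul_le_iff₀ hK] at hle
  calc _ ≤ s ^ n * v n y := (hcmp n y).1
    _ ≤ s ^ n * (K * (κ * s ^ n)) := mul_le_mul_of_nonneg_left hle (by positivity)
    _ = _ := by ring

end Distortion

/-! ### Bounds for the spectral radius -/

section SpectralRadius

lemma le_of_eventually_pow_le {R t K : ℝ} (hR : 0 ≤ R) (ht : 0 ≤ t)
    (h : ∀ᶠ n : ℕ in atTop, R ^ n ≤ K * t ^ n) : R ≤ t := by
  by_contra! hlt
  have hR0 : 0 < R := ht.trans_lt hlt
  have h1 : Tendsto (fun n : ℕ ↦ K * (t / R) ^ n) atTop (𝓝 (K * 0)) :=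
    (tendsto_pow_atTop_nhds_zero_of_lt_one (div_nonneg ht hR)
      ((div_lt_one hR0).2 hlt)).const_mul K
  have h2 : (1 : ℝ) ≤ K * 0 := by
    refine ge_of_tendsto h1 (h.mono fun n hn ↦ ?_)
    rw [div_pow, ← mul_div_assoc, one_le_div (pow_pos hR0 n)]
    exact hn
  linarith

variable {d : ℕ} {M : Type*} [TopologicalSpace M] [ChartedSpace (EuclideanSpace ℝ (Fin d)) M]
  [IsManifold (𝓡 d) ∞ M] [T2Space M] [CompactSpace M] [ConnectedSpace M]

lemma IsRegularMap.card_fiber_iterate {r : ℕ} {φ : M → M} (h : IsRegularMap d r φ) (n : ℕ)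
    (y : M) : ((h.iterate n).fiber y).card = degree φ ^ n := by
  induction n generalizing y with
  | zero =>
    have : (h.iterate 0).fiber y = {y} := by
      ext x
      simp
    rw [this, Finset.card_singleton, pow_zero]
  | succ n ih =>
    have h1 := (h.iterate n).sum_fiber_comp h (fun _ ↦ (1 : ℝ)) y
    simp only [Finset.sum_const, nsmul_eq_mul, mul_one, h.card_fiber, ih] at h1
    rw [pow_succ]
    exact_mod_cast h1.symm

variable [RiemannianBundle (fun x : M ↦ TangentSpace (𝓡 d) x)]
  [IsContMDiffRiemannianBundle (𝓡 d) ∞ (EuclideanSpace ℝ (Fin d))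
    (fun x : M ↦ TangentSpace (𝓡 d) x)]
  {m : ℕ} {e : Fin m → OpenPartialHomeomorph M (EuclideanSpace ℝ (Fin d))}

/-- With respect to the filtration by the order of differentiation, the transfer operator is
triangular up to lower order terms. The constant `K` depends on the atlas only. -/
lemma IsNormAtlas.exists_triangular (hd : 1 ≤ d) (he : IsNormAtlas e) (r : ℕ) :
    ∃ K : ℝ, 0 < K ∧ ∀ (φ : M → M) (h : IsRegularMap d r φ) (S : ℝ),
      (∀ k < r, ∀ y, ∑ x ∈ h.fiber y, (jacobian (d := d) φ x)⁻¹ *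
        (expansionConst (d := d) φ x)⁻¹ ^ k ≤ S) →
      0 ≤ K * S ∧ ∃ D : ℝ, 0 ≤ D ∧ ∀ k < r, ∀ ρ : CkSpace d M (r - 1),
        chartSeminorm e k (h.transferOp ρ) ≤ K * S * chartSeminorm e k ρ
          + D * ∑ j ∈ Finset.range k, chartSeminorm e j ρ := by
  choose K hK hest using fun k ↦ he.exists_seminorm_estimate hd k
  have hKle : ∀ k < r, K k ≤ 1 + ∑ k ∈ Finset.range r, K k := fun k hk ↦
    (Finset.single_le_sum (f := K) (fun k _ ↦ (hK k).le) (Finset.mem_range.2 hk)).trans (by simp)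
  have hK0 : 0 < 1 + ∑ k ∈ Finset.range r, K k :=
    add_pos_of_pos_of_nonneg one_pos (Finset.sum_nonneg fun k _ ↦ (hK k).le)
  refine ⟨1 + ∑ k ∈ Finset.range r, K k, hK0, fun φ h S hS ↦ ?_⟩
  have hS0 : 0 ≤ S := by
    refine le_trans ?_ (hS 0 h.one_le (Classical.arbitrary M))
    exact Finset.sum_nonneg fun x _ ↦ mul_nonneg (inv_nonneg.2 (h.jacobian_pos x).le)
      (pow_nonneg (inv_nonneg.2 (expansionConst_nonneg _ _)) _)
  have hex : ∀ k < r, ∃ D : ℝ, 0 ≤ D ∧ ∀ ρ : CkSpace d M (r - 1),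
      chartSeminorm e k (h.transferOp ρ) ≤ K k * S * chartSeminorm e k ρ
        + D * ∑ j ∈ Finset.range k, chartSeminorm e j ρ := by
    intro k hk
    have hkr : ((k : ℕ) : WithTop ℕ∞) ≤ ((r - 1 : ℕ) : WithTop ℕ∞) := by
      exact_mod_cast (by omega : k ≤ r - 1)
    obtain ⟨D, hD, hD'⟩ := hest k r φ h (fun x ↦ (jacobian (d := d) φ x)⁻¹) S hk
      (h.contMDiff_inv_jacobian.of_le hkr) fun y ↦ by
        refine le_trans (le_of_eq (Finset.sum_congr rfl fun x _ ↦ ?_)) (hS k hk y)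
        rw [abs_of_pos (inv_pos.2 (h.jacobian_pos x))]
    refine ⟨D, hD, fun ρ ↦ ?_⟩
    rw [h.coe_transferOp]
    exact hD' ρ (ρ.contMDiff.of_le hkr)
  choose! D hD hDest using hex
  refine ⟨mul_nonneg hK0.le hS0, ∑ k ∈ Finset.range r, D k, Finset.sum_nonneg fun k hk ↦
    hD k (Finset.mem_range.1 hk), fun k hk ρ ↦ (hDest k hk ρ).trans (add_le_add ?_ ?_)⟩
  · exact mul_le_mul_of_nonneg_right (mul_le_mul_of_nonneg_right (hKle k hk) hS0)
      (chartSeminorm_nonneg _ _)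
  · exact mul_le_mul_of_nonneg_right (Finset.single_le_sum (f := D)
      (fun k hk ↦ hD k (Finset.mem_range.1 hk)) (Finset.mem_range.2 hk))
      (Finset.sum_nonneg fun j _ ↦ chartSeminorm_nonneg _ _)

section

variable (hd : 1 ≤ d) (he : IsNormAtlas e) {r : ℕ} {φ : M → M} (h : IsRegularMap d r φ)
  {N : Seminorm ℝ (CkSpace d M (r - 1))} {a b : ℝ} (ha : 0 < a) (hb : 0 < b)
  (hN : ∀ ρ : CkSpace d M (r - 1), a * ∑ j ∈ Finset.range r, chartSeminorm e j ρ ≤ N ρ ∧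
    N ρ ≤ b * ∑ j ∈ Finset.range r, chartSeminorm e j ρ)

include hd he ha hb hN

lemma IsRegularMap.isBoundedOp_transferOp : IsBoundedOp N h.transferOp := by
  obtain ⟨K, hK, htri⟩ := he.exists_triangular hd r
  obtain ⟨c, _, hc, _, hcE⟩ := he.exists_expansionConst_bounds hd h
  obtain ⟨c', _, hc', _, hcJ⟩ := h.exists_jacobian_bounds
  have hS : ∀ k < r, ∀ y, ∑ x ∈ h.fiber y, (jacobian (d := d) φ x)⁻¹ *
      (expansionConst (d := d) φ x)⁻¹ ^ k
      ≤ ∑ k ∈ Finset.range r, degree φ * (c'⁻¹ * c⁻¹ ^ k) := by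
    intro k hk y
    refine le_trans ?_ (Finset.single_le_sum
      (f := fun k ↦ (degree φ : ℝ) * (c'⁻¹ * c⁻¹ ^ k)) (fun k _ ↦ by positivity)
      (Finset.mem_range.2 hk))
    rw [← h.card_fiber y, ← nsmul_eq_mul]
    refine Finset.sum_le_card_nsmul _ _ _ fun x _ ↦ ?_
    have := h.jacobian_pos x
    have := he.expansionConst_pos hd h x
    have := (hcE x).1
    have := (hcJ x).1
    gcongr
  obtain ⟨hα, D, hD, hest⟩ := htri φ h _ hS
  obtain ⟨C, -, hC⟩ := exists_pow_le_of_triangular (p := fun j ρ ↦ chartSeminorm e j ρ)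
    (B := h.transferOp) (fun _ _ ↦ chartSeminorm_nonneg _ _) ha hb hN hα hD hest (lt_add_one _)
  exact ⟨_, fun v ↦ by simpa using hC 1 v⟩

/-- The constant function `1` witnesses that the powers of the transfer operator do not decay,
since the volume is preserved. -/
lemma IsRegularMap.exists_le_opNorm_transferOp_pow :
    ∃ c : ℝ, 0 < c ∧ ∀ n, c ≤ opNorm N (h.transferOp ^ n) := by
  have hbdd := h.isBoundedOp_transferOp hd he ha hb hN
  have h1 : ∀ n, a ≤ opNorm N (h.transferOp ^ n) * N 1 := by
    intro n
    refine le_trans ?_ ((hbdd.pow n).le_opNorm 1)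
    refine le_trans ?_ (hN _).1
    rw [h.transferOp_pow]
    have h2 : 1 ≤ chartSeminorm e 0 ((h.iterate n).transferOp 1) := by
      refine he.one_le_of_wtransfer_one_le (h.iterate n) fun y ↦ ?_
      have h3 := he.abs_le_chartSeminorm_zero
        ((h.iterate n).transferOp (1 : CkSpace d M (r - 1))).contMDiff.continuous y
      refine le_trans ?_ ((le_abs_self _).trans h3)
      rw [(h.iterate n).coe_transferOp]
      exact le_rfl
    refine le_mul_of_one_le_right ha.le (h2.trans ?_)
    exact Finset.single_le_sum
      (f := fun j ↦ chartSeminorm e j ((h.iterate n).transferOp (1 : CkSpace d M (r - 1))))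
      (fun _ _ ↦ chartSeminorm_nonneg _ _) (Finset.mem_range.2 h.one_le)
  have hN1 : 0 < N 1 := by
    refine lt_of_le_of_ne (apply_nonneg N 1) fun h0 ↦ ?_
    have := h1 0
    rw [← h0, mul_zero] at this
    exact absurd this (not_le.2 ha)
  exact ⟨a / N 1, div_pos ha hN1, fun n ↦ (div_le_iff₀ hN1).2 (h1 n)⟩

lemma IsRegularMap.tendsto_radiusSeq_transferOp :
    Tendsto (radiusSeq N h.transferOp) atTop (𝓝 (specRadius N h.transferOp)) := by
  obtain ⟨c, hc, hcL⟩ := h.exists_le_opNorm_transferOp_pow hd he ha hb hN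
  exact (h.isBoundedOp_transferOp hd he ha hb hN).tendsto_radiusSeq hc hcL

lemma IsRegularMap.one_le_specRadius_transferOp : 1 ≤ specRadius N h.transferOp := by
  obtain ⟨c, hc, hcL⟩ := h.exists_le_opNorm_transferOp_pow hd he ha hb hN
  exact (h.isBoundedOp_transferOp hd he ha hb hN).one_le_specRadius hc hcL

/-- The powers of the transfer operator are transfer operators of iterates, and the constant of
the triangular estimate does not depend on the iterate. -/
lemma IsRegularMap.exists_specRadius_pow_le : ∃ K : ℝ, 0 < K ∧ ∀ n : ℕ, 0 < n → ∀ S : ℝ,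
    (∀ k < r, ∀ y, ∑ x ∈ (h.iterate n).fiber y, (jacobian (d := d) φ^[n] x)⁻¹ *
      (expansionConst (d := d) φ^[n] x)⁻¹ ^ k ≤ S) →
    specRadius N h.transferOp ^ n ≤ K * S := by
  obtain ⟨K, hK, htri⟩ := he.exists_triangular hd r
  refine ⟨K, hK, fun n hn S hS ↦ ?_⟩
  obtain ⟨hα, D, hD, hest⟩ := htri _ (h.iterate n) S hS
  refine specRadius_pow_le_of_triangular (p := fun j ρ ↦ chartSeminorm e j ρ)
    (h.tendsto_radiusSeq_transferOp hd he ha hb hN) hn (fun _ _ ↦ chartSeminorm_nonneg _ _)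
    ha hb hN hα hD fun k hk ρ ↦ ?_
  rw [h.transferOp_pow]
  exact hest k hk ρ

/-- The upper bound by the degree and the expansion volume rates. -/
lemma IsRegularMap.specRadius_le_degree_mul : specRadius N h.transferOp ≤
    (degree φ : ℝ) * ⨆ k : Fin r, Real.exp (-expansionVolumeRate (d := d) φ k) := by
  obtain ⟨K, hK, hpow⟩ := h.exists_specRadius_pow_le hd he ha hb hN
  set X := ⨆ k : Fin r, Real.exp (-expansionVolumeRate (d := d) φ k)
  have hX : ∀ k : Fin r, Real.exp (-expansionVolumeRate (d := d) φ k) ≤ X := fun k ↦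
    le_ciSup (f := fun k : Fin r ↦ Real.exp (-expansionVolumeRate (d := d) φ k))
      (Set.finite_range _).bddAbove k
  have hX0 : 0 < X := (Real.exp_pos _).trans_le (hX ⟨0, h.one_le⟩)
  have hR : 0 ≤ specRadius N h.transferOp :=
    zero_le_one.trans (h.one_le_specRadius_transferOp hd he ha hb hN)
  have key : ∀ Y, X < Y → specRadius N h.transferOp ≤ degree φ * Y := by
    intro Y hY
    have hY0 : 0 < Y := hX0.trans hY
    refine le_of_eventually_pow_le (K := K) hR (mul_nonneg (Nat.cast_nonneg _) hY0.le) ?_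
    have hev : ∀ᶠ n : ℕ in atTop, ∀ k : Fin r,
        Real.exp (-expansionVolumeSeq (d := d) φ k n) < Y :=
      Filter.eventually_all.2 fun k ↦ ((Real.continuous_exp.tendsto _).comp
        (he.tendsto_expansionVolumeSeq hd h k).neg).eventually_lt_const ((hX k).trans_lt hY)
    filter_upwards [hev, eventually_gt_atTop 0] with n hn hn0
    refine hpow n hn0 _ fun k hk y ↦ ?_
    rw [mul_pow, ← Nat.cast_pow, ← h.card_fiber_iterate n y, ← nsmul_eq_mul]
    refine Finset.sum_le_card_nsmul _ _ _ fun x _ ↦ ?_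
    exact (he.inv_jacobian_mul_pow_le hd h k n hn0 x).trans
      (pow_le_pow_left₀ (Real.exp_pos _).le (hn ⟨k, hk⟩).le n)
  have hcont : Tendsto (fun Y : ℝ ↦ degree φ * Y) (𝓝[>] X) (𝓝 (degree φ * X)) :=
    ((continuous_const.mul continuous_id).tendsto X).mono_left nhdsWithin_le_nhds
  exact ge_of_tendsto hcont (eventually_mem_nhdsWithin.mono fun Y hY ↦ key Y hY)

/-- For an expanding map the factors `E^{-k}` are at most `1`, so that the growth of the powers in
`C^{r-1}` is controlled by the growth in sup norm, which is subexponential. -/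
lemma IsRegularMap.specRadius_le_one (hexp : 0 < expansionRate (d := d) φ) :
    specRadius N h.transferOp ≤ 1 := by
  obtain ⟨K, hK, hpow⟩ := h.exists_specRadius_pow_le hd he ha hb hN
  have hR : 0 ≤ specRadius N h.transferOp :=
    zero_le_one.trans (h.one_le_specRadius_transferOp hd he ha hb hN)
  obtain ⟨n₀, hn₀, hpos⟩ := (((he.tendsto_expansionSeq hd h).eventually_const_lt hexp).and
    (eventually_gt_atTop 0)).exists
  have hlog : 0 < Real.log (⨅ x : M, expansionConst (d := d) φ^[n₀] x) :=
    pos_of_mul_pos_right hn₀ (by positivity)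
  have hlam : 1 < ⨅ x : M, expansionConst (d := d) φ^[n₀] x :=
    (Real.log_pos_iff (he.iInf_expansionConst_pos hd (h.iterate n₀)).le).1 hlog
  have hE : ∀ x, (⨅ x : M, expansionConst (d := d) φ^[n₀] x)
      ≤ expansionConst (d := d) φ^[n₀] x := fun x ↦
    ciInf_le ⟨0, by rintro _ ⟨x, rfl⟩; exact expansionConst_nonneg _ _⟩ x
  have hψ := h.iterate n₀
  have hE1 : ∀ n x, 1 ≤ expansionConst (d := d) (φ^[n₀])^[n] x := by
    intro n
    induction n with
    | zero =>
      intro x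
      rw [Function.iterate_zero, expansionConst_id hd]
    | succ n ih =>
      intro x
      rw [Function.iterate_succ]
      exact (one_le_mul_of_one_le_of_one_le (ih _) (hlam.le.trans (hE x))).trans
        (mul_expansionConst_le hd ((hψ.iterate n).mdifferentiable _) (hψ.mdifferentiable _))
  have key : ∀ s : ℝ, 1 < s → specRadius N h.transferOp ^ n₀ ≤ s ^ 2 := by
    intro s hs
    obtain ⟨C, hC, hCest⟩ := he.exists_transfer_iterate_one_le hψ hlam hE hs
    refine le_of_eventually_pow_le (K := K * C) (pow_nonneg hR _) (sq_nonneg s) ?_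
    filter_upwards [eventually_gt_atTop 0] with n hn
    rw [← pow_mul, mul_assoc]
    refine hpow (n₀ * n) (Nat.mul_pos hpos hn) _ fun k hk y ↦ ?_
    refine le_trans ?_ (hCest n y)
    rw [← Function.iterate_mul, transfer_eq_wtransfer, (h.iterate (n₀ * n)).wtransfer_apply]
    refine Finset.sum_le_sum fun x _ ↦ mul_le_mul_of_nonneg_left ?_
      (inv_nonneg.2 ((h.iterate (n₀ * n)).jacobian_pos x).le)
    rw [Function.iterate_mul]
    exact pow_le_one₀ (inv_nonneg.2 (expansionConst_nonneg _ _)) (inv_le_one_of_one_le₀ (hE1 n x))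
  have hcont : Tendsto (fun s : ℝ ↦ s ^ 2) (𝓝[>] 1) (𝓝 (1 ^ 2)) :=
    ((continuous_pow 2).tendsto 1).mono_left nhdsWithin_le_nhds
  have h1 := ge_of_tendsto hcont (eventually_mem_nhdsWithin.mono fun s hs ↦ key s hs)
  rw [one_pow] at h1
  exact (pow_le_one_iff_of_nonneg hR hpos.ne').1 h1

end

end SpectralRadius

end RuelleTransfer

end

theorem mainTheorem4 {d : ℕ} (hd : 1 ≤ d) {M : Type*} [TopologicalSpace M] [T2Space M]
    [CompactSpace M] [ConnectedSpace M] [ChartedSpace (EuclideanSpace ℝ (Fin d)) M]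
    [IsManifold (𝓡 d) ∞ M] [RiemannianBundle (fun x : M ↦ TangentSpace (𝓡 d) x)]
    [IsContMDiffRiemannianBundle (𝓡 d) ∞ (EuclideanSpace ℝ (Fin d))
      (fun x : M ↦ TangentSpace (𝓡 d) x)]
    (r : ℕ) (hr : 1 ≤ r) (φ : M → M) (hφ : ContMDiff (𝓡 d) (𝓡 d) (r : WithTop ℕ∞) φ)
    (hφ' : ∀ x, Function.Bijective (mfderiv (𝓡 d) (𝓡 d) φ x))
    (N : Seminorm ℝ (RuelleTransfer.CkSpace d M (r - 1)))
    (hN : RuelleTransfer.IsCkNorm (r - 1) N) :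
    -- the degree, the expansion rate and the expansion volume rates are well defined
    (∀ y, (φ ⁻¹' {y}).Finite ∧ (φ ⁻¹' {y}).ncard = RuelleTransfer.degree φ) ∧
    Tendsto (RuelleTransfer.expansionSeq (d := d) φ) atTop
      (𝓝 (RuelleTransfer.expansionRate (d := d) φ)) ∧
    (∀ k, Tendsto (RuelleTransfer.expansionVolumeSeq (d := d) φ k) atTop
      (𝓝 (RuelleTransfer.expansionVolumeRate (d := d) φ k))) ∧
    -- the transfer operator is a bounded operator on `C^{r-1}(M)` with a spectral radius
    ∃ L : Module.End ℝ (RuelleTransfer.CkSpace d M (r - 1)),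
      (∀ ρ y, L ρ y = RuelleTransfer.transfer (d := d) φ ρ y) ∧
      RuelleTransfer.IsBoundedOp N L ∧
      Tendsto (RuelleTransfer.radiusSeq N L) atTop (𝓝 (RuelleTransfer.specRadius N L)) ∧
      (0 < RuelleTransfer.expansionRate (d := d) φ → RuelleTransfer.specRadius N L = 1) ∧
      (RuelleTransfer.expansionRate (d := d) φ ≤ 0 →
        1 ≤ RuelleTransfer.specRadius N L ∧
        RuelleTransfer.specRadius N L ≤ (RuelleTransfer.degree φ : ℝ) *
          ⨆ k : Fin r, Real.exp (-RuelleTransfer.expansionVolumeRate (d := d) φ k)) := by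
  have h : RuelleTransfer.IsRegularMap d r φ := ⟨hφ, hφ', hr⟩
  obtain ⟨m, e, he, a, b, ha, hb, hab⟩ := hN
  have hN' : ∀ ρ : RuelleTransfer.CkSpace d M (r - 1),
      a * ∑ j ∈ Finset.range r, RuelleTransfer.chartSeminorm e j ρ ≤ N ρ ∧
        N ρ ≤ b * ∑ j ∈ Finset.range r, RuelleTransfer.chartSeminorm e j ρ := by
    intro ρ
    have h1 := hab ρ
    rwa [he.atlasNorm_eq_sum _ ρ.contMDiff.continuous, Nat.sub_add_cancel hr] at h1
  refine ⟨fun y ↦ ⟨h.finite_fiber y, h.ncard_fiber_eq y _⟩, he.tendsto_expansionSeq hd h,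
    he.tendsto_expansionVolumeSeq hd h, h.transferOp, h.transferOp_apply,
    h.isBoundedOp_transferOp hd he ha hb hN', h.tendsto_radiusSeq_transferOp hd he ha hb hN',
    fun hexp ↦ le_antisymm (h.specRadius_le_one hd he ha hb hN' hexp)
      (h.one_le_specRadius_transferOp hd he ha hb hN'),
    fun _ ↦ ⟨h.one_le_specRadius_transferOp hd he ha hb hN',
      h.specRadius_le_degree_mul hd he ha hb hN'⟩⟩
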